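/- Let $d\ge 1$ and let $\Omega\subset\mathbb{R}^d$ be a bounded open set whose boundary is of class $C^{3,\alpha}$ for some $\alpha\in(0,1)$. Let $\mu$ be a finite measure on $\Omega$ that is equivalent to Lebesgue measure, with $\log\frac{d\mu}{dx}$ (essentially) bounded. Write $H^2_{(0)}=H^2(\Omega,\mu)\cap H^1_0(\Omega,\mu)$, where $H^p(\Omega,\mu)$ consists of the functions whose weak derivatives of order $\le p$ lie in $L^2(\mu)$. Let $\mathcal{A}f=\sum_{i,j}a_{ij}\partial_i\partial_jf+\sum_i b_i\partial_if+a_0f$ be a second-order linear differential operator with measurable coefficients such that, for some $k>0$ and all $f_1,f_2\in H^2$, $|\mathcal{A}f_1(x)-\mathcal{A}f_2(x)|\le k\sum_{|\alpha|\le 2}|D_\alpha f_1(x)-D_\alpha f_2(x)|$ for a.e. $x\in\Omega$. (The subscript $b$ below means that the function and its derivatives up to the given order are bounded.) Let $\eta\in C^3_b(\mathbb{R}^d)$ satisfy $\eta>0$ in $\Omega$, $\eta=0$ on $\partial\Omega$ and $\nabla\eta\ne0$ on $\partial\Omega$. Let $\sigma\in C^4_b(\mathbb{R})$ be non-constant.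 Let $(c,w,b)$ be a random vector in $\mathbb{R}\times\mathbb{R}^d\times\mathbb{R}$ such that $|c|<K_0$ almost surely for some constant $K_0$, $\mathbb{E}[c]=0$, $\mathbb{P}((w,b)\in D)>0$ for every nonempty open $D\subseteq\mathbb{R}^{d+1}$, $\mathbb{E}|w_k|^4<\infty$ for each $k$, and $\mathbb{E}|b|<\infty$. Put $$U(x,y)=\mathbb{E}\Big[\nabla_{c,w,b}\,\mathcal{A}\big[\eta\, c\,\sigma(w\cdot\,\cdot\,+b)\big](x)\cdot\nabla_{c,w,b}\big[\eta(y)\,c\,\sigma(w\cdot y+b)\big]\Big],\qquad (\mathcal{U}f)(y)=\int_\Omega f(x)\,U(x,y)\,d\mu(x).$$ The wide-limit ODE of the Deep Galerkin Method (DGM) is $\frac{dQ_t}{dt}=-\mathcal{U}[\mathcal{A}Q_t-g]$, and $Q^*\in H^2_{(0)}$ is called a stationary point of it if $\mathcal{U}[\mathcal{A}Q^*-g]=0$ ($\mu$-almost everywhere). Suppose the PDE $\mathcal{A}u=g$ in $\Omega$, $u=0$ on $\partial\Omega$, has a solution $u\in H^2_{(0)}$ (the equation holding almost everywhere in $\Omega$).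 Then every stationary point $Q^*\in H^2_{(0)}$ of the wide-limit ODE is a solution of this PDE. In particular, $\int_\Omega(\mathcal{A}Q^*-g)^2d\mu=0$, so $Q^*$ is a global minimizer of $Q\mapsto\int_\Omega(\mathcal{A}Q-g)^2d\mu$ over $H^2_{(0)}$. -/

import Mathlib

open MeasureTheory Set
open scoped ContDiff ENNReal NNReal

noncomputable section

namespace DGM

/-- Euclidean space `ℝ^d`. -/
abbrev E (d : ℕ) := EuclideanSpace ℝ (Fin d)

/-- The classical partial derivative `∂_i φ`. -/
def partialD {d : ℕ} (i : Fin d) (φ : E d → ℝ) : E d → ℝ :=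
  fun x => fderiv ℝ φ x (EuclideanSpace.single i (1 : ℝ))

/-! ### The domain, the auxiliary function and the sampling measure -/

/-- The boundary of `Ω` is of class `C^{3,α}`: near each boundary point there are a unit vector `e`
(the "vertical" direction) and a function `γ` of the remaining coordinates, of class `C³` with
`α`-Hölder third derivative, such that `Ω` is locally the part strictly above the graph of `γ`. -/
def HasC3HolderBoundary {d : ℕ} (α : ℝ≥0) (Ω : Set (E d)) : Prop :=
  ∀ x₀ ∈ frontier Ω, ∃ r : ℝ, 0 < r ∧ ∃ e : E d, ‖e‖ = 1 ∧ ∃ γ : E d → ℝ,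
    ContDiff ℝ 3 γ ∧ (∃ K : ℝ≥0, HolderWith K α (iteratedFDeriv ℝ 3 γ)) ∧
    ∀ x ∈ Metric.ball x₀ r, (x ∈ Ω ↔ γ (x - (inner ℝ e x : ℝ) • e) < inner ℝ e x)

/-- `f ∈ C^n_b(F)`: `f` is of class `C^n` and all its derivatives of order `≤ n` are bounded. -/
def IsCnb {F : Type*} [NormedAddCommGroup F] [NormedSpace ℝ F] (n : ℕ) (f : F → ℝ) : Prop :=
  ContDiff ℝ n f ∧ ∀ k ≤ n, ∃ C : ℝ, ∀ x, ‖iteratedFDeriv ℝ k f x‖ ≤ C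

/-- The auxiliary function: `η ∈ C³_b(ℝ^d)`, `η > 0` in `Ω`, `η = 0` on `∂Ω`, and the first
derivative does not vanish on `∂Ω`. (As `η` vanishes on `∂Ω`, its gradient there is normal, so this
is the same as a nonzero normal derivative.) -/
structure IsAuxiliary {d : ℕ} (Ω : Set (E d)) (η : E d → ℝ) : Prop where
  smooth : IsCnb 3 η
  pos : ∀ x ∈ Ω, 0 < η x
  zero : ∀ x ∈ frontier Ω, η x = 0
  fderiv_ne : ∀ x ∈ frontier Ω, fderiv ℝ η x ≠ 0

/-- A finite measure on `Ω`, equivalent to Lebesgue measure on `Ω`, such that the logarithm of its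
Radon–Nikodym derivative is (essentially) bounded. -/
structure IsSamplingMeasure {d : ℕ} (Ω : Set (E d)) (μ : Measure (E d)) : Prop where
  finite : IsFiniteMeasure μ
  ac : μ ≪ volume.restrict Ω
  ac' : volume.restrict Ω ≪ μ
  log_bdd : ∃ K : ℝ, ∀ᵐ x ∂(volume.restrict Ω),
    |Real.log ((μ.rnDeriv (volume.restrict Ω) x).toReal)| ≤ K

/-! ### Weak derivatives and Sobolev spaces -/

/-- Test functions `φ ∈ C_c^∞(Ω)`. -/
def IsTest {d : ℕ} (Ω : Set (E d)) (φ : E d → ℝ) : Prop :=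
  ContDiff ℝ ∞ φ ∧ HasCompactSupport φ ∧ tsupport φ ⊆ Ω

/-- `g` is the `i`-th weak partial derivative of `f` in the open set `Ω`. -/
def HasWeakPartial {d : ℕ} (Ω : Set (E d)) (i : Fin d) (f g : E d → ℝ) : Prop :=
  LocallyIntegrableOn f Ω volume ∧ LocallyIntegrableOn g Ω volume ∧
  ∀ φ : E d → ℝ, IsTest Ω φ →
    ∫ x in Ω, f x * partialD i φ x = - ∫ x in Ω, g x * φ x

open Classical in
/-- The `i`-th weak partial derivative of `f` in `Ω` (unique up to null sets), if it exists. -/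
def weakPartial {d : ℕ} (Ω : Set (E d)) (i : Fin d) (f : E d → ℝ) : E d → ℝ :=
  if h : ∃ g, HasWeakPartial Ω i f g then h.choose else 0

/-- `f` has the `i`-th weak partial derivative in `Ω`, and it belongs to `L²(μ)`. -/
def HasL2WeakPartial {d : ℕ} (Ω : Set (E d)) (μ : Measure (E d)) (i : Fin d)
    (f : E d → ℝ) : Prop :=
  HasWeakPartial Ω i f (weakPartial Ω i f) ∧ MemLp (weakPartial Ω i f) 2 μ

/-- `f ∈ H¹(Ω, μ)`. -/
def MemH1 {d : ℕ} (Ω : Set (E d)) (μ : Measure (E d)) (f : E d → ℝ) : Prop :=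
  MemLp f 2 μ ∧ ∀ i, HasL2WeakPartial Ω μ i f

/-- `f ∈ H²(Ω, μ)`: `f` and its weak derivatives of order `≤ 2` belong to `L²(μ)`. -/
def MemH2 {d : ℕ} (Ω : Set (E d)) (μ : Measure (E d)) (f : E d → ℝ) : Prop :=
  MemH1 Ω μ f ∧ ∀ i j, HasL2WeakPartial Ω μ j (weakPartial Ω i f)

/-- `f ∈ H¹₀(Ω, μ)`: `f ∈ H¹` is a limit in the `H¹` norm of test functions. -/
def MemH10 {d : ℕ} (Ω : Set (E d)) (μ : Measure (E d)) (f : E d → ℝ) : Prop :=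
  MemH1 Ω μ f ∧ ∀ ε : ℝ≥0∞, 0 < ε → ∃ φ : E d → ℝ, IsTest Ω φ ∧
    eLpNorm (f - φ) 2 μ < ε ∧ ∀ i, eLpNorm (weakPartial Ω i f - partialD i φ) 2 μ < ε

/-- `H²₍₀₎ = H² ∩ H¹₀`. -/
def MemH20 {d : ℕ} (Ω : Set (E d)) (μ : Measure (E d)) (f : E d → ℝ) : Prop :=
  MemH2 Ω μ f ∧ MemH10 Ω μ f

/-! ### The PDE operator -/

/-- Coefficients of a second-order linear differential operator
`𝒜 f = ∑ᵢⱼ aᵢⱼ ∂ᵢ∂ⱼ f + ∑ᵢ bᵢ ∂ᵢ f + c f`. -/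
structure PDEOp (d : ℕ) where
  a : Fin d → Fin d → E d → ℝ
  b : Fin d → E d → ℝ
  c : E d → ℝ

/-- The coefficients are measurable functions. -/
def PDEOp.IsMeasurable {d : ℕ} (A : PDEOp d) : Prop :=
  (∀ i j, Measurable (A.a i j)) ∧ (∀ i, Measurable (A.b i)) ∧ Measurable A.c

/-- `𝒜 f` for a Sobolev function `f`, through its weak derivatives. -/
def PDEOp.weak {d : ℕ} (A : PDEOp d) (Ω : Set (E d)) (f : E d → ℝ) : E d → ℝ := fun x =>
  (∑ i, ∑ j, A.a i j x * weakPartial Ω j (weakPartial Ω i f) x)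
    + (∑ i, A.b i x * weakPartial Ω i f x) + A.c x * f x

/-- `𝒜 φ` for a function `φ` of class `C²`, through its classical derivatives. -/
def PDEOp.classical {d : ℕ} (A : PDEOp d) (φ : E d → ℝ) : E d → ℝ := fun x =>
  (∑ i, ∑ j, A.a i j x * partialD j (partialD i φ) x)
    + (∑ i, A.b i x * partialD i φ x) + A.c x * φ x

/-- The Lipschitz condition
`|𝒜 f₁(x) - 𝒜 f₂(x)| ≤ k ∑_{|α| ≤ 2} |D_α f₁(x) - D_α f₂(x)|` for `f₁, f₂ ∈ H²` and a.e. `x ∈ Ω`. -/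
def PDEOp.IsLipschitz {d : ℕ} (A : PDEOp d) (Ω : Set (E d)) (μ : Measure (E d)) : Prop :=
  ∃ k : ℝ, 0 < k ∧ ∀ f₁ f₂ : E d → ℝ, MemH2 Ω μ f₁ → MemH2 Ω μ f₂ →
    ∀ᵐ x ∂(volume.restrict Ω), |A.weak Ω f₁ x - A.weak Ω f₂ x| ≤
      k * (|f₁ x - f₂ x| + (∑ i, |weakPartial Ω i f₁ x - weakPartial Ω i f₂ x|)
        + ∑ i, ∑ j, |weakPartial Ω j (weakPartial Ω i f₁) x
            - weakPartial Ω j (weakPartial Ω i f₂) x|)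

/-- `u ∈ H²₍₀₎` is a (strong) solution of `𝒜 u = g` in `Ω`, `u = 0` on `∂Ω`. -/
def IsSolution {d : ℕ} (Ω : Set (E d)) (μ : Measure (E d)) (A : PDEOp d) (g u : E d → ℝ) : Prop :=
  MemH20 Ω μ u ∧ ∀ᵐ x ∂μ, A.weak Ω u x = g x

/-- The objective `J(Q) = ∫_Ω (𝒜 Q - g)² dμ`. -/
def objective {d : ℕ} (Ω : Set (E d)) (μ : Measure (E d)) (A : PDEOp d) (g Q : E d → ℝ) : ℝ :=
  ∫ x, (A.weak Ω Q x - g x) ^ 2 ∂μ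

/-! ### The neural network and the wide-limit ODE -/

/-- The parameters `(c, w, b)` of one hidden unit. -/
abbrev Param (d : ℕ) := ℝ × E d × ℝ

/-- One hidden unit: `x ↦ η(x) c σ(w·x + b)`. -/
def unit {d : ℕ} (η : E d → ℝ) (σ : ℝ → ℝ) (p : Param d) (x : E d) : ℝ :=
  η x * (p.1 * σ (inner ℝ p.2.1 x + p.2.2))

/-- `∇_{c,w,b} F (p) · ∇_{c,w,b} G (p)`. -/
def gradDot {d : ℕ} (F G : Param d → ℝ) (p : Param d) : ℝ :=
  fderiv ℝ F p (1, 0, 0) * fderiv ℝ G p (1, 0, 0)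
    + (∑ i, fderiv ℝ F p (0, EuclideanSpace.single i (1 : ℝ), 0)
        * fderiv ℝ G p (0, EuclideanSpace.single i (1 : ℝ), 0))
    + fderiv ℝ F p (0, 0, 1) * fderiv ℝ G p (0, 0, 1)

/-- Conditions on the law `π` of the initial parameters `(c, w, b)` of a hidden unit. -/
structure IsInitLaw {d : ℕ} (π : Measure (Param d)) : Prop where
  prob : IsProbabilityMeasure π
  c_bdd : ∃ K₀ : ℝ, ∀ᵐ p ∂π, |p.1| < K₀
  c_mean : ∫ p, p.1 ∂π = 0
  full_support : ∀ D : Set (E d × ℝ), IsOpen D → D.Nonempty → 0 < π {p | p.2 ∈ D}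
  w_moment : ∀ k, Integrable (fun p : Param d => |p.2.1 k| ^ 4) π
  b_moment : Integrable (fun p : Param d => |p.2.2|) π

/-- The kernel
`U(x,y) = 𝔼 [∇_{c,w,b} 𝒜[η(x) c σ(x;w,b)] · ∇_{c,w,b} [η(y) c σ(y;w,b)]]`. -/
def kernelU {d : ℕ} (A : PDEOp d) (η : E d → ℝ) (σ : ℝ → ℝ) (π : Measure (Param d))
    (x y : E d) : ℝ :=
  ∫ p, gradDot (fun q => A.classical (unit η σ q) x) (fun q => unit η σ q y) p ∂π

/-- The operator `𝒰 f (y) = ∫_Ω f(x) U(x,y) dμ(x)`. -/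
def opU {d : ℕ} (μ : Measure (E d)) (A : PDEOp d) (η : E d → ℝ) (σ : ℝ → ℝ)
    (π : Measure (Param d)) (f : E d → ℝ) : E d → ℝ :=
  fun y => ∫ x, f x * kernelU A η σ π x y ∂μ

/-- The right-hand side of the wide-limit ODE `dQ_t/dt = -𝒰[𝒜 Q_t - g]`. -/
def limitField {d : ℕ} (Ω : Set (E d)) (μ : Measure (E d)) (A : PDEOp d) (η : E d → ℝ) (σ : ℝ → ℝ)
    (π : Measure (Param d)) (g Q : E d → ℝ) : E d → ℝ :=
  fun y => - opU μ A η σ π (fun x => A.weak Ω Q x - g x) y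

/-- `Q ∈ H²₍₀₎` is a stationary point of the wide-limit ODE: its right-hand side vanishes at `Q`,
as an element of the function space. -/
def IsStationary {d : ℕ} (Ω : Set (E d)) (μ : Measure (E d)) (A : PDEOp d) (η : E d → ℝ)
    (σ : ℝ → ℝ) (π : Measure (Param d)) (g Q : E d → ℝ) : Prop :=
  MemH20 Ω μ Q ∧ ∀ᵐ y ∂μ, limitField Ω μ A η σ π g Q y = 0

end DGM

end

/-! ### Classical partial derivatives, and weak derivatives tested against C¹ functions. -/

namespace DGM
open Filter Topology

variable {d : ℕ}

/-! Let h = 𝒜Q* − g be the residual. Since g = 𝒜u with u in H²₍₀₎, h = 𝒜(Q* − u) lies in the image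
of H²₍₀₎. So it suffices that h is orthogonal in L²(μ) to 𝒜v for v in a dense class: approximating
Q* − u then gives ∫ h² dμ = 0.

Positivity. Let ψ_m(p, ·) be the derivatives of a hidden unit in its parameters and F_m(p) = ∫ h
𝒜ψ_m(p) dμ. Then 𝒰h(y) = 𝔼 Σ F_m(p) ψ_m(p, y). This vanishes almost everywhere, hence everywhere in
Ω by continuity. Applying 𝒜 in y under the expectation and integrating against h gives 𝔼 Σ F_m² = 0
(`ae_integral_eq_zero_of_stationary`). The component m = c does not involve c; continuity and full
support of (w, b) yield ∫ h 𝒜[η σ(w·x + b)] dμ = 0 for all w, b (`integral_classical_unit_eq_zero`).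

From ridge functions to test functions. The map φ ↦ ∫ h 𝒜[ηφ] dμ is a second-order functional with
integrable densities. Applied to σ(z w·x + b) and differentiated n times at z = 0 it gives σ⁽ⁿ⁾(b)
times a moment of order n. After smoothing σ by convolution, no derivative of it is identically
zero, because a bounded non-constant function is not a polynomial. So all moments vanish, and with
them the functional on exp(z w·x), which is entire in z. Taking z = 2πi, Fourier inversion reaches
every test function g on ℝ^d (`integral_eq_zero_of_ridge`).

Density. The products ηg are dense in H²₍₀₎ (`exists_aux_mul_tendsto`). All boundary geometry is
read off from η, a defining function with nonzero gradient on ∂Ω. A given f is written ηq; Hardy's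
inequality (`hardy`), used on f, on its tangential derivatives (`WD.tangential`) and on η²∇q, puts q
in H¹ with ηD²q in L² (`exists_quotient`). Such q is approximated up to the boundary by mollifiers
supported in cones pointing into Ω, along which η does not drop by more than a constant factor
(`weightedLimit_of_weak`).

Passage to the limit. The Lipschitz condition turns H² convergence into L² convergence of the images
under 𝒜, and tested on polynomials of degree at most two it provides bounded coefficients for 𝒜 on
C² functions (`exists_bounded_coefficients`). -/

theorem contDiff_partialD {n m : ℕ∞ω} {φ : E d → ℝ} (hφ : ContDiff ℝ n φ) (hmn : m + 1 ≤ n)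
    (i : Fin d) : ContDiff ℝ m (partialD i φ) :=
  (hφ.fderiv_right hmn).clm_apply contDiff_const

theorem continuous_partialD {φ : E d → ℝ} (hφ : ContDiff ℝ 1 φ) (i : Fin d) :
    Continuous (partialD i φ) :=
  (contDiff_partialD (m := 0) hφ (by norm_num) i).continuous

theorem partialD_mul {f g : E d → ℝ} {x : E d} (hf : DifferentiableAt ℝ f x)
    (hg : DifferentiableAt ℝ g x) (i : Fin d) :
    partialD i (fun y => f y * g y) x = f x * partialD i g x + partialD i f x * g x := by
  simp only [partialD, fderiv_fun_mul hf hg]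
  simp [mul_comm]

theorem partialD_add {f g : E d → ℝ} {x : E d} (hf : DifferentiableAt ℝ f x)
    (hg : DifferentiableAt ℝ g x) (i : Fin d) :
    partialD i (fun y => f y + g y) x = partialD i f x + partialD i g x := by
  simp only [partialD, fderiv_fun_add hf hg]
  simp

theorem partialD_sub {f g : E d → ℝ} {x : E d} (hf : DifferentiableAt ℝ f x)
    (hg : DifferentiableAt ℝ g x) (i : Fin d) :
    partialD i (fun y => f y - g y) x = partialD i f x - partialD i g x := by
  simp only [partialD, fderiv_fun_sub hf hg]
  simp

theorem partialD_comp {f : E d → ℝ} {h : ℝ → ℝ} {x : E d} (hf : DifferentiableAt ℝ f x)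
    (hh : DifferentiableAt ℝ h (f x)) (i : Fin d) :
    partialD i (fun y => h (f y)) x = deriv h (f x) * partialD i f x := by
  simp only [partialD]
  rw [show (fun y => h (f y)) = h ∘ f from rfl, fderiv_comp x hh hf]
  simp [mul_comm]

theorem partialD_congr {f g : E d → ℝ} {x : E d} (h : f =ᶠ[𝓝 x] g) (i : Fin d) :
    partialD i f x = partialD i g x := by
  simp only [partialD, h.fderiv_eq]

theorem partialD_comm {φ : E d → ℝ} (hφ : ContDiff ℝ 2 φ) (i j : Fin d) (x : E d) :
    partialD i (partialD j φ) x = partialD j (partialD i φ) x := by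
  have hs : IsSymmSndFDerivAt ℝ φ x := hφ.contDiffAt.isSymmSndFDerivAt (by simp)
  have hd : DifferentiableAt ℝ (fderiv ℝ φ) x :=
    ((hφ.fderiv_right (m := 1) (by norm_num)).differentiable one_ne_zero) x
  have key : ∀ v w : E d, fderiv ℝ (fun y => fderiv ℝ φ y v) x w = fderiv ℝ (fderiv ℝ φ) x w v := by
    intro v w
    rw [fderiv_clm_apply hd (differentiableAt_const v)]
    simp
  change fderiv ℝ (fun y => fderiv ℝ φ y _) x _ = fderiv ℝ (fun y => fderiv ℝ φ y _) x _
  rw [key, key]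
  exact hs _ _

theorem hasCompactSupport_partialD {φ : E d → ℝ} (hφ : HasCompactSupport φ) (i : Fin d) :
    HasCompactSupport (partialD i φ) :=
  hφ.fderiv_apply (𝕜 := ℝ) _

theorem tsupport_partialD_subset (φ : E d → ℝ) (i : Fin d) :
    tsupport (partialD i φ) ⊆ tsupport φ :=
  tsupport_fderiv_apply_subset ℝ _

theorem partialD_eq_zero_of_notMem {φ : E d → ℝ} {x : E d} (hx : x ∉ tsupport φ) (i : Fin d) :
    partialD i φ x = 0 :=
  image_eq_zero_of_notMem_tsupport fun h => hx (tsupport_partialD_subset φ i h)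

/-- `f * φ` is integrable for `f` locally integrable on `V` and `φ` continuous with compact support
in `V`. -/
theorem integrable_mul_of_tsupport_subset {V : Set (E d)} {f φ : E d → ℝ}
    (hf : LocallyIntegrableOn f V) (hφ : Continuous φ) (hc : HasCompactSupport φ)
    (hV : tsupport φ ⊆ V) : Integrable fun x => f x * φ x := by
  have h1 : IntegrableOn f (tsupport φ) := hf.integrableOn_compact_subset hV hc
  have h2 : IntegrableOn (fun x => f x * φ x) (tsupport φ) :=
    h1.mul_continuousOn hφ.continuousOn hc
  refine (integrableOn_iff_integrable_of_support_subset fun x hx => ?_).1 h2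
  refine subset_tsupport φ fun h => hx ?_
  simp [h]

/-- `g` is the `i`-th weak derivative of `f` in `V`, tested against `C¹` functions. -/
structure WD (V : Set (E d)) (i : Fin d) (f g : E d → ℝ) : Prop where
  locInt : LocallyIntegrableOn f V
  locInt' : LocallyIntegrableOn g V
  ibp : ∀ φ : E d → ℝ, ContDiff ℝ 1 φ → HasCompactSupport φ → tsupport φ ⊆ V →
    ∫ x, f x * partialD i φ x = - ∫ x, g x * φ x

theorem WD.add {V : Set (E d)} {i : Fin d} {f g f' g' : E d → ℝ} (h : WD V i f g)
    (h' : WD V i f' g') : WD V i (fun x => f x + f' x) (fun x => g x + g' x) := by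
  refine ⟨h.locInt.add h'.locInt, h.locInt'.add h'.locInt', fun φ h1 h2 h3 => ?_⟩
  have e1 : Integrable fun x => f x * partialD i φ x :=
    integrable_mul_of_tsupport_subset h.locInt (continuous_partialD h1 i)
      (hasCompactSupport_partialD h2 i) ((tsupport_partialD_subset φ i).trans h3)
  have e1' : Integrable fun x => f' x * partialD i φ x :=
    integrable_mul_of_tsupport_subset h'.locInt (continuous_partialD h1 i)
      (hasCompactSupport_partialD h2 i) ((tsupport_partialD_subset φ i).trans h3)
  have e2 := integrable_mul_of_tsupport_subset h.locInt' h1.continuous h2 h3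
  have e2' := integrable_mul_of_tsupport_subset h'.locInt' h1.continuous h2 h3
  simp only [add_mul]
  rw [integral_add e1 e1', integral_add e2 e2', h.ibp φ h1 h2 h3, h'.ibp φ h1 h2 h3]
  ring

/-- A function that is `C¹` on an open set, times a compactly supported function. -/
theorem contDiff_mul_of_tsupport_subset {V : Set (E d)} (hV : IsOpen V) {n : ℕ∞ω}
    {ψ φ : E d → ℝ} (hψ : ContDiffOn ℝ n ψ V) (hφ : ContDiff ℝ n φ) (hs : tsupport φ ⊆ V) :
    ContDiff ℝ n fun x => ψ x * φ x := by
  rw [contDiff_iff_contDiffAt]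
  intro x
  by_cases hx : x ∈ V
  · exact (hψ.contDiffAt (hV.mem_nhds hx)).mul hφ.contDiffAt
  · have h0 : φ =ᶠ[𝓝 x] 0 := notMem_tsupport_iff_eventuallyEq.1 fun h => hx (hs h)
    refine (contDiffAt_const (c := (0 : ℝ))).congr_of_eventuallyEq ?_
    filter_upwards [h0] with y hy
    simp [hy]

theorem tsupport_mul_subset_right' (ψ φ : E d → ℝ) :
    tsupport (fun x => ψ x * φ x) ⊆ tsupport φ :=
  closure_mono fun x hx h => hx (by simp [h])

/-- The test function φ is replaced by ψφ, which is only C¹. This is why `WD` tests against C¹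
functions: η is only C³, and its second derivatives occur as multipliers. -/
theorem WD.mul {V : Set (E d)} (hV : IsOpen V) {i : Fin d} {f g ψ : E d → ℝ} (h : WD V i f g)
    (hψ : ContDiffOn ℝ 1 ψ V) :
    WD V i (fun x => ψ x * f x) (fun x => ψ x * g x + partialD i ψ x * f x) := by
  have hψ' : ContinuousOn (partialD i ψ) V :=
    (hψ.continuousOn_fderiv_of_isOpen hV le_rfl).clm_apply continuousOn_const
  have l1 : LocallyIntegrableOn (fun x => ψ x * f x) V :=
    h.locInt.continuousOn_mul hψ.continuousOn hV.isLocallyClosed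
  have l2 : LocallyIntegrableOn (fun x => ψ x * g x) V :=
    h.locInt'.continuousOn_mul hψ.continuousOn hV.isLocallyClosed
  have l3 : LocallyIntegrableOn (fun x => partialD i ψ x * f x) V :=
    h.locInt.continuousOn_mul hψ' hV.isLocallyClosed
  refine ⟨l1, l2.add l3, fun φ h1 h2 h3 => ?_⟩
  have hc : ContDiff ℝ 1 fun x => ψ x * φ x := contDiff_mul_of_tsupport_subset hV hψ h1 h3
  have hs : tsupport (fun x => ψ x * φ x) ⊆ tsupport φ := tsupport_mul_subset_right' ψ φ
  have key := h.ibp _ hc (h2.mul_left (f := ψ)) (hs.trans h3)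
  have e1 : Integrable fun x => ψ x * f x * partialD i φ x :=
    integrable_mul_of_tsupport_subset l1 (continuous_partialD h1 i)
      (hasCompactSupport_partialD h2 i) ((tsupport_partialD_subset φ i).trans h3)
  have e2 := integrable_mul_of_tsupport_subset l2 h1.continuous h2 h3
  have e3 := integrable_mul_of_tsupport_subset l3 h1.continuous h2 h3
  have hd : ∀ x, f x * partialD i (fun y => ψ y * φ y) x
      = ψ x * f x * partialD i φ x + partialD i ψ x * f x * φ x := by
    intro x
    by_cases hx : x ∈ V
    · rw [partialD_mul ((hψ.contDiffAt (hV.mem_nhds hx)).differentiableAt one_ne_zero)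
        (h1.differentiable one_ne_zero x)]
      ring
    · have hx' : x ∉ tsupport φ := fun h => hx (h3 h)
      rw [partialD_eq_zero_of_notMem hx', partialD_eq_zero_of_notMem fun h => hx' (hs h),
        image_eq_zero_of_notMem_tsupport hx']
      ring
  simp only [hd, add_mul] at key ⊢
  rw [integral_add e1 e3] at key
  rw [integral_add e2 e3]
  have : ∀ x, ψ x * g x * φ x = g x * (ψ x * φ x) := fun x => by ring
  simp only [this]
  linarith

theorem WD.const_mul {V : Set (E d)} (hV : IsOpen V) {i : Fin d} {f g : E d → ℝ} (h : WD V i f g)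
    (c : ℝ) : WD V i (fun x => c * f x) (fun x => c * g x) := by
  have := h.mul hV (ψ := fun _ => c) contDiffOn_const
  simpa [partialD] using this

theorem WD.sub {V : Set (E d)} (hV : IsOpen V) {i : Fin d} {f g f' g' : E d → ℝ} (h : WD V i f g)
    (h' : WD V i f' g') : WD V i (fun x => f x - f' x) (fun x => g x - g' x) := by
  have := h.add (h'.const_mul hV (-1))
  simpa [sub_eq_add_neg] using this

theorem WD.congr_ae {V : Set (E d)} (hV : MeasurableSet V) {i : Fin d} {f g f' g' : E d → ℝ}
    (h : WD V i f g) (hf : ∀ᵐ x ∂(volume.restrict V), f x = f' x)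
    (hg : ∀ᵐ x ∂(volume.restrict V), g x = g' x) : WD V i f' g' := by
  have L : ∀ {a b : E d → ℝ}, LocallyIntegrableOn a V → (∀ᵐ x ∂(volume.restrict V), a x = b x) →
      LocallyIntegrableOn b V := by
    intro a b ha hab x hx
    obtain ⟨t, ht, hi⟩ := ha x hx
    refine ⟨t ∩ V, inter_mem ht self_mem_nhdsWithin, ?_⟩
    refine (hi.mono_set inter_subset_left).congr ?_
    exact ae_mono (Measure.restrict_mono inter_subset_right le_rfl) hab
  have I : ∀ {a b φ : E d → ℝ}, (∀ᵐ x ∂(volume.restrict V), a x = b x) → tsupport φ ⊆ V →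
      ∫ x, a x * φ x = ∫ x, b x * φ x := by
    intro a b φ hab hφ
    refine integral_congr_ae ?_
    filter_upwards [(ae_restrict_iff' hV).1 hab] with x hx
    by_cases hxV : x ∈ V
    · rw [hx hxV]
    · rw [image_eq_zero_of_notMem_tsupport fun h => hxV (hφ h)]; simp
  refine ⟨L h.locInt hf, L h.locInt' hg, fun φ h1 h2 h3 => ?_⟩
  rw [← I hf ((tsupport_partialD_subset φ i).trans h3), ← I hg h3, h.ibp φ h1 h2 h3]

end DGM

/-! ### Mollification and averages of translates in L². -/

namespace DGM
open Filter Topology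
variable {d : ℕ}

/-- A `C¹` function with compact support in an open set is approximated by test functions. -/
theorem exists_smooth_approx {V : Set (E d)} (hV : IsOpen V) {φ : E d → ℝ} (h1 : ContDiff ℝ 1 φ)
    (h2 : HasCompactSupport φ) (h3 : tsupport φ ⊆ V) (i : Fin d) :
    ∃ (φn : ℕ → E d → ℝ) (K : Set (E d)) (C : ℝ), IsCompact K ∧ K ⊆ V ∧
      (∀ n, ContDiff ℝ ∞ (φn n) ∧ tsupport (φn n) ⊆ K ∧
        ∀ x, |φn n x| ≤ C ∧ |partialD i (φn n) x| ≤ C) ∧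
      ∀ x, Tendsto (fun n => φn n x) atTop (𝓝 (φ x)) ∧
        Tendsto (fun n => partialD i (φn n) x) atTop (𝓝 (partialD i φ x)) := by
  obtain ⟨δ, hδ, hδV⟩ := IsCompact.exists_cthickening_subset_open h2 hV h3
  -- The outer radii tend to 0 and never exceed δ, so all the mollified functions are supported in
  -- one compact δ-thickening inside V.
  let b : ℕ → ContDiffBump (0 : E d) := fun n =>
    ⟨δ / 2 * (1 / ((n : ℝ) + 1)), δ * (1 / ((n : ℝ) + 1)), by positivity, by
      have : 0 < 1 / ((n : ℝ) + 1) := by positivity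
      nlinarith⟩
  have hb : Tendsto (fun n => (b n).rOut) atTop (𝓝 0) := by
    have := (tendsto_one_div_add_atTop_nhds_zero_nat (𝕜 := ℝ)).const_mul δ
    simpa [b] using this
  have hbδ : ∀ n, (b n).rOut ≤ δ := by
    intro n
    have : 1 / ((n : ℝ) + 1) ≤ 1 := by
      rw [div_le_one (by positivity)]; linarith [(Nat.cast_nonneg n : (0 : ℝ) ≤ n)]
    change δ * (1 / ((n : ℝ) + 1)) ≤ δ
    nlinarith
  let φn : ℕ → E d → ℝ := fun n =>
    convolution ((b n).normed volume) φ (ContinuousLinearMap.lsmul ℝ ℝ) volume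
  have hloc : ∀ n, LocallyIntegrable ((b n).normed (volume : Measure (E d))) :=
    fun n => ((b n).continuous_normed).locallyIntegrable
  have hpd : ∀ n x, partialD i (φn n) x =
      convolution ((b n).normed volume) (partialD i φ) (ContinuousLinearMap.lsmul ℝ ℝ) volume x := by
    intro n x
    have := h2.hasFDerivAt_convolution_right (μ := volume) (ContinuousLinearMap.lsmul ℝ ℝ)
      (hloc n) h1 x
    simp only [partialD, φn]
    rw [this.fderiv]
    rw [convolution_precompR_apply _ (hloc n) (h2.fderiv (𝕜 := ℝ)) (h1.continuous_fderiv one_ne_zero)]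
    rfl
  have bound : ∀ ψ : E d → ℝ, Continuous ψ → HasCompactSupport ψ → ∃ C, ∀ n x,
      |convolution ((b n).normed volume) ψ (ContinuousLinearMap.lsmul ℝ ℝ) volume x| ≤ C := by
    intro ψ hψ hψc
    obtain ⟨C, hC⟩ := hψ.bounded_above_of_compact_support hψc
    refine ⟨2 * C + C, fun n x => ?_⟩
    have := (b n).dist_normed_convolution_le (μ := volume) (g := ψ) (x₀ := x) (ε := 2 * C)
      hψ.aestronglyMeasurable (fun y _ => by
        rw [dist_eq_norm]
        exact (norm_sub_le _ _).trans (by linarith [hC y, hC x]))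
    rw [Real.dist_eq] at this
    have h4 := hC x
    rw [Real.norm_eq_abs] at h4
    have h5 := abs_add_le (convolution ((b n).normed volume) ψ (ContinuousLinearMap.lsmul ℝ ℝ) volume x
      - ψ x) (ψ x)
    rw [sub_add_cancel] at h5
    linarith
  obtain ⟨C1, hC1⟩ := bound φ h1.continuous h2
  obtain ⟨C2, hC2⟩ := bound _ (continuous_partialD h1 i) (hasCompactSupport_partialD h2 i)
  refine ⟨φn, Metric.cthickening δ (tsupport φ), max C1 C2,
    IsCompact.cthickening h2, hδV, fun n => ⟨?_, ?_, fun x => ⟨?_, ?_⟩⟩, fun x => ⟨?_, ?_⟩⟩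
  · exact (b n).hasCompactSupport_normed.contDiff_convolution_left _ (b n).contDiff_normed
      h1.continuous.locallyIntegrable
  · refine closure_minimal ?_ Metric.isClosed_cthickening
    refine (support_convolution_subset _).trans ?_
    rintro _ ⟨u, hu, v, hv, rfl⟩
    rw [(b n).support_normed_eq] at hu
    refine Metric.mem_cthickening_of_dist_le _ v δ _ (subset_tsupport _ hv) ?_
    rw [dist_eq_norm]
    simp only [add_sub_cancel_right]
    rw [mem_ball_zero_iff] at hu
    exact hu.le.trans (hbδ n)
  · exact (hC1 n x).trans (le_max_left _ _)
  · rw [hpd]; exact (hC2 n x).trans (le_max_right _ _)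
  · exact ContDiffBump.convolution_tendsto_right_of_continuous hb h1.continuous x
  · simp only [hpd]
    exact ContDiffBump.convolution_tendsto_right_of_continuous hb (continuous_partialD h1 i) x

/-- Mollifying a C¹ test function converges pointwise, with bounded values and derivatives on a
fixed compact set where f and g are integrable; dominated convergence passes the identity to the
limit. -/
theorem WD.of_smooth {V : Set (E d)} (hV : IsOpen V) {i : Fin d} {f g : E d → ℝ}
    (hf : LocallyIntegrableOn f V) (hg : LocallyIntegrableOn g V)
    (h : ∀ φ : E d → ℝ, ContDiff ℝ ∞ φ → HasCompactSupport φ → tsupport φ ⊆ V →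
      ∫ x, f x * partialD i φ x = - ∫ x, g x * φ x) : WD V i f g := by
  refine ⟨hf, hg, fun φ h1 h2 h3 => ?_⟩
  obtain ⟨φn, K, C, hK, hKV, hn, hlim⟩ := exists_smooth_approx hV h1 h2 h3 i
  have lim : ∀ (a : E d → ℝ) (ψ : E d → ℝ) (ψn : ℕ → E d → ℝ), LocallyIntegrableOn a V →
      (∀ n, Continuous (ψn n)) → (∀ n, tsupport (ψn n) ⊆ K) → (∀ n x, |ψn n x| ≤ C) →
      (∀ x, Tendsto (fun n => ψn n x) atTop (𝓝 (ψ x))) →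
      Tendsto (fun n => ∫ x, a x * ψn n x) atTop (𝓝 (∫ x, a x * ψ x)) := by
    intro a ψ ψn ha hc hs hb hl
    have hi : IntegrableOn a K := ha.integrableOn_compact_subset hKV hK
    refine tendsto_integral_of_dominated_convergence
      (K.indicator fun x => |a x| * C) (fun n => ?_) ?_ (fun n => ?_) ?_
    · have := integrable_mul_of_tsupport_subset ha (hc n)
        (HasCompactSupport.of_support_subset_isCompact hK ((subset_tsupport _).trans (hs n)))
        ((hs n).trans hKV)
      exact this.aestronglyMeasurable
    · exact (integrable_indicator_iff hK.measurableSet).2 (hi.abs.mul_const C)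
    · refine Eventually.of_forall fun x => ?_
      by_cases hx : x ∈ K
      · rw [indicator_of_mem hx, Real.norm_eq_abs, abs_mul]
        exact mul_le_mul_of_nonneg_left (hb n x) (abs_nonneg _)
      · rw [indicator_of_notMem hx, image_eq_zero_of_notMem_tsupport fun h => hx (hs n h)]
        simp
    · exact Eventually.of_forall fun x => (hl x).const_mul _
  have t1 := lim f (partialD i φ) (fun n => partialD i (φn n)) hf
    (fun n => continuous_partialD ((hn n).1.of_le (by exact_mod_cast le_top)) i)
    (fun n => (tsupport_partialD_subset _ i).trans (hn n).2.1)
    (fun n x => ((hn n).2.2 x).2) (fun x => (hlim x).2)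
  have t2 := lim g φ φn hg (fun n => (hn n).1.continuous) (fun n => (hn n).2.1)
    (fun n x => ((hn n).2.2 x).1) (fun x => (hlim x).1)
  refine tendsto_nhds_unique t1 (t2.neg.congr fun n => ?_)
  rw [h _ (hn n).1 (HasCompactSupport.of_support_subset_isCompact hK
    ((subset_tsupport _).trans (hn n).2.1)) ((hn n).2.1.trans hKV)]

/-- Averaging of translates with weight `K`. -/
noncomputable def moll (K v : E d → ℝ) : E d → ℝ := fun x => ∫ u, K u * v (x + u)

theorem moll_eq (K v : E d → ℝ) (x : E d) : moll K v x = ∫ y, v y * K (y - x) := by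
  rw [moll, ← integral_add_left_eq_self (fun y => v y * K (y - x)) x]
  simp [mul_comm]

theorem moll_eq_convolution (K v : E d → ℝ) :
    moll K v = convolution v (fun u => K (-u)) (ContinuousLinearMap.mul ℝ ℝ) volume := by
  ext x
  rw [moll_eq, convolution_def]
  simp

theorem hasCompactSupport_comp_neg {K : E d → ℝ} (hK : HasCompactSupport K) :
    HasCompactSupport fun u => K (-u) :=
  hK.comp_homeomorph (Homeomorph.neg (E d))

theorem contDiff_moll {K v : E d → ℝ} (hK : ContDiff ℝ ∞ K) (hKc : HasCompactSupport K)
    (hv : LocallyIntegrable v) : ContDiff ℝ ∞ (moll K v) := by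
  rw [moll_eq_convolution]
  exact (hasCompactSupport_comp_neg hKc).contDiff_convolution_right _ hv (hK.comp contDiff_neg)

theorem hasCompactSupport_moll {K v : E d → ℝ} (hKc : HasCompactSupport K)
    (hv : HasCompactSupport v) : HasCompactSupport (moll K v) := by
  rw [moll_eq_convolution]
  exact HasCompactSupport.convolution _ hv (hasCompactSupport_comp_neg hKc)

theorem partialD_comp_neg (K : E d → ℝ) (i : Fin d) (u : E d) :
    partialD i (fun y => K (-y)) u = - partialD i K (-u) := by
  have := fderiv_comp_smul (𝕜 := ℝ) (f := K) (x := u) (-1)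
  simp only [neg_smul, one_smul] at this
  simp [partialD, this]

theorem partialD_comp_sub (K : E d → ℝ) (i : Fin d) (x y : E d) :
    partialD i (fun z => K (z - x)) y = partialD i K (y - x) := by
  simp only [partialD, fderiv_comp_sub]

theorem partialD_moll {K v : E d → ℝ} (hK : ContDiff ℝ ∞ K) (hKc : HasCompactSupport K)
    (hv : LocallyIntegrable v) (i : Fin d) (x : E d) :
    partialD i (moll K v) x = - ∫ y, v y * partialD i K (y - x) := by
  have hK1 : ContDiff ℝ 1 fun u => K (-u) :=
    (hK.of_le (by exact_mod_cast le_top)).comp contDiff_neg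
  have hc := hasCompactSupport_comp_neg hKc
  have := hc.hasFDerivAt_convolution_right (μ := volume) (ContinuousLinearMap.mul ℝ ℝ) hv hK1 x
  rw [← moll_eq_convolution] at this
  rw [partialD, this.fderiv, convolution_precompR_apply _ hv (hc.fderiv (𝕜 := ℝ))
    (hK1.continuous_fderiv one_ne_zero), convolution_def, ← integral_neg]
  refine integral_congr_ae (Eventually.of_forall fun y => ?_)
  have := partialD_comp_neg K i (x - y)
  simp only [partialD] at this
  simp [this, partialD]

/-- At points `x` with `x + tsupport K ⊆ V`, mollification commutes with weak derivatives. -/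
theorem WD.partialD_moll {V : Set (E d)} {i : Fin d} {v w K : E d → ℝ} (h : WD V i v w)
    (hK : ContDiff ℝ ∞ K) (hKc : HasCompactSupport K) (hv : LocallyIntegrable v) {x : E d}
    (hx : ∀ u ∈ tsupport K, x + u ∈ V) : partialD i (moll K v) x = moll K w x := by
  have hs : tsupport (fun y => K (y - x)) ⊆ (fun y => y - x) ⁻¹' tsupport K :=
    tsupport_comp_subset_preimage K (by fun_prop)
  -- The translated kernel is the test function. Only x + tsupport K has to lie in V, not a ball
  -- around x, so kernels supported off the origin are allowed.
  have := h.ibp (fun y => K (y - x)) ((hK.of_le (by exact_mod_cast le_top)).comp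
      (contDiff_id.sub contDiff_const))
    (hKc.comp_homeomorph (Homeomorph.subRight x)) (fun y hy => by simpa using hx _ (hs hy))
  simp only [partialD_comp_sub] at this
  rw [DGM.partialD_moll hK hKc hv, this, neg_neg, moll_eq]

/-- Averages of functions `G · u` that are `L²`-close to `F` are `L²`-close to `F`. -/
theorem lintegral_average_sub_le {S : Set (E d)} {K : E d → ℝ}
    (hK : Continuous K) (hK0 : ∀ u, 0 ≤ K u) (hK1 : ∫ u, K u = 1) {G : E d → E d → ℝ} {F : E d → ℝ}
    (hG : Measurable (Function.uncurry G)) (hF : Measurable F)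
    (hi : ∀ x ∈ S, Integrable fun u => K u * G x u) (hS : MeasurableSet S) {ε : ℝ≥0∞}
    (hε : ∀ u, K u ≠ 0 → ∫⁻ x in S, ‖G x u - F x‖ₑ ^ 2 ≤ ε) :
    ∫⁻ x in S, ‖(∫ u, K u * G x u) - F x‖ₑ ^ 2 ≤ ε := by
  have hKi : Integrable K := integrable_of_integral_eq_one hK1
  have hKl : ∫⁻ u, ‖K u‖ₑ = 1 := by
    rw [← ofReal_integral_norm_eq_lintegral_enorm hKi]
    simp only [Real.norm_eq_abs, abs_of_nonneg (hK0 _), hK1, ENNReal.ofReal_one]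
  have hKm : Measurable fun u => ‖K u‖ₑ := hK.measurable.enorm
  have pt : ∀ x ∈ S, ‖(∫ u, K u * G x u) - F x‖ₑ ^ 2 ≤ ∫⁻ u, ‖K u‖ₑ * ‖G x u - F x‖ₑ ^ 2 := by
    intro x hx
    have hGx : Measurable (G x) := hG.comp measurable_prodMk_left
    have e1 : (∫ u, K u * G x u) - F x = ∫ u, K u * (G x u - F x) := by
      simp only [mul_sub]
      rw [integral_sub (hi x hx) (hKi.mul_const _), integral_mul_const, hK1, one_mul]
    have hgm : Measurable fun u => ‖G x u - F x‖ₑ := (hGx.sub_const _).enorm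
    have e2 : ‖(∫ u, K u * G x u) - F x‖ₑ ≤ ∫⁻ u, ‖K u‖ₑ * ‖G x u - F x‖ₑ := by
      rw [e1]
      refine (enorm_integral_le_lintegral_enorm _).trans (le_of_eq ?_)
      simp [enorm_mul]
    -- Cauchy–Schwarz with K split as K^(1/2) · K^(1/2); the first factor then integrates to 1.
    -- Integrating over S and exchanging the integrals leaves an average of quantities at most ε.
    have e3 : ∫⁻ u, ‖K u‖ₑ * ‖G x u - F x‖ₑ ≤
        (∫⁻ u, ‖K u‖ₑ) ^ (1 / 2 : ℝ) * (∫⁻ u, ‖K u‖ₑ * ‖G x u - F x‖ₑ ^ 2) ^ (1 / 2 : ℝ) := by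
      have := ENNReal.lintegral_mul_le_Lp_mul_Lq volume (Real.HolderConjugate.two_two)
        (f := fun u => ‖K u‖ₑ ^ (1 / 2 : ℝ)) (g := fun u => ‖K u‖ₑ ^ (1 / 2 : ℝ) * ‖G x u - F x‖ₑ)
        (hKm.pow_const _).aemeasurable ((hKm.pow_const _).mul hgm).aemeasurable
      have h0 : ∀ a : ℝ≥0∞, (a ^ (1 / 2 : ℝ)) ^ (2 : ℝ) = a := by
        intro a; rw [← ENNReal.rpow_mul]; norm_num
      have h00 : ∀ a : ℝ≥0∞, a ^ (1 / 2 : ℝ) * a ^ (1 / 2 : ℝ) = a := by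
        intro a
        rw [← ENNReal.rpow_add_of_nonneg _ _ (by norm_num) (by norm_num)]
        norm_num
      simp only [ENNReal.mul_rpow_of_nonneg _ _ (by norm_num : (0 : ℝ) ≤ 2), h0, Pi.mul_apply,
        ← mul_assoc, h00] at this
      simpa only [ENNReal.rpow_ofNat] using this
    rw [hKl, ENNReal.one_rpow, one_mul] at e3
    calc ‖(∫ u, K u * G x u) - F x‖ₑ ^ 2
        ≤ ((∫⁻ u, ‖K u‖ₑ * ‖G x u - F x‖ₑ ^ 2) ^ (1 / 2 : ℝ)) ^ 2 :=
          pow_le_pow_left₀ zero_le (e2.trans e3) 2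
      _ = _ := by
          rw [← ENNReal.rpow_natCast, ← ENNReal.rpow_mul]; norm_num
  calc ∫⁻ x in S, ‖(∫ u, K u * G x u) - F x‖ₑ ^ 2
      ≤ ∫⁻ x in S, ∫⁻ u, ‖K u‖ₑ * ‖G x u - F x‖ₑ ^ 2 := setLIntegral_mono' hS pt
    _ = ∫⁻ u, ∫⁻ x in S, ‖K u‖ₑ * ‖G x u - F x‖ₑ ^ 2 := by
        refine lintegral_lintegral_swap ?_
        have : Measurable (Function.uncurry fun x u => ‖K u‖ₑ * ‖G x u - F x‖ₑ ^ 2) :=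
          (hKm.comp measurable_snd).mul ((hG.sub (hF.comp measurable_fst)).enorm.pow_const 2)
        exact this.aemeasurable
    _ ≤ ∫⁻ u, ‖K u‖ₑ * ε := by
        refine lintegral_mono fun u => ?_
        dsimp only
        rw [lintegral_const_mul']
        · by_cases hu : K u = 0
          · simp [hu]
          · exact mul_le_mul_right (hε u hu) _
        · exact enorm_ne_top
    _ = ε := by rw [lintegral_mul_const _ hKm, hKl, one_mul]

/-- Translation is continuous in `L²`. -/
theorem tendsto_lintegral_translate {F : E d → ℝ} (hF : MemLp F 2 volume) :
    Tendsto (fun u : E d => ∫⁻ x, ‖F (x + u) - F x‖ₑ ^ 2) (𝓝 0) (𝓝 0) := by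
  let g : E d → C(E d, E d) := fun u => ⟨fun x => x + u, by fun_prop⟩
  have hg : Continuous g := ContinuousMap.continuous_of_continuous_uncurry _ (by
    change Continuous fun p : E d × E d => p.2 + p.1
    fun_prop)
  have hm : ∀ u, MeasurePreserving (g u) (volume : Measure (E d)) volume :=
    fun u => measurePreserving_add_right volume u
  have := Filter.Tendsto.compMeasurePreservingLp (p := 2) (l := 𝓝 (0 : E d))
    (tendsto_const_nhds (x := hF.toLp F)) (hg.tendsto 0) hm (hm 0) (by norm_num)
  rw [tendsto_iff_edist_tendsto_0] at this
  have h2 := ((ENNReal.continuous_pow 2).tendsto 0).comp this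
  simp only [ne_eq, OfNat.ofNat_ne_zero, not_false_eq_true, zero_pow] at h2
  refine h2.congr fun u => ?_
  simp only [Function.comp_apply]
  have e : ∀ u, Lp.compMeasurePreserving (g u) (hm u) (hF.toLp F) =
      (hF.comp_measurePreserving (hm u)).toLp (F ∘ g u) := fun u => rfl
  rw [e, e, Lp.edist_toLp_toLp, eLpNorm_eq_lintegral_rpow_enorm_toReal (by norm_num) (by norm_num)]
  rw [← ENNReal.rpow_natCast, ← ENNReal.rpow_mul]
  simp [g]

end DGM

/-! ### Square integrable functions vanishing off Ω, and the divergence identity for F². -/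

namespace DGM
open Filter Topology
variable {d : ℕ}

/-- Measurable square integrable functions vanishing off `Ω`. -/
structure L2S (Ω : Set (E d)) (F : E d → ℝ) : Prop where
  meas : Measurable F
  memLp : MemLp F 2 volume
  zero : ∀ x, x ∉ Ω → F x = 0

theorem L2S.add {Ω : Set (E d)} {F G : E d → ℝ} (hF : L2S Ω F) (hG : L2S Ω G) :
    L2S Ω fun x => F x + G x :=
  ⟨hF.meas.add hG.meas, hF.memLp.add hG.memLp, fun x hx => by simp [hF.zero x hx, hG.zero x hx]⟩

theorem L2S.sub {Ω : Set (E d)} {F G : E d → ℝ} (hF : L2S Ω F) (hG : L2S Ω G) :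
    L2S Ω fun x => F x - G x :=
  ⟨hF.meas.sub hG.meas, hF.memLp.sub hG.memLp, fun x hx => by simp [hF.zero x hx, hG.zero x hx]⟩

theorem L2S.zero' {Ω : Set (E d)} : L2S Ω fun _ => 0 :=
  ⟨measurable_const, MemLp.zero, fun _ _ => rfl⟩

theorem L2S.sum {Ω : Set (E d)} {ι : Type*} (s : Finset ι) {F : ι → E d → ℝ}
    (hF : ∀ i ∈ s, L2S Ω (F i)) : L2S Ω fun x => ∑ i ∈ s, F i x := by
  classical
  induction s using Finset.induction_on with
  | empty => simpa using L2S.zero'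
  | insert a s ha ih =>
    simp only [Finset.sum_insert ha]
    exact (hF a (by simp)).add (ih fun i hi => hF i (by simp [hi]))

theorem L2S.bdd_mul {Ω : Set (E d)} {F ψ : E d → ℝ} (hF : L2S Ω F) (hψ : Measurable ψ) {C : ℝ}
    (hC : ∀ x ∈ Ω, |ψ x| ≤ C) : L2S Ω fun x => ψ x * F x := by
  refine ⟨hψ.mul hF.meas, ?_, fun x hx => by simp [hF.zero x hx]⟩
  refine hF.memLp.of_le_mul (c := C) (hψ.mul hF.meas).aestronglyMeasurable
    (Eventually.of_forall fun x => ?_)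
  by_cases hx : x ∈ Ω
  · rw [norm_mul]
    exact mul_le_mul_of_nonneg_right (hC x hx) (norm_nonneg _)
  · simp [hF.zero x hx]

theorem exists_bound_on {Ω : Set (E d)} (hΩ : Bornology.IsBounded Ω) {ψ : E d → ℝ}
    (hψ : Continuous ψ) : ∃ C, 0 ≤ C ∧ ∀ x ∈ Ω, |ψ x| ≤ C := by
  obtain ⟨C, hC⟩ := hΩ.isCompact_closure.exists_bound_of_continuousOn hψ.continuousOn
  exact ⟨max C 0, le_max_right _ _, fun x hx => (hC x (subset_closure hx)).trans (le_max_left _ _)⟩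

theorem L2S.cont_mul {Ω : Set (E d)} (hΩ : Bornology.IsBounded Ω) {F ψ : E d → ℝ} (hF : L2S Ω F)
    (hψ : Continuous ψ) : L2S Ω fun x => ψ x * F x :=
  let ⟨_, _, hC⟩ := exists_bound_on hΩ hψ
  hF.bdd_mul hψ.measurable hC

theorem L2S.integrable_mul {Ω : Set (E d)} {F G : E d → ℝ} (hF : L2S Ω F) (hG : L2S Ω G) :
    Integrable fun x => F x * G x :=
  hF.memLp.integrable_mul hG.memLp

theorem L2S.locallyIntegrable {Ω : Set (E d)} {F : E d → ℝ} (hF : L2S Ω F) :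
    LocallyIntegrable F :=
  hF.memLp.locallyIntegrable (by norm_num)

theorem L2S.integrable_cont_mul {Ω : Set (E d)} (hΩ : Bornology.IsBounded Ω) {F ψ : E d → ℝ}
    (hF : L2S Ω F) (hψ : Continuous ψ) : Integrable fun x => F x * ψ x := by
  have h1 : IntegrableOn (fun x => F x * ψ x) (closure Ω) :=
    (hF.locallyIntegrable.integrableOn_isCompact hΩ.isCompact_closure).mul_continuousOn
      hψ.continuousOn hΩ.isCompact_closure
  refine (integrableOn_iff_integrable_of_support_subset fun x hx => ?_).1 h1
  by_contra h
  exact hx (by simp [hF.zero x fun h' => h (subset_closure h')])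

/-- A smooth probability density supported in a given ball. -/
theorem exists_kernel (c : E d) {s : ℝ} (hs : 0 < s) : ∃ K : E d → ℝ, ContDiff ℝ ∞ K ∧
    HasCompactSupport K ∧ (∀ u, 0 ≤ K u) ∧ ∫ u, K u = 1 ∧ tsupport K ⊆ Metric.closedBall c s := by
  let b : ContDiffBump c := ⟨s / 2, s, by positivity, by linarith⟩
  exact ⟨b.normed volume, b.contDiff_normed, b.hasCompactSupport_normed, b.nonneg_normed,
    b.integral_normed, (b.tsupport_normed_eq (μ := volume)).subset⟩

theorem integrable_kernel_mul_translate {K F : E d → ℝ} (hK : Continuous K)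
    (hKc : HasCompactSupport K) (hF : LocallyIntegrable F) (x : E d) :
    Integrable fun u => K u * F (x + u) := by
  have h0 : Integrable fun y => F y * K (y - x) :=
    integrable_mul_of_tsupport_subset (V := univ) (locallyIntegrableOn_univ.2 hF)
      (hK.comp (continuous_sub_right x)) (hKc.comp_homeomorph (Homeomorph.subRight x))
      (subset_univ _)
  have := (measurePreserving_add_left (volume : Measure (E d)) x).integrable_comp
    h0.aestronglyMeasurable |>.2 h0
  refine this.congr (Eventually.of_forall fun u => ?_)
  simp [mul_comm]

/-- The radius δ does not depend on the kernel, so a single kernel can serve a function and its weak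
derivative at once. -/
theorem exists_moll_close {F : E d → ℝ} (hFm : Measurable F) (hF : MemLp F 2 volume) {ε : ℝ≥0∞}
    (hε : 0 < ε) : ∃ δ : ℝ, 0 < δ ∧ ∀ K : E d → ℝ, ContDiff ℝ ∞ K → HasCompactSupport K →
      (∀ u, 0 ≤ K u) → ∫ u, K u = 1 → tsupport K ⊆ Metric.ball 0 δ →
      ∫⁻ x, ‖moll K F x - F x‖ₑ ^ 2 ≤ ε := by
  have := (tendsto_lintegral_translate hF).eventually (ge_mem_nhds hε)
  obtain ⟨δ, hδ, h⟩ := Metric.eventually_nhds_iff_ball.1 this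
  refine ⟨δ, hδ, fun K h1 h2 h3 h4 h5 => ?_⟩
  have := lintegral_average_sub_le (S := univ) (G := fun x u => F (x + u)) (F := F) (ε := ε)
    h1.continuous h3 h4 (hFm.comp measurable_add) hFm
    (fun x _ => integrable_kernel_mul_translate h1.continuous h2 (hF.locallyIntegrable (by norm_num)) x)
    MeasurableSet.univ (fun u hu => by
      rw [Measure.restrict_univ]
      exact h u (h5 (subset_tsupport _ hu)))
  rwa [Measure.restrict_univ] at this

/-- Cauchy–Schwarz; L² convergence is stated through the integral of the squared distance because
the averaging estimates produce it in that form. -/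
theorem tendsto_integral_mul_of_lintegral {α : Type*} [MeasurableSpace α] {μ : Measure α}
    {G a : α → ℝ} {an : ℕ → α → ℝ}
    (hG : MemLp G 2 μ) (ha : MemLp a 2 μ) (han : ∀ n, AEStronglyMeasurable (an n) μ)
    (h : Tendsto (fun n => ∫⁻ x, ‖an n x - a x‖ₑ ^ 2 ∂μ) atTop (𝓝 0)) :
    Tendsto (fun n => ∫ x, G x * an n x ∂μ) atTop (𝓝 (∫ x, G x * a x ∂μ)) := by
  have hfin : ∀ᶠ n in atTop, ∫⁻ x, ‖an n x - a x‖ₑ ^ 2 ∂μ < ⊤ :=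
    h.eventually (gt_mem_nhds (by simp))
  have hGi : ∫⁻ x, ‖G x‖ₑ ^ (2 : ℝ) ∂μ ≠ ⊤ := by
    have := lintegral_rpow_enorm_lt_top_of_eLpNorm_lt_top (by norm_num) (by norm_num) hG.2
    simpa using this.ne
  rw [tendsto_iff_edist_tendsto_0]
  have hlim : Tendsto (fun n => (∫⁻ x, ‖G x‖ₑ ^ (2 : ℝ) ∂μ) ^ (1 / 2 : ℝ) *
      (∫⁻ x, ‖an n x - a x‖ₑ ^ 2 ∂μ) ^ (1 / 2 : ℝ)) atTop (𝓝 0) := by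
    have h1 := (ENNReal.continuous_rpow_const (y := 1 / 2)).tendsto 0 |>.comp h
    have h2 := ENNReal.Tendsto.const_mul (a := (∫⁻ x, ‖G x‖ₑ ^ (2 : ℝ) ∂μ) ^ (1 / 2 : ℝ)) h1
      (Or.inr (ENNReal.rpow_ne_top_of_nonneg (by norm_num) hGi))
    simpa using h2
  refine tendsto_of_tendsto_of_tendsto_of_le_of_le' tendsto_const_nhds hlim
    (Eventually.of_forall fun n => zero_le) ?_
  filter_upwards [hfin] with n hn
  have hmem : MemLp (fun x => an n x - a x) 2 μ := by
    refine ⟨(han n).sub ha.1, ?_⟩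
    rw [eLpNorm_lt_top_iff_lintegral_rpow_enorm_lt_top (by norm_num) (by norm_num)]
    simpa using hn
  have hi : Integrable (fun x => G x * (an n x - a x)) μ := hG.integrable_mul hmem
  have hi0 : Integrable (fun x => G x * a x) μ := hG.integrable_mul ha
  have e : ∫ x, G x * an n x ∂μ - ∫ x, G x * a x ∂μ = ∫ x, G x * (an n x - a x) ∂μ := by
    have : ∀ x, G x * an n x = G x * (an n x - a x) + G x * a x := fun x => by ring
    simp only [this]
    rw [integral_add hi hi0]
    ring
  rw [edist_eq_enorm_sub, e]
  refine (enorm_integral_le_lintegral_enorm _).trans ?_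
  have := ENNReal.lintegral_mul_le_Lp_mul_Lq μ (Real.HolderConjugate.two_two)
    (f := fun x => ‖G x‖ₑ) (g := fun x => ‖an n x - a x‖ₑ) hG.1.enorm hmem.1.enorm
  simpa [enorm_mul] using this

/-- `∫ div (F² X) = 0`, one component, for weakly differentiable `F`. -/
theorem integral_weak_div_sq {Ω : Set (E d)} (hΩ : Bornology.IsBounded Ω) {k : Fin d}
    {F Fk X : E d → ℝ} (hF : L2S Ω F) (hFk : L2S Ω Fk) (h : WD univ k F Fk) (hX : ContDiff ℝ 1 X) :
    ∫ x, (2 * F x * Fk x * X x + F x ^ 2 * partialD k X x) = 0 := by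
  have hex : ∀ n : ℕ, ∃ K : E d → ℝ, ContDiff ℝ ∞ K ∧ HasCompactSupport K ∧
      ∫⁻ x, ‖moll K F x - F x‖ₑ ^ 2 ≤ ENNReal.ofReal (1 / (n + 1)) ∧
      ∫⁻ x, ‖moll K Fk x - Fk x‖ₑ ^ 2 ≤ ENNReal.ofReal (1 / (n + 1)) := by
    intro n
    have hp : 0 < ENNReal.ofReal (1 / ((n : ℝ) + 1)) := ENNReal.ofReal_pos.2 (by positivity)
    obtain ⟨δ1, h1, H1⟩ := exists_moll_close hF.meas hF.memLp hp
    obtain ⟨δ2, h2, H2⟩ := exists_moll_close hFk.meas hFk.memLp hp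
    obtain ⟨K, a1, a2, a3, a4, a5⟩ := exists_kernel (0 : E d) (half_pos (lt_min h1 h2))
    have hs : Metric.closedBall (0 : E d) (min δ1 δ2 / 2) ⊆ Metric.ball 0 (min δ1 δ2) :=
      Metric.closedBall_subset_ball (by linarith [lt_min h1 h2])
    refine ⟨K, a1, a2, H1 K a1 a2 a3 a4 ?_, H2 K a1 a2 a3 a4 ?_⟩
    · exact a5.trans (hs.trans (Metric.ball_subset_ball (min_le_left _ _)))
    · exact a5.trans (hs.trans (Metric.ball_subset_ball (min_le_right _ _)))
  choose K hK1 hK2 hK3 hK4 using hex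
  have hz : Tendsto (fun n : ℕ => ENNReal.ofReal (1 / ((n : ℝ) + 1))) atTop (𝓝 0) := by
    have := (ENNReal.continuous_ofReal.tendsto 0).comp
      (tendsto_one_div_add_atTop_nhds_zero_nat (𝕜 := ℝ))
    simpa [Function.comp_def] using this
  have l1 := tendsto_of_tendsto_of_tendsto_of_le_of_le tendsto_const_nhds hz
    (fun n => zero_le) hK3
  have l2 := tendsto_of_tendsto_of_tendsto_of_le_of_le tendsto_const_nhds hz
    (fun n => zero_le) hK4
  have hXF : L2S Ω fun x => X x * F x := hF.cont_mul hΩ hX.continuous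
  have hXFk : L2S Ω fun x => X x * Fk x := hFk.cont_mul hΩ hX.continuous
  have hdXF : L2S Ω fun x => partialD k X x * F x := hF.cont_mul hΩ (continuous_partialD hX k)
  have hm : ∀ n, ContDiff ℝ ∞ (moll (K n) F) := fun n =>
    contDiff_moll (hK1 n) (hK2 n) hF.locallyIntegrable
  have hmk : ∀ n, ContDiff ℝ ∞ (moll (K n) Fk) := fun n =>
    contDiff_moll (hK1 n) (hK2 n) hFk.locallyIntegrable
  have t1 := tendsto_integral_mul_of_lintegral hXF.memLp hFk.memLp
    (fun n => (hmk n).continuous.aestronglyMeasurable) l2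
  have t2 := tendsto_integral_mul_of_lintegral hdXF.memLp hF.memLp
    (fun n => (hm n).continuous.aestronglyMeasurable) l1
  have t3 := tendsto_integral_mul_of_lintegral hXFk.memLp hF.memLp
    (fun n => (hm n).continuous.aestronglyMeasurable) l1
  have key : ∀ n, (∫ x, X x * F x * moll (K n) Fk x) + (∫ x, partialD k X x * F x * moll (K n) F x)
      + ∫ x, X x * Fk x * moll (K n) F x = 0 := by
    intro n
    have hmn : ContDiff ℝ 1 (moll (K n) F) := (hm n).of_le (by exact_mod_cast le_top)
    have hFc : HasCompactSupport F := HasCompactSupport.of_support_subset_isCompact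
      hΩ.isCompact_closure fun x hx => subset_closure (by
        by_contra hxΩ
        exact hx (hF.zero x hxΩ))
    have hc := hasCompactSupport_moll (hK2 n) hFc
    -- Testing the weak derivative of F against F_K X, with F_K a mollification of F, gives an
    -- identity in which everything converges in L²; its limit is the claim.
    have e := h.ibp (fun x => moll (K n) F x * X x) (hmn.mul hX) hc.mul_right (subset_univ _)
    have pd : ∀ x, partialD k (fun x => moll (K n) F x * X x) x
        = moll (K n) F x * partialD k X x + moll (K n) Fk x * X x := by
      intro x
      rw [partialD_mul (hmn.differentiable one_ne_zero x) (hX.differentiable one_ne_zero x),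
        h.partialD_moll (hK1 n) (hK2 n) hF.locallyIntegrable (fun u _ => mem_univ _)]
    simp only [pd] at e
    rw [← integral_add (hXF.integrable_cont_mul hΩ (hmk n).continuous)
      (hdXF.integrable_cont_mul hΩ (hm n).continuous)]
    have e2 : ∀ x, X x * F x * moll (K n) Fk x + partialD k X x * F x * moll (K n) F x
      = F x * (moll (K n) F x * partialD k X x + moll (K n) Fk x * X x) := fun x => by ring
    simp only [e2]
    rw [e, neg_add_eq_zero]
    exact integral_congr_ae (Eventually.of_forall fun x => by dsimp only; ring)
  have hlim := (t1.add t2).add t3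
  simp only [key] at hlim
  have h0 := tendsto_nhds_unique hlim tendsto_const_nhds
  have i1 : Integrable fun x => X x * F x * Fk x + partialD k X x * F x * F x :=
    (hXF.integrable_mul hFk).add (hdXF.integrable_mul hF)
  rw [← integral_add (hXF.integrable_mul hFk) (hdXF.integrable_mul hF),
    ← integral_add i1 (hXFk.integrable_mul hF)] at h0
  rw [← h0]
  exact integral_congr_ae (Eventually.of_forall fun x => by dsimp only; ring)

end DGM

/-! ### Hardy's inequality with weight η. -/

namespace DGM
open Filter Topology
variable {d : ℕ}

/-- A positive smooth function equal to `s + ε` for `s ≥ 0`. -/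
theorem exists_pos_extension {ε : ℝ} (hε : 0 < ε) : ∃ T : ℝ → ℝ, ContDiff ℝ ∞ T ∧
    (∀ s, 0 < T s) ∧ ∀ s, 0 ≤ s → T s = s + ε := by
  -- ρ vanishes for s ≤ −ε/2 and equals 1 for s ≥ 0, so the interpolation between s + ε and 1 uses s
  -- + ε only where it is positive.
  let ρ : ℝ → ℝ := fun s => Real.smoothTransition (2 * (s + ε) / ε - 1)
  have hρ : ContDiff ℝ ∞ ρ := Real.smoothTransition.contDiff.comp (by fun_prop)
  refine ⟨fun s => ρ s * (s + ε) + (1 - ρ s), by fun_prop, fun s => ?_, fun s hs => ?_⟩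
  · change 0 < ρ s * (s + ε) + (1 - ρ s)
    have h0 : 0 ≤ ρ s := Real.smoothTransition.nonneg _
    have h1 : ρ s ≤ 1 := Real.smoothTransition.le_one _
    rcases lt_or_ge 0 (s + ε) with h | h
    · rcases h0.eq_or_lt with h2 | h2
      · rw [← h2]; norm_num
      · nlinarith [mul_pos h2 h]
    · have : ρ s = 0 := Real.smoothTransition.zero_of_nonpos (by
        have : 2 * (s + ε) / ε ≤ 0 := div_nonpos_of_nonpos_of_nonneg (by linarith) hε.le
        linarith)
      simp [this]
  · have : ρ s = 1 := Real.smoothTransition.one_of_one_le (by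
      have : 2 ≤ 2 * (s + ε) / ε := by rw [le_div_iff₀ hε]; linarith
      linarith)
    simp [this]

theorem IsAuxiliary.contDiff {Ω : Set (E d)} {η : E d → ℝ} (hη : IsAuxiliary Ω η) :
    ContDiff ℝ 3 η := hη.smooth.1

theorem partialD_contDiff_two {Ω : Set (E d)} {η : E d → ℝ} (hη : IsAuxiliary Ω η) (k : Fin d) :
    ContDiff ℝ 2 (partialD k η) :=
  contDiff_partialD hη.contDiff (by norm_num) k

theorem partialD_partialD_contDiff_one {Ω : Set (E d)} {η : E d → ℝ} (hη : IsAuxiliary Ω η)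
    (k l : Fin d) : ContDiff ℝ 1 (partialD k (partialD l η)) :=
  contDiff_partialD (partialD_contDiff_two hη l) (by norm_num) k

theorem exists_partialD_ne_zero {φ : E d → ℝ} {x : E d} (h : fderiv ℝ φ x ≠ 0) :
    ∃ k, partialD k φ x ≠ 0 := by
  by_contra! hc
  refine h ?_
  have : (fderiv ℝ φ x : E d →ₗ[ℝ] ℝ) = 0 := by
    refine (EuclideanSpace.basisFun (Fin d) ℝ).toBasis.ext fun k => ?_
    have := hc k
    simp only [partialD] at this
    simp [this]
  ext v
  exact LinearMap.congr_fun this v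

/-- The continuous function |∇η|² + η² is positive on the compact closure: η > 0 inside, and ∇η ≠ 0
on the boundary. It replaces a lower bound for |∇η| alone, since η may have critical points inside
Ω. -/
theorem exists_grad_lower_bound {Ω : Set (E d)} (hΩo : IsOpen Ω) (hΩ : Bornology.IsBounded Ω)
    {η : E d → ℝ} (hη : IsAuxiliary Ω η) :
    ∃ c, 0 < c ∧ ∀ x ∈ Ω, c ≤ (∑ k, partialD k η x ^ 2) + η x ^ 2 := by
  have hc : Continuous fun x => (∑ k, partialD k η x ^ 2) + η x ^ 2 := by
    refine Continuous.add (continuous_finsetSum _ fun k _ => ?_) (hη.contDiff.continuous.pow 2)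
    exact (partialD_contDiff_two hη k).continuous.pow 2
  rcases Ω.eq_empty_or_nonempty with h | h
  · exact ⟨1, one_pos, fun x hx => by simp [h] at hx⟩
  obtain ⟨x0, hx0, hmin⟩ := hΩ.isCompact_closure.exists_isMinOn h.closure hc.continuousOn
  refine ⟨_, ?_, fun x hx => hmin (subset_closure hx)⟩
  have hs : 0 ≤ ∑ k, partialD k η x0 ^ 2 := Finset.sum_nonneg fun k _ => sq_nonneg _
  by_cases hx : x0 ∈ Ω
  · have := hη.pos x0 hx
    positivity
  · obtain ⟨k, hk⟩ := exists_partialD_ne_zero (hη.fderiv_ne x0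
      (by rw [hΩo.frontier_eq]; exact ⟨hx0, hx⟩))
    have : partialD k η x0 ^ 2 ≤ ∑ k, partialD k η x0 ^ 2 :=
      Finset.single_le_sum (f := fun k => partialD k η x0 ^ 2) (fun k _ => sq_nonneg _)
        (Finset.mem_univ k)
    have : 0 < partialD k η x0 ^ 2 := by positivity
    have := sq_nonneg (η x0)
    linarith

/-- The integrand of Hardy's inequality, with Q = |∇η|², L = Δη, a = F/(η+ε)^(m+1), g = F/(η+ε)^m
and b = (∇η·∇F)/(η+ε)^m. Since η²a² ≤ g², the term Qa² dominates c a² − g²; each of the two cross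
terms costs (c/4)a² by Young's inequality, which leaves (c/2)a². -/
theorem hardy_pointwise {c M a b g L Q η ε : ℝ} (m : ℕ) (hc : 0 < c) (hη : 0 < η) (hε : 0 < ε)
    (hL : |L| ≤ M) (hQ : 0 ≤ Q) (hQc : c ≤ Q + η ^ 2) (ha : a = g * (η + ε)⁻¹) :
    c / 2 * a ^ 2 + (2 * a * b + L * g * a - (2 * m + 1) * Q * a ^ 2) ≤
      4 / c * b ^ 2 + (1 + M ^ 2 / c) * g ^ 2 := by
  have h1 : η ^ 2 * a ^ 2 ≤ g ^ 2 := by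
    rw [ha, mul_pow, mul_comm (g ^ 2), ← mul_assoc, ← mul_pow]
    have : η * (η + ε)⁻¹ ≤ 1 := by
      rw [← div_eq_mul_inv, div_le_one (by positivity)]; linarith
    have h2 : (η * (η + ε)⁻¹) ^ 2 ≤ 1 := pow_le_one₀ (by positivity) this
    nlinarith [sq_nonneg g]
  have h2 : c * a ^ 2 ≤ Q * a ^ 2 + g ^ 2 := by nlinarith [sq_nonneg a]
  have h3 : Q * a ^ 2 ≤ (2 * m + 1) * Q * a ^ 2 := by
    have : 0 ≤ 2 * (m : ℝ) * (Q * a ^ 2) := by positivity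
    nlinarith
  have h4 : 2 * a * b ≤ c / 4 * a ^ 2 + 4 / c * b ^ 2 := by
    have : 0 ≤ (c * a - 4 * b) ^ 2 / (4 * c) := by positivity
    have e : (c * a - 4 * b) ^ 2 / (4 * c) = c / 4 * a ^ 2 - 2 * a * b + 4 / c * b ^ 2 := by
      field_simp; ring
    linarith
  have h5 : L * g * a ≤ c / 4 * a ^ 2 + M ^ 2 / c * g ^ 2 := by
    have h6 : L * g * a ≤ c / 4 * a ^ 2 + L ^ 2 / c * g ^ 2 := by
      have : 0 ≤ (c * a - 2 * (L * g)) ^ 2 / (4 * c) := by positivity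
      have e : (c * a - 2 * (L * g)) ^ 2 / (4 * c) = c / 4 * a ^ 2 - L * g * a + L ^ 2 / c * g ^ 2 := by
        field_simp; ring
      linarith
    have h7 : L ^ 2 ≤ M ^ 2 := sq_le_sq' (by linarith [neg_abs_le L]) ((le_abs_self L).trans hL)
    have h8 : L ^ 2 / c * g ^ 2 ≤ M ^ 2 / c * g ^ 2 := by gcongr
    linarith
  linarith

/-- Fatou's lemma. It serves to let ε → 0 in a bound that is uniform in ε. -/
theorem memLp_two_of_integral_le {α : Type*} [MeasurableSpace α] {μ : Measure α} {f : α → ℝ}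
    {fn : ℕ → α → ℝ} (hn : ∀ n, MemLp (fn n) 2 μ) {B : ℝ}
    (hB : ∀ n, ∫ x, fn n x ^ 2 ∂μ ≤ B) (hf : AEStronglyMeasurable f μ)
    (hlim : ∀ x, Tendsto (fun n => fn n x) atTop (𝓝 (f x))) : MemLp f 2 μ := by
  refine ⟨hf, ?_⟩
  have h1 := Lp.eLpNorm_lim_le_liminf_eLpNorm (p := 2) (μ := μ) (fun n => (hn n).1) f
    (Eventually.of_forall hlim)
  refine h1.trans_lt ?_
  have h2 : ∀ n, eLpNorm (fn n) 2 μ ≤ ENNReal.ofReal (B ^ (1 / 2 : ℝ)) := by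
    intro n
    rw [(hn n).eLpNorm_eq_integral_rpow_norm (by norm_num) (by norm_num)]
    refine ENNReal.ofReal_le_ofReal ?_
    have e : ∫ x, ‖fn n x‖ ^ (ENNReal.toReal 2) ∂μ = ∫ x, fn n x ^ 2 ∂μ := by
      refine integral_congr_ae (Eventually.of_forall fun x => ?_)
      simp
    rw [e, ENNReal.toReal_ofNat, ← one_div]
    exact Real.rpow_le_rpow (integral_nonneg fun x => sq_nonneg _) (hB n) (by norm_num)
  refine lt_of_le_of_lt (Filter.liminf_le_of_le (a := ENNReal.ofReal (B ^ (1 / 2 : ℝ)))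
    (by isBoundedDefault) fun b hb => ?_) ENNReal.ofReal_lt_top
  obtain ⟨n, hn⟩ := hb.exists
  exact hn.trans (h2 n)

/-- Hardy's inequality with the weight `η`. -/
theorem hardy {Ω : Set (E d)} (hΩo : IsOpen Ω) (hΩ : Bornology.IsBounded Ω) {η : E d → ℝ}
    (hη : IsAuxiliary Ω η) (m : ℕ) {F : E d → ℝ} {Fk : Fin d → E d → ℝ} (hF : L2S Ω F)
    (hFk : ∀ k, L2S Ω (Fk k)) (h : ∀ k, WD univ k F (Fk k))
    (h1 : L2S Ω fun x => F x / η x ^ m)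
    (h2 : L2S Ω fun x => (∑ k, partialD k η x * Fk k x) / η x ^ m) :
    L2S Ω fun x => F x / η x ^ (m + 1) := by
  have hηm : Measurable η := hη.contDiff.continuous.measurable
  obtain ⟨c, hc, hgrad⟩ := exists_grad_lower_bound hΩo hΩ hη
  obtain ⟨M, hM0, hM⟩ := exists_bound_on hΩ (ψ := fun x => ∑ k, partialD k (partialD k η) x)
    (continuous_finsetSum _ fun k _ => (partialD_partialD_contDiff_one hη k k).continuous)
  let ε : ℕ → ℝ := fun n => 1 / ((n : ℝ) + 1)
  have hε : ∀ n, 0 < ε n := fun n => by positivity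
  let fn : ℕ → E d → ℝ := fun n x => (η x + ε n)⁻¹ ^ (m + 1) * F x
  have hfn : ∀ n, L2S Ω (fn n) := by
    intro n
    refine hF.bdd_mul (C := (ε n)⁻¹ ^ (m + 1)) ((hηm.add_const _).inv.pow_const _) fun x hx => ?_
    have := hη.pos x hx
    have h3 := hε n
    rw [abs_of_nonneg (by positivity)]
    gcongr
    linarith
  refine ⟨hF.meas.div (hηm.pow_const _), ?_, fun x hx => by simp [hF.zero x hx]⟩
  refine memLp_two_of_integral_le (fn := fn)
    (B := 2 / c * ∫ x, (4 / c * ((∑ k, partialD k η x * Fk k x) / η x ^ m) ^ 2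
      + (1 + M ^ 2 / c) * (F x / η x ^ m) ^ 2))
    (fun n => (hfn n).memLp) (fun n => ?_)
    (hF.meas.div (hηm.pow_const _)).aestronglyMeasurable fun x => ?_
  -- Outside Ω nothing prevents η + ε from vanishing. T is a positive smooth substitute for s + ε
  -- which agrees with it at the values s = η(x), x ∈ Ω, so the vector field below is C¹ on all of
  -- ℝ^d.
  · obtain ⟨T, hT, hTpos, hTε⟩ := exists_pos_extension (hε n)
    let H : ℝ → ℝ := fun s => (T s ^ (2 * m + 1))⁻¹
    have hH : ContDiff ℝ ∞ H := (hT.pow _).inv fun s => (pow_pos (hTpos s) _).ne'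
    have hHη : ContDiff ℝ 3 fun x => H (η x) :=
      (contDiff_infty.1 hH 3).comp hη.contDiff
    -- On Ω, X = ∇η/(η+ε)^(2m+1). The exponent is chosen so that F² div X contains −(2m+1)|∇η|²
    -- F²/(η+ε)^(2m+2), which is −(2m+1)|∇η|² times `fn n` squared.
    let X : Fin d → E d → ℝ := fun k x => partialD k η x * H (η x)
    have hX : ∀ k, ContDiff ℝ 1 (X k) := fun k =>
      ((partialD_contDiff_two hη k).of_le (by norm_num)).mul (hHη.of_le (by norm_num))
    have hint := fun k => integral_weak_div_sq hΩ hF (hFk k) (h k) (hX k)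
    have hinti : ∀ k, Integrable fun x => 2 * F x * Fk k x * X k x + F x ^ 2 * partialD k (X k) x := by
      intro k
      have i1 := ((hFk k).cont_mul hΩ (hX k).continuous).integrable_mul hF
      have i2 := (hF.cont_mul hΩ (continuous_partialD (hX k) k)).integrable_mul hF
      refine ((i1.const_mul 2).add i2).congr (Eventually.of_forall fun x => ?_)
      simp only [Pi.add_apply]; ring
    have hsum : ∫ x, ∑ k, (2 * F x * Fk k x * X k x + F x ^ 2 * partialD k (X k) x) = 0 := by
      rw [integral_finsetSum _ fun k _ => hinti k]
      exact Finset.sum_eq_zero fun k _ => hint k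
    have hXd : ∀ k, ∀ x ∈ Ω, partialD k (X k) x = partialD k (partialD k η) x
        * ((η x + ε n) ^ (2 * m + 1))⁻¹
        - (2 * m + 1) * partialD k η x ^ 2 * ((η x + ε n) ^ (2 * m + 2))⁻¹ := by
      intro k x hx
      have hpos := hη.pos x hx
      have hεn := hε n
      have hne : η x + ε n ≠ 0 := by positivity
      have hHd : HasDerivAt H (-(2 * m + 1) * ((η x + ε n) ^ (2 * m + 2))⁻¹) (η x) := by
        have e : H =ᶠ[𝓝 (η x)] fun s => ((s + ε n) ^ (2 * m + 1))⁻¹ := by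
          filter_upwards [lt_mem_nhds hpos] with s hs
          simp only [H, hTε s hs.le]
        refine HasDerivAt.congr_of_eventuallyEq ?_ e
        have := (((hasDerivAt_id (η x)).add_const (ε n)).pow (2 * m + 1)).inv
          (pow_ne_zero _ hne)
        convert! this using 1
        simp only [id, Pi.pow_apply, Nat.add_sub_cancel]
        push_cast
        field_simp
        ring
      rw [partialD_mul (((partialD_contDiff_two hη k).differentiable two_ne_zero) x)
        (hHη.differentiable three_ne_zero x),
        partialD_comp (hη.contDiff.differentiable three_ne_zero x) hHd.differentiableAt, hHd.deriv]
      simp only [H, hTε _ hpos.le]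
      ring
    have i3 := (hfn n).integrable_mul (hfn n)
    have i4 := (h2.integrable_mul h2).const_mul (4 / c)
    have i5 := (h1.integrable_mul h1).const_mul (1 + M ^ 2 / c)
    have hle : ∫ x, (c / 2 * (fn n x * fn n x) +
        ∑ k, (2 * F x * Fk k x * X k x + F x ^ 2 * partialD k (X k) x)) ≤
        ∫ x, (4 / c * ((∑ k, partialD k η x * Fk k x) / η x ^ m) ^ 2
      + (1 + M ^ 2 / c) * (F x / η x ^ m) ^ 2) := by
      refine integral_mono ((i3.const_mul _).add (integrable_finsetSum _ fun k _ => hinti k))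
        ((i4.add i5).congr (Eventually.of_forall fun x => ?_)) fun x => ?_
      · simp only [Pi.add_apply]; ring
      · by_cases hx : x ∈ Ω
        · have hpos := hη.pos x hx
          have hεn := hε n
          set θ := (η x + ε n)⁻¹ with hθ
          have hθ0 : 0 < θ := by positivity
          have hθη : θ ≤ (η x)⁻¹ := by
            rw [hθ]; gcongr; linarith
          have key := hardy_pointwise (a := fn n x) (b := (∑ k, partialD k η x * Fk k x) * θ ^ m)
            (g := F x * θ ^ m) (ε := ε n) m hc hpos hεn (hM x hx)
            (Finset.sum_nonneg fun k _ => sq_nonneg _) (hgrad x hx)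
            (by simp only [fn, ← hθ]; ring)
          have b1 : ((∑ k, partialD k η x * Fk k x) * θ ^ m) ^ 2 ≤
              ((∑ k, partialD k η x * Fk k x) / η x ^ m) ^ 2 := by
            rw [div_eq_mul_inv, mul_pow, mul_pow, ← inv_pow]
            gcongr
          have b2 : (F x * θ ^ m) ^ 2 ≤ (F x / η x ^ m) ^ 2 := by
            rw [div_eq_mul_inv, mul_pow, mul_pow, ← inv_pow]
            gcongr
          have e : ∑ k, (2 * F x * Fk k x * X k x + F x ^ 2 * partialD k (X k) x) =
              2 * fn n x * ((∑ k, partialD k η x * Fk k x) * θ ^ m)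
              + (∑ k, partialD k (partialD k η) x) * (F x * θ ^ m) * fn n x
              - (2 * m + 1) * (∑ k, partialD k η x ^ 2) * fn n x ^ 2 := by
            simp only [Finset.sum_mul, Finset.mul_sum]
            rw [← Finset.sum_add_distrib, ← Finset.sum_sub_distrib]
            refine Finset.sum_congr rfl fun k _ => ?_
            rw [hXd k x hx]
            simp only [X, H, hTε _ hpos.le, fn, ← inv_pow, ← hθ]
            ring
          rw [e]
          calc _ = c / 2 * fn n x ^ 2 + (2 * fn n x * ((∑ k, partialD k η x * Fk k x) * θ ^ m)
              + (∑ k, partialD k (partialD k η) x) * (F x * θ ^ m) * fn n x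
              - (2 * m + 1) * (∑ k, partialD k η x ^ 2) * fn n x ^ 2) := by ring
            _ ≤ _ := key
            _ ≤ _ := by gcongr
        · have z1 := hF.zero x hx
          have z2 := fun k => (hFk k).zero x hx
          simp [z1, z2, fn]
    rw [integral_add (i3.const_mul _) (integrable_finsetSum _ fun k _ => hinti k), hsum, add_zero,
      integral_const_mul] at hle
    have e : ∫ x, fn n x ^ 2 = ∫ x, fn n x * fn n x := by simp only [sq]
    rw [e, div_mul_eq_mul_div, le_div_iff₀ hc]
    linarith
  · by_cases hx : x ∈ Ω
    · have hpos := hη.pos x hx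
      have : Tendsto (fun n => (η x + ε n)⁻¹ ^ (m + 1) * F x) atTop
          (𝓝 ((η x + 0)⁻¹ ^ (m + 1) * F x)) := by
        refine Tendsto.mul_const _ (Tendsto.pow (Tendsto.inv₀ ?_ (by simpa using hpos.ne')) _)
        exact tendsto_const_nhds.add tendsto_one_div_add_atTop_nhds_zero_nat
      convert this using 2
      rw [add_zero, inv_pow]; ring
    · simp [fn, hF.zero x hx]

end DGM

/-! ### Cutoffs near the boundary and tangential integration by parts. -/

namespace DGM
open Filter Topology
variable {d : ℕ}

open Classical in
/-- A cutoff function of the form `S(η / ε)`, with support in `{η ≥ ε}`. -/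
noncomputable def cutoff (Ω : Set (E d)) (η : E d → ℝ) (ε : ℝ) : E d → ℝ :=
  Ω.indicator fun x => Real.smoothTransition (η x / ε - 1)

theorem cutoff_bounds (Ω : Set (E d)) (η : E d → ℝ) (ε : ℝ) (x : E d) :
    0 ≤ cutoff Ω η ε x ∧ cutoff Ω η ε x ≤ 1 := by
  by_cases hx : x ∈ Ω
  · simp only [cutoff, indicator_of_mem hx]
    exact ⟨Real.smoothTransition.nonneg _, Real.smoothTransition.le_one _⟩
  · simp [cutoff, hx]

/-- A point of the closure outside Ω is a boundary point, where η = 0. Hence the support of a cutoff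
is a compact subset of Ω, and restricting to Ω by an indicator costs no smoothness. -/
theorem superlevel_subset {Ω : Set (E d)} (hΩo : IsOpen Ω) {η : E d → ℝ} (hη : IsAuxiliary Ω η)
    {ε : ℝ} (hε : 0 < ε) : closure Ω ∩ {x | ε ≤ η x} ⊆ Ω := by
  rintro x ⟨h1, h2⟩
  by_contra hx
  have := hη.zero x (by rw [hΩo.frontier_eq]; exact ⟨h1, hx⟩)
  simp only [mem_ofPred_eq] at h2
  linarith

theorem isCompact_superlevel {Ω : Set (E d)} (hΩ : Bornology.IsBounded Ω) {η : E d → ℝ}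
    (hη : IsAuxiliary Ω η) (ε : ℝ) : IsCompact (closure Ω ∩ {x | ε ≤ η x}) :=
  hΩ.isCompact_closure.inter_right (isClosed_le continuous_const hη.contDiff.continuous)

theorem tsupport_cutoff_subset {Ω : Set (E d)} (hΩ : Bornology.IsBounded Ω) {η : E d → ℝ}
    (hη : IsAuxiliary Ω η) {ε : ℝ} (hε : 0 < ε) :
    tsupport (cutoff Ω η ε) ⊆ closure Ω ∩ {x | ε ≤ η x} := by
  refine closure_minimal (fun x hx => ?_) (isCompact_superlevel hΩ hη ε).isClosed
  have hxΩ : x ∈ Ω := by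
    by_contra h
    exact hx (by simp [cutoff, h])
  refine ⟨subset_closure hxΩ, ?_⟩
  by_contra h
  simp only [mem_ofPred_eq, not_le] at h
  refine hx ?_
  simp only [cutoff, indicator_of_mem hxΩ]
  refine Real.smoothTransition.zero_of_nonpos ?_
  have : η x / ε < 1 := by rwa [div_lt_one hε]
  linarith

theorem contDiff_cutoff {Ω : Set (E d)} (hΩo : IsOpen Ω) (hΩ : Bornology.IsBounded Ω) {η : E d → ℝ}
    (hη : IsAuxiliary Ω η) {ε : ℝ} (hε : 0 < ε) : ContDiff ℝ 3 (cutoff Ω η ε) := by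
  rw [contDiff_iff_contDiffAt]
  intro x
  by_cases hx : x ∈ Ω
  · have : ContDiff ℝ 3 fun x => Real.smoothTransition (η x / ε - 1) :=
      Real.smoothTransition.contDiff.comp ((hη.contDiff.div_const ε).sub contDiff_const)
    refine this.contDiffAt.congr_of_eventuallyEq ?_
    filter_upwards [hΩo.mem_nhds hx] with y hy
    simp [cutoff, hy]
  · have h0 : cutoff Ω η ε =ᶠ[𝓝 x] 0 := notMem_tsupport_iff_eventuallyEq.1 fun h =>
      hx (superlevel_subset hΩo hη hε (tsupport_cutoff_subset hΩ hη hε h))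
    exact (contDiffAt_const (c := (0 : ℝ))).congr_of_eventuallyEq h0

theorem partialD_cutoff {Ω : Set (E d)} (hΩo : IsOpen Ω) {η : E d → ℝ}
    (hη : IsAuxiliary Ω η) (ε : ℝ) (k : Fin d) {x : E d} (hx : x ∈ Ω) :
    partialD k (cutoff Ω η ε) x = deriv Real.smoothTransition (η x / ε - 1) * (partialD k η x / ε) := by
  have e : cutoff Ω η ε =ᶠ[𝓝 x] fun x => Real.smoothTransition (η x / ε - 1) := by
    filter_upwards [hΩo.mem_nhds hx] with y hy
    simp [cutoff, hy]
  have hd : DifferentiableAt ℝ η x := hη.contDiff.differentiable three_ne_zero x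
  rw [partialD_congr e, partialD_comp (f := fun x => η x / ε - 1) (by fun_prop)
    ((Real.smoothTransition.contDiff (n := 1)).differentiable one_ne_zero _)]
  congr 1
  simp only [partialD]
  rw [fderiv_sub_const]
  simp only [div_eq_mul_inv]
  rw [fderiv_mul_const hd]
  simp [mul_comm]

theorem deriv_smoothTransition_eq_zero {t : ℝ} (ht : 1 < t) :
    deriv Real.smoothTransition t = 0 := by
  have : Real.smoothTransition =ᶠ[𝓝 t] fun _ => 1 := by
    filter_upwards [lt_mem_nhds ht] with s hs
    exact Real.smoothTransition.one_of_one_le hs.le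
  rw [this.deriv_eq, deriv_const]

theorem deriv_smoothTransition_eq_zero' {t : ℝ} (ht : t < 0) :
    deriv Real.smoothTransition t = 0 := by
  have : Real.smoothTransition =ᶠ[𝓝 t] fun _ => 0 := by
    filter_upwards [gt_mem_nhds ht] with s hs
    exact Real.smoothTransition.zero_of_nonpos hs.le
  rw [this.deriv_eq, deriv_const]

/-- The derivative of the transition at t − 1 vanishes unless 1 ≤ t ≤ 2, so it stays bounded after
multiplication by t. With t = η/ε this bounds ∇χ·Y uniformly in ε whenever Y·∇η = O(η). -/
theorem exists_deriv_smoothTransition_bound :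
    ∃ B, 0 ≤ B ∧ ∀ t s : ℝ, |deriv Real.smoothTransition (t - 1) * s| ≤ B * |s| ∧
      |deriv Real.smoothTransition (t - 1) * t| ≤ B := by
  obtain ⟨C, hC⟩ := (isCompact_Icc (a := (0 : ℝ)) (b := 1)).exists_bound_of_continuousOn
    ((Real.smoothTransition.contDiff (n := 1)).continuous_deriv le_rfl).continuousOn
  have hC' : ∀ t, |deriv Real.smoothTransition t| ≤ max C 0 := by
    intro t
    rcases lt_or_ge t 0 with h | h
    · simp [deriv_smoothTransition_eq_zero' h]
    rcases lt_or_ge 1 t with h' | h'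
    · simp [deriv_smoothTransition_eq_zero h']
    · exact (hC t ⟨h, h'⟩).trans (le_max_left _ _)
  refine ⟨max C 0 * 2, by positivity, fun t s => ⟨?_, ?_⟩⟩
  · rw [abs_mul]
    have h1 := hC' (t - 1)
    have h0 : 0 ≤ max C 0 := le_max_right _ _
    nlinarith [abs_nonneg s, mul_le_mul_of_nonneg_right h1 (abs_nonneg s),
      mul_nonneg h0 (abs_nonneg s)]
  · rcases lt_or_ge (t - 1) 0 with h | h
    · simp [deriv_smoothTransition_eq_zero' h]
    rcases lt_or_ge 1 (t - 1) with h' | h'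
    · simp [deriv_smoothTransition_eq_zero h']
    · rw [abs_mul]
      have : |t| ≤ 2 := abs_le.2 ⟨by linarith, by linarith⟩
      exact mul_le_mul (hC' _) this (abs_nonneg _) (le_max_right _ _)

/-- Integration by parts over `Ω`, without boundary condition on `G`, against vector fields
tangential to the boundary. -/
theorem integral_tangential {Ω : Set (E d)} (hΩo : IsOpen Ω) (hΩ : Bornology.IsBounded Ω)
    {η : E d → ℝ} (hη : IsAuxiliary Ω η) {G : E d → ℝ} {Gk : Fin d → E d → ℝ} (hG : L2S Ω G)
    (hGk : ∀ k, L2S Ω (Gk k)) (h : ∀ k, WD Ω k G (Gk k)) {Y : Fin d → E d → ℝ}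
    (hY : ∀ k, ContDiff ℝ 1 (Y k)) {C : ℝ}
    (hC : ∀ x ∈ Ω, |∑ k, Y k x * partialD k η x| ≤ C * η x) :
    ∫ x, G x * ∑ k, partialD k (Y k) x = - ∫ x, ∑ k, Gk k x * Y k x := by
  obtain ⟨B, hB0, hB⟩ := exists_deriv_smoothTransition_bound
  let ε : ℕ → ℝ := fun n => 1 / ((n : ℝ) + 1)
  have hε : ∀ n, 0 < ε n := fun n => by positivity
  have hε0 : Tendsto ε atTop (𝓝 0) := tendsto_one_div_add_atTop_nhds_zero_nat
  let χ : ℕ → E d → ℝ := fun n => cutoff Ω η (ε n)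
  have hχ : ∀ n, ContDiff ℝ 1 (χ n) := fun n =>
    (contDiff_cutoff hΩo hΩ hη (hε n)).of_le (by norm_num)
  have hχs : ∀ n, tsupport (χ n) ⊆ Ω := fun n =>
    (tsupport_cutoff_subset hΩ hη (hε n)).trans (superlevel_subset hΩo hη (hε n))
  have hχc : ∀ n, HasCompactSupport (χ n) := fun n =>
    (isCompact_superlevel hΩ hη (ε n)).of_isClosed_subset (isClosed_tsupport _)
      (tsupport_cutoff_subset hΩ hη (hε n))
  have hdiv : Continuous fun x => ∑ k, partialD k (Y k) x :=
    continuous_finsetSum _ fun k _ => continuous_partialD (hY k) k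
  obtain ⟨D, hD0, hD⟩ := exists_bound_on hΩ hdiv
  -- The only dangerous term carries 1/ε, and there the field enters only through Y·∇η.
  have hpd : ∀ n x, x ∈ Ω → ∑ k, partialD k (fun y => χ n y * Y k y) x =
      χ n x * ∑ k, partialD k (Y k) x +
        deriv Real.smoothTransition (η x / ε n - 1) * ((∑ k, Y k x * partialD k η x) / ε n) := by
    intro n x hx
    rw [Finset.mul_sum, Finset.sum_div, Finset.mul_sum, ← Finset.sum_add_distrib]
    refine Finset.sum_congr rfl fun k _ => ?_
    rw [partialD_mul ((hχ n).differentiable one_ne_zero x) ((hY k).differentiable one_ne_zero x),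
      partialD_cutoff hΩo hη _ _ hx]
    ring
  have hχY : ∀ n k, ContDiff ℝ 1 fun y => χ n y * Y k y := fun n k => (hχ n).mul (hY k)
  have key : ∀ n, ∫ x, G x * ∑ k, partialD k (fun y => χ n y * Y k y) x
      = - ∫ x, ∑ k, Gk k x * (χ n x * Y k x) := by
    intro n
    have e := fun k => (h k).ibp _ (hχY n k) ((hχc n).mul_right)
      ((tsupport_mul_subset_left (f := χ n) (g := Y k)).trans (hχs n))
    simp only [Finset.mul_sum]
    rw [integral_finsetSum _ fun k _ => hG.integrable_cont_mul hΩ (continuous_partialD (hχY n k) k),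
      integral_finsetSum _ fun k _ => (hGk k).integrable_cont_mul hΩ (hχY n k).continuous,
      ← Finset.sum_neg_distrib]
    exact Finset.sum_congr rfl fun k _ => e k
  -- At a fixed point of Ω the cutoff is eventually 1 with zero derivative, so the boundary term
  -- tends to 0 pointwise; its domination comes from |Y·∇η| ≤ Cη.
  have hχ1 : ∀ x ∈ Ω, ∀ᶠ n in atTop, χ n x = 1 ∧
      deriv Real.smoothTransition (η x / ε n - 1) = 0 := by
    intro x hx
    have hpos := hη.pos x hx
    filter_upwards [hε0.eventually (gt_mem_nhds (show (0 : ℝ) < η x / 2 / 2 by positivity))] with n hn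
    have : 2 < η x / ε n := by rw [lt_div_iff₀ (hε n)]; linarith
    constructor
    · simp only [χ, cutoff, indicator_of_mem hx]
      exact Real.smoothTransition.one_of_one_le (by linarith)
    · exact deriv_smoothTransition_eq_zero (by linarith)
  have hGi : Integrable G := by
    have := hG.integrable_cont_mul hΩ (continuous_const (y := (1 : ℝ)))
    simpa using this
  have t1 : Tendsto (fun n => ∫ x, G x * ∑ k, partialD k (fun y => χ n y * Y k y) x) atTop
      (𝓝 (∫ x, G x * ∑ k, partialD k (Y k) x)) := by
    refine tendsto_integral_of_dominated_convergence (fun x => |G x| * (D + |C| * B)) (fun n => ?_)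
      (hGi.abs.mul_const _) (fun n => Eventually.of_forall fun x => ?_)
      (Eventually.of_forall fun x => ?_)
    · exact (hG.meas.mul (continuous_finsetSum _ fun k _ =>
        continuous_partialD (hχY n k) k).measurable).aestronglyMeasurable
    · by_cases hx : x ∈ Ω
      · have hpos := hη.pos x hx
        rw [hpd n x hx, Real.norm_eq_abs, abs_mul]
        refine mul_le_mul_of_nonneg_left ((abs_add_le _ _).trans (add_le_add ?_ ?_)) (abs_nonneg _)
        · rw [abs_mul, abs_of_nonneg (cutoff_bounds _ _ _ _).1]
          have := hD x hx
          have h2 := (cutoff_bounds Ω η (ε n) x).2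
          have h3 := (cutoff_bounds Ω η (ε n) x).1
          nlinarith [abs_nonneg (∑ k, partialD k (Y k) x)]
        · have h1 := (hB (η x / ε n) 0).2
          rw [abs_mul, abs_of_pos (div_pos hpos (hε n))] at h1
          rw [abs_mul, abs_div, abs_of_pos (hε n)]
          calc _ ≤ |deriv Real.smoothTransition (η x / ε n - 1)| * (|C| * η x / ε n) := by
                have := (hε n).le
                gcongr
                exact (hC x hx).trans (by gcongr; exact le_abs_self C)
            _ = |C| * (|deriv Real.smoothTransition (η x / ε n - 1)| * (η x / ε n)) := by ring
            _ ≤ _ := by gcongr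
      · simp [hG.zero x hx]
    · by_cases hx : x ∈ Ω
      · refine tendsto_const_nhds.congr' ?_
        filter_upwards [hχ1 x hx] with n hn
        rw [hpd n x hx, hn.1, hn.2]
        ring
      · simp [hG.zero x hx]
  have hGY : Integrable fun x => ∑ k, |Gk k x * Y k x| :=
    integrable_finsetSum _ fun k _ => ((hGk k).integrable_cont_mul hΩ (hY k).continuous).abs
  have t2 : Tendsto (fun n => ∫ x, ∑ k, Gk k x * (χ n x * Y k x)) atTop
      (𝓝 (∫ x, ∑ k, Gk k x * Y k x)) := by
    refine tendsto_integral_of_dominated_convergence (fun x => ∑ k, |Gk k x * Y k x|) (fun n => ?_)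
      hGY (fun n => Eventually.of_forall fun x => ?_) (Eventually.of_forall fun x => ?_)
    · exact (Finset.measurable_fun_sum _ fun k _ =>
        (hGk k).meas.mul (hχY n k).continuous.measurable).aestronglyMeasurable
    · refine (norm_sum_le _ _).trans (Finset.sum_le_sum fun k _ => ?_)
      rw [Real.norm_eq_abs, mul_left_comm, abs_mul, abs_of_nonneg (cutoff_bounds _ _ _ _).1]
      exact mul_le_of_le_one_left (abs_nonneg _) (cutoff_bounds _ _ _ _).2
    · by_cases hx : x ∈ Ω
      · refine tendsto_const_nhds.congr' ?_
        filter_upwards [hχ1 x hx] with n hn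
        simp [hn.1]
      · simp [fun k => (hGk k).zero x hx]
  exact tendsto_nhds_unique t1 (t2.neg.congr fun n => (key n).symm)

end DGM

/-! ### Division by η: an H² ∩ H¹₀ function as η times a weighted Sobolev function. -/

namespace DGM
open Filter Topology
variable {d : ℕ}

theorem WD.congr {V : Set (E d)} (hV : MeasurableSet V) {i : Fin d} {f g f' g' : E d → ℝ}
    (h : WD V i f g) (hf : ∀ x ∈ V, f x = f' x) (hg : ∀ x ∈ V, g x = g' x) : WD V i f' g' :=
  h.congr_ae hV ((ae_restrict_iff' hV).2 (Eventually.of_forall hf))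
    ((ae_restrict_iff' hV).2 (Eventually.of_forall hg))

/-- No boundary condition on G is needed: the factor η makes the field ηφ e_k admissible in
`integral_tangential`, so no boundary term appears. -/
theorem WD.eta_mul {Ω : Set (E d)} (hΩo : IsOpen Ω) (hΩ : Bornology.IsBounded Ω)
    {η : E d → ℝ} (hη : IsAuxiliary Ω η) {G : E d → ℝ} {Gk : Fin d → E d → ℝ} (hG : L2S Ω G)
    (hGk : ∀ k, L2S Ω (Gk k)) (h : ∀ k, WD Ω k G (Gk k)) (k : Fin d) :
    WD univ k (fun x => η x * G x) (fun x => η x * Gk k x + partialD k η x * G x) := by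
  have hη1 : ContDiff ℝ 1 η := hη.contDiff.of_le (by norm_num)
  have i1 := hG.cont_mul hΩ hη1.continuous
  have i2 := (hGk k).cont_mul hΩ hη1.continuous
  have i3 := hG.cont_mul hΩ (continuous_partialD hη1 k)
  refine ⟨locallyIntegrableOn_univ.2 i1.locallyIntegrable,
    locallyIntegrableOn_univ.2 (i2.add i3).locallyIntegrable, fun φ h1 h2 _ => ?_⟩
  obtain ⟨C, hC0, hC⟩ := exists_bound_on hΩ (ψ := fun x => φ x * partialD k η x)
    (h1.continuous.mul (continuous_partialD hη1 k))
  have hp : ContDiff ℝ 1 fun x => η x * φ x := hη1.mul h1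
  let Y : Fin d → E d → ℝ := fun l => if l = k then fun x => η x * φ x else fun _ => 0
  have hYk : ∀ l x, Y l x = if l = k then η x * φ x else 0 := by
    intro l x
    simp only [Y]; split_ifs <;> rfl
  have hpY : ∀ l x, partialD l (Y l) x = if l = k then partialD k (fun x => η x * φ x) x else 0 := by
    intro l x
    by_cases hl : l = k
    · simp [Y, hl]
    · simp [Y, hl, partialD]
  have := integral_tangential hΩo hΩ hη hG hGk h (Y := Y) (C := C) (fun l => by
      by_cases hl : l = k
      · simpa [Y, hl] using hp
      · simpa [Y, hl] using contDiff_const)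
    (fun x hx => by
      have hpos := hη.pos x hx
      simp only [hYk, ite_mul, zero_mul, Finset.sum_ite_eq', Finset.mem_univ, if_true]
      rw [mul_assoc, abs_mul, abs_of_pos hpos, mul_comm]
      exact mul_le_mul_of_nonneg_right (hC x hx) hpos.le)
  simp only [hpY, hYk, mul_ite, mul_zero, Finset.sum_ite_eq', Finset.mem_univ, if_true] at this
  have e : ∀ x, G x * partialD k (fun x => η x * φ x) x =
      η x * G x * partialD k φ x + partialD k η x * G x * φ x := by
    intro x
    rw [partialD_mul (hη1.differentiable one_ne_zero x) (h1.differentiable one_ne_zero x)]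
    ring
  simp only [e] at this
  rw [integral_add (i1.integrable_cont_mul hΩ (continuous_partialD h1 k))
    (i3.integrable_cont_mul hΩ h1.continuous)] at this
  simp only [add_mul]
  rw [integral_add (i2.integrable_cont_mul hΩ h1.continuous)
    (i3.integrable_cont_mul hΩ h1.continuous)]
  have e2 : ∫ x, η x * Gk k x * φ x = ∫ x, Gk k x * (η x * φ x) :=
    integral_congr_ae (Eventually.of_forall fun x => by dsimp only; ring)
  rw [e2]
  linarith

/-- An `H²` function on `Ω`, with its weak derivatives, extended by zero. -/
structure H2Data (Ω : Set (E d)) (f : E d → ℝ) (fi : Fin d → E d → ℝ)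
    (fij : Fin d → Fin d → E d → ℝ) : Prop where
  l2 : L2S Ω f
  l2i : ∀ i, L2S Ω (fi i)
  l2ij : ∀ i j, L2S Ω (fij i j)
  wd : ∀ i, WD Ω i f (fi i)
  wdi : ∀ i j, WD Ω j (fi i) (fij i j)

theorem integral_sub_sub_add_add_sub {a₁ a₂ a₃ a₄ a₅ a₆ : E d → ℝ} (h₁ : Integrable a₁)
    (h₂ : Integrable a₂) (h₃ : Integrable a₃) (h₄ : Integrable a₄) (h₅ : Integrable a₅)
    (h₆ : Integrable a₆) :
    ∫ x, (a₁ x - a₂ x - a₃ x + a₄ x + a₅ x - a₆ x) =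
      (∫ x, a₁ x) - (∫ x, a₂ x) - (∫ x, a₃ x) + (∫ x, a₄ x) + (∫ x, a₅ x) - ∫ x, a₆ x := by
  rw [← integral_sub' h₁ h₂, ← integral_sub' (h₁.sub h₂) h₃,
    ← integral_add' ((h₁.sub h₂).sub h₃) h₄, ← integral_add' (((h₁.sub h₂).sub h₃).add h₄) h₅,
    ← integral_sub' ((((h₁.sub h₂).sub h₃).add h₄).add h₅) h₆]
  rfl

/-- Tangential derivatives of functions in `H² ∩ H¹₀` extend by zero to weakly differentiable
functions. -/
theorem WD.tangential {Ω : Set (E d)} (hΩo : IsOpen Ω) (hΩ : Bornology.IsBounded Ω)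
    {η : E d → ℝ} (hη : IsAuxiliary Ω η) {f : E d → ℝ} {fi : Fin d → E d → ℝ}
    {fij : Fin d → Fin d → E d → ℝ} (hf : H2Data Ω f fi fij) (h0 : ∀ k, WD univ k f (fi k))
    (i j k : Fin d) :
    WD univ k (fun x => partialD i η x * fi j x - partialD j η x * fi i x)
      (fun x => (partialD k (partialD i η) x * fi j x - partialD k (partialD j η) x * fi i x)
        + (partialD i η x * fij k j x - partialD j η x * fij k i x)) := by
  have c2 := fun i => partialD_contDiff_two hη i
  have c2c := fun i => (c2 i).continuous
  have c1 := fun i k => partialD_partialD_contDiff_one hη k i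
  have c1c := fun i k => (c1 i k).continuous
  have g1 := ((hf.l2i j).cont_mul hΩ (c2c i)).sub ((hf.l2i i).cont_mul hΩ (c2c j))
  have g2 := ((hf.l2i j).cont_mul hΩ (c1c i k)).sub ((hf.l2i i).cont_mul hΩ (c1c j k))
  have g3 := ((hf.l2ij k j).cont_mul hΩ (c2c i)).sub ((hf.l2ij k i).cont_mul hΩ (c2c j))
  refine WD.of_smooth isOpen_univ (locallyIntegrableOn_univ.2 g1.locallyIntegrable)
    (locallyIntegrableOn_univ.2 (g2.add g3).locallyIntegrable) fun φ h1 h2 _ => ?_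
  have p1 : ContDiff ℝ 1 φ := h1.of_le (by exact_mod_cast le_top)
  have p2 : ContDiff ℝ 2 φ := contDiff_infty.1 h1 2
  have q1 := fun i => contDiff_partialD (m := 1) p2 (by norm_num) i
  have q1c := fun i => (q1 i).continuous
  have q0c := fun i j => continuous_partialD (q1 i) j
  have dη := fun i x => (c2 i).differentiable two_ne_zero x
  have dη2 := fun i k x => (c1 i k).differentiable one_ne_zero x
  have dφ := fun x => p1.differentiable one_ne_zero x
  have dφ1 := fun i x => (q1 i).differentiable one_ne_zero x
  have c21 := fun i => (c2 i).of_le (m := 1) (by norm_num)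
  -- weak derivatives of `f` against products
  have A : ∀ (a l m : Fin d), ∫ x, f x * (partialD a η x * partialD m (partialD l φ) x
      + partialD m (partialD a η) x * partialD l φ x)
      = - ∫ x, fi m x * (partialD a η x * partialD l φ x) := by
    intro a l m
    have := (h0 m).ibp (fun x => partialD a η x * partialD l φ x) ((c21 a).mul (q1 l))
      (hasCompactSupport_partialD h2 l).mul_left (subset_univ _)
    rw [← this]
    refine integral_congr_ae (Eventually.of_forall fun x => ?_)
    dsimp only
    rw [partialD_mul (dη a x) (dφ1 l x)]
  have B : ∀ (a m : Fin d), ∫ x, f x * (partialD k (partialD a η) x * partialD m φ x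
      + partialD m (partialD k (partialD a η)) x * φ x)
      = - ∫ x, fi m x * (partialD k (partialD a η) x * φ x) := by
    intro a m
    have := (h0 m).ibp (fun x => partialD k (partialD a η) x * φ x) ((c1 a k).mul p1)
      h2.mul_left (subset_univ _)
    rw [← this]
    refine integral_congr_ae (Eventually.of_forall fun x => ?_)
    dsimp only
    rw [partialD_mul (dη2 a k x) (dφ x)]
  -- the tangential integration by parts for `fi k`
  have hT : ∫ x, fi k x * (partialD i η x * partialD j φ x - partialD j η x * partialD i φ x)
      = - ∫ x, (fij k j x * (partialD i η x * φ x) - fij k i x * (partialD j η x * φ x)) := by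
    -- Y = φ(∂_iη e_j − ∂_jη e_i) is orthogonal to ∇η, so the constant in `integral_tangential` is
    -- 0.
    let Y : Fin d → E d → ℝ := fun l x =>
      (if l = j then 1 else 0) * (partialD i η x * φ x) - (if l = i then 1 else 0) * (partialD j η x * φ x)
    have := integral_tangential hΩo hΩ hη (hf.l2i k) (hf.l2ij k) (hf.wdi k) (Y := Y) (C := 0)
      (fun l => ((contDiff_const.mul ((c21 i).mul p1)).sub (contDiff_const.mul ((c21 j).mul p1))))
      (fun x _ => by
        simp only [Y, sub_mul, ite_mul, one_mul, zero_mul, Finset.sum_sub_distrib,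
          Finset.sum_ite_eq', Finset.mem_univ, if_true]
        apply le_of_eq
        rw [abs_eq_zero]; ring)
    have e1 : ∀ l x, partialD l (Y l) x = (if l = j then 1 else 0) *
        (partialD i η x * partialD l φ x + partialD l (partialD i η) x * φ x)
        - (if l = i then 1 else 0) *
        (partialD j η x * partialD l φ x + partialD l (partialD j η) x * φ x) := by
      intro l x
      have d1 := (((c21 i).mul p1).differentiable one_ne_zero x)
      have d2 := (((c21 j).mul p1).differentiable one_ne_zero x)
      have d1' : DifferentiableAt ℝ (fun x => (if l = j then 1 else 0) * (partialD i η x * φ x)) x :=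
        (differentiableAt_const _).mul d1
      have d2' : DifferentiableAt ℝ (fun x => (if l = i then 1 else 0) * (partialD j η x * φ x)) x :=
        (differentiableAt_const _).mul d2
      rw [partialD_sub d1' d2', partialD_mul (differentiableAt_const _) d1, partialD_mul (differentiableAt_const _) d2,
        partialD_mul (dη i x) (dφ x), partialD_mul (dη j x) (dφ x)]
      simp [partialD]
    simp only [e1] at this
    simp only [Y, mul_sub, ite_mul, one_mul, zero_mul, mul_ite, mul_zero,
      Finset.sum_sub_distrib, Finset.sum_ite_eq', Finset.mem_univ, if_true] at this
    rw [← this]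
    refine integral_congr_ae (Eventually.of_forall fun x => ?_)
    dsimp only
    rw [partialD_comm (hη.contDiff.of_le (by norm_num)) j i]
    ring
  have A1 := A i k j
  have A2 := A j k i
  have A3 := A i j k
  have A4 := A j i k
  have B1 := B i j
  have B2 := B j i
  have I := fun {a b : E d → ℝ} (ha : L2S Ω a) (hb : Continuous b) => ha.integrable_cont_mul hΩ hb
  -- Third derivatives of η appear when the weak derivatives of f are moved off f; they cancel by
  -- symmetry.
  have third : ∀ x, partialD j (partialD k (partialD i η)) x = partialD i (partialD k (partialD j η)) x := by
    intro x
    rw [partialD_comm (c2 i) j k, partialD_comm (c2 j) i k]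
    congr 1
    ext y
    exact partialD_comm (hη.contDiff.of_le (by norm_num)) j i y
  have iA : ∀ a l m, Integrable fun x => f x * (partialD a η x * partialD m (partialD l φ) x
      + partialD m (partialD a η) x * partialD l φ x) := fun a l m =>
    I hf.l2 (((c2c a).mul (q0c l m)).add ((c1c a m).mul (q1c l)))
  have c0 : ∀ a m, Continuous (partialD m (partialD k (partialD a η))) := fun a m =>
    continuous_partialD (c1 a k) m
  have iB : ∀ a m, Integrable fun x => f x * (partialD k (partialD a η) x * partialD m φ x
      + partialD m (partialD k (partialD a η)) x * φ x) := fun a m =>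
    I hf.l2 (((c1c a k).mul (q1c m)).add ((c0 a m).mul p1.continuous))
  have iA' : ∀ a l m, Integrable fun x => fi m x * (partialD a η x * partialD l φ x) := fun a l m =>
    I (hf.l2i m) ((c2c a).mul (q1c l))
  have iB' : ∀ a m, Integrable fun x => fi m x * (partialD k (partialD a η) x * φ x) := fun a m =>
    I (hf.l2i m) ((c1c a k).mul p1.continuous)
  have iT : ∀ a m, Integrable fun x => fij k m x * (partialD a η x * φ x) := fun a m =>
    I (hf.l2ij k m) ((c2c a).mul p1.continuous)
  -- Since f itself is weakly differentiable across ∂Ω, every first-order term can be written as an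
  -- integral of f against derivatives of φ and η. The resulting six integrals cancel by the
  -- symmetry of mixed derivatives, which exchanges ∂_kφ with the tangential derivative of φ.
  have S : (∫ x, f x * (partialD i η x * partialD j (partialD k φ) x
      + partialD j (partialD i η) x * partialD k φ x))
      - (∫ x, f x * (partialD j η x * partialD i (partialD k φ) x
      + partialD i (partialD j η) x * partialD k φ x))
      - (∫ x, f x * (partialD i η x * partialD k (partialD j φ) x
      + partialD k (partialD i η) x * partialD j φ x))
      + (∫ x, f x * (partialD j η x * partialD k (partialD i φ) x
      + partialD k (partialD j η) x * partialD i φ x))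
      + (∫ x, f x * (partialD k (partialD i η) x * partialD j φ x
      + partialD j (partialD k (partialD i η)) x * φ x))
      - (∫ x, f x * (partialD k (partialD j η) x * partialD i φ x
      + partialD i (partialD k (partialD j η)) x * φ x)) = 0 := by
    rw [← integral_sub_sub_add_add_sub (iA i k j) (iA j k i) (iA i j k) (iA j i k) (iB i j) (iB j i)]
    rw [← integral_zero (E d) ℝ]
    refine integral_congr_ae (Eventually.of_forall fun x => ?_)
    dsimp only
    rw [third, partialD_comm p2 k j, partialD_comm p2 k i,
      partialD_comm (hη.contDiff.of_le (by norm_num)) j i]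
    ring
  have L1 : ∫ x, (partialD i η x * fi j x - partialD j η x * fi i x) * partialD k φ x
      = (∫ x, fi j x * (partialD i η x * partialD k φ x))
        - ∫ x, fi i x * (partialD j η x * partialD k φ x) := by
    rw [← integral_sub (iA' i k j) (iA' j k i)]
    exact integral_congr_ae (Eventually.of_forall fun x => by dsimp only; ring)
  have L2 : ∫ x, fi k x * (partialD i η x * partialD j φ x - partialD j η x * partialD i φ x)
      = (∫ x, fi k x * (partialD i η x * partialD j φ x))
        - ∫ x, fi k x * (partialD j η x * partialD i φ x) := by
    rw [← integral_sub (iA' i j k) (iA' j i k)]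
    exact integral_congr_ae (Eventually.of_forall fun x => by dsimp only; ring)
  have L3 : ∫ x, ((partialD k (partialD i η) x * fi j x - partialD k (partialD j η) x * fi i x)
        + (partialD i η x * fij k j x - partialD j η x * fij k i x)) * φ x
      = (∫ x, fi j x * (partialD k (partialD i η) x * φ x))
        - (∫ x, fi i x * (partialD k (partialD j η) x * φ x))
        + ∫ x, (fij k j x * (partialD i η x * φ x) - fij k i x * (partialD j η x * φ x)) := by
    have i1 : Integrable fun x => fi j x * (partialD k (partialD i η) x * φ x)
        - fi i x * (partialD k (partialD j η) x * φ x) := (iB' i j).sub (iB' j i)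
    have i2 : Integrable fun x => fij k j x * (partialD i η x * φ x)
        - fij k i x * (partialD j η x * φ x) := (iT i j).sub (iT j i)
    rw [← integral_sub (iB' i j) (iB' j i), ← integral_add i1 i2]
    exact integral_congr_ae (Eventually.of_forall fun x => by dsimp only; ring)
  rw [L1, L3]
  rw [L2] at hT
  linarith

/-- A function in `H² ∩ H¹₀` is `η q` with `q` in a weighted Sobolev space. -/
theorem exists_quotient {Ω : Set (E d)} (hΩo : IsOpen Ω) (hΩ : Bornology.IsBounded Ω)
    {η : E d → ℝ} (hη : IsAuxiliary Ω η) {f : E d → ℝ} {fi : Fin d → E d → ℝ}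
    {fij : Fin d → Fin d → E d → ℝ} (hf : H2Data Ω f fi fij) (h0 : ∀ k, WD univ k f (fi k)) :
    ∃ (q : E d → ℝ) (qi : Fin d → E d → ℝ) (qij : Fin d → Fin d → E d → ℝ),
      L2S Ω q ∧ (∀ i, L2S Ω (qi i)) ∧ (∀ i j, L2S Ω fun x => η x * qij i j x) ∧
      (∀ i j, Measurable (qij i j)) ∧
      (∀ i, WD Ω i q (qi i)) ∧ (∀ i j, WD Ω j (qi i) (qij i j)) ∧
      (∀ x ∈ Ω, f x = η x * q x) ∧
      (∀ i, ∀ x ∈ Ω, fi i x = η x * qi i x + partialD i η x * q x) ∧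
      (∀ i j, ∀ x ∈ Ω, fij i j x = η x * qij i j x + partialD j η x * qi i x
        + partialD i η x * qi j x + partialD j (partialD i η) x * q x) := by
  have hη1 : ContDiff ℝ 1 η := hη.contDiff.of_le (by norm_num)
  have c2 := fun i => partialD_contDiff_two hη i
  have c2c := fun i => (c2 i).continuous
  have c21 := fun i => (c2 i).of_le (m := 1) (by norm_num)
  have c1 := fun i k => partialD_partialD_contDiff_one hη k i
  have c1c := fun i k => (c1 i k).continuous
  have hηne : ∀ x ∈ Ω, η x ≠ 0 := fun x hx => (hη.pos x hx).ne'
  have L0 : ∀ {F : E d → ℝ}, L2S Ω F → L2S Ω fun x => F x / η x ^ 0 := fun hF => by simpa using hF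
  have hq : L2S Ω fun x => f x / η x := by
    simpa using hardy hΩo hΩ hη 0 hf.l2 hf.l2i h0 (L0 hf.l2)
      (L0 (L2S.sum _ fun k _ => (hf.l2i k).cont_mul hΩ (c2c k)))
  -- The tangential derivative ∂_iη f_j − ∂_jη f_i extends by zero, so Hardy's inequality allows
  -- dividing it by η.
  have hT : ∀ i j, L2S Ω fun x => (partialD i η x * fi j x - partialD j η x * fi i x) / η x := by
    intro i j
    have t0 : L2S Ω fun x => partialD i η x * fi j x - partialD j η x * fi i x :=
      ((hf.l2i j).cont_mul hΩ (c2c i)).sub ((hf.l2i i).cont_mul hΩ (c2c j))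
    have tk : ∀ k, L2S Ω fun x =>
        (partialD k (partialD i η) x * fi j x - partialD k (partialD j η) x * fi i x)
        + (partialD i η x * fij k j x - partialD j η x * fij k i x) := fun k =>
      (((hf.l2i j).cont_mul hΩ (c1c i k)).sub ((hf.l2i i).cont_mul hΩ (c1c j k))).add
        (((hf.l2ij k j).cont_mul hΩ (c2c i)).sub ((hf.l2ij k i).cont_mul hΩ (c2c j)))
    simpa using hardy hΩo hΩ hη 0 t0 tk (WD.tangential hΩo hΩ hη hf h0 i j) (L0 t0)
      (L0 (L2S.sum _ fun k _ => (tk k).cont_mul hΩ (c2c k)))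
  -- The numerator is η²∂_jq for q = f/η. Two uses of Hardy's inequality, with m = 0 and then m = 1,
  -- divide it by η².
  have hP : ∀ j, L2S Ω fun x => (η x * fi j x - partialD j η x * f x) / η x ^ 2 := by
    intro j
    have p0 : L2S Ω fun x => η x * fi j x - partialD j η x * f x :=
      ((hf.l2i j).cont_mul hΩ hη1.continuous).sub (hf.l2.cont_mul hΩ (c2c j))
    have pk : ∀ k, L2S Ω fun x => (η x * fij j k x + partialD k η x * fi j x)
        - (partialD j η x * fi k x + partialD k (partialD j η) x * f x) := fun k =>
      (((hf.l2ij j k).cont_mul hΩ hη1.continuous).add ((hf.l2i j).cont_mul hΩ (c2c k))).sub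
        (((hf.l2i k).cont_mul hΩ (c2c j)).add (hf.l2.cont_mul hΩ (c1c j k)))
    have pw : ∀ k, WD univ k (fun x => η x * fi j x - partialD j η x * f x)
        (fun x => (η x * fij j k x + partialD k η x * fi j x)
        - (partialD j η x * fi k x + partialD k (partialD j η) x * f x)) := fun k =>
      (WD.eta_mul hΩo hΩ hη (hf.l2i j) (hf.l2ij j) (hf.wdi j) k).sub isOpen_univ
        ((h0 k).mul isOpen_univ (c21 j).contDiffOn)
    have p1 : L2S Ω fun x => (η x * fi j x - partialD j η x * f x) / η x ^ 1 := by
      simpa using hardy hΩo hΩ hη 0 p0 pk pw (L0 p0)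
        (L0 (L2S.sum _ fun k _ => (pk k).cont_mul hΩ (c2c k)))
    refine hardy hΩo hΩ hη 1 p0 pk pw p1 ?_
    -- The hypothesis of `hardy` for m = 1: after division by η, ∇η·∇(η f_j − ∂_jη f) contains first
    -- derivatives of f only through tangential combinations divided by η, and f only through f/η;
    -- both are already in L².
    have s := L2S.sum (Ω := Ω) Finset.univ (F := fun k x => partialD k η x *
      (((partialD k η x * fi j x - partialD j η x * fi k x) / η x + fij j k x)
        - partialD k (partialD j η) x * (f x / η x))) fun k _ =>
      (((hT k j).add (hf.l2ij j k)).sub (hq.cont_mul hΩ (c1c j k))).cont_mul hΩ (c2c k)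
    convert s using 2 with x
    by_cases hx : x ∈ Ω
    · have := hηne x hx
      rw [Finset.sum_div]
      refine Finset.sum_congr rfl fun k _ => ?_
      field_simp
      ring
    · simp [hf.l2.zero x hx, fun k => (hf.l2i k).zero x hx, fun k l => (hf.l2ij k l).zero x hx]
  let q : E d → ℝ := fun x => f x / η x
  let qi : Fin d → E d → ℝ := fun j x => (η x * fi j x - partialD j η x * f x) / η x ^ 2
  -- Leibniz' rule for f = ηq solved for η∂_i∂_jq. Only this product, not ∂_i∂_jq itself, is claimed
  -- to be in L².
  have hr : ∀ i j, L2S Ω fun x => ((fij i j x - partialD j η x * qi i x)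
      - partialD i η x * qi j x) - partialD j (partialD i η) x * q x := fun i j =>
    (((hf.l2ij i j).sub ((hP i).cont_mul hΩ (c2c j))).sub ((hP j).cont_mul hΩ (c2c i))).sub
      (hq.cont_mul hΩ (c1c i j))
  have hinv : ContDiffOn ℝ 1 (fun x => (η x)⁻¹) Ω := hη1.contDiffOn.inv hηne
  have hinvd : ∀ k, ∀ x ∈ Ω, partialD k (fun x => (η x)⁻¹) x = - (partialD k η x / η x ^ 2) := by
    intro k x hx
    rw [partialD_comp (h := fun s => s⁻¹) (hη1.differentiable one_ne_zero x)
      (differentiableAt_inv (hηne x hx)), deriv_inv]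
    ring
  have hfq : ∀ i, ∀ x ∈ Ω, fi i x = η x * qi i x + partialD i η x * q x := by
    intro i x hx
    have := hηne x hx
    simp only [q, qi]
    field_simp
    ring
  have w1 : ∀ i, WD Ω i q (qi i) := by
    intro i
    refine ((hf.wd i).mul hΩo hinv).congr hΩo.measurableSet (fun x hx => ?_) fun x hx => ?_
    · simp only [q]; ring
    · have := hηne x hx
      rw [hinvd i x hx]
      simp only [qi]
      field_simp
      ring
  refine ⟨q, qi, fun i j x => (((fij i j x - partialD j η x * qi i x)
      - partialD i η x * qi j x) - partialD j (partialD i η) x * q x) / η x, hq, hP,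
    fun i j => ?_, fun i j => (hr i j).meas.div hη1.continuous.measurable, w1, fun i j => ?_,
    fun x hx => ?_, hfq, fun i j x hx => ?_⟩
  · convert hr i j using 2 with x
    by_cases hx : x ∈ Ω
    · have := hηne x hx
      field_simp
    · dsimp only
      rw [(hr i j).zero x hx]; simp
  · refine (((hf.wdi i j).sub hΩo ((w1 j).mul hΩo (c21 i).contDiffOn)).mul hΩo hinv).congr
      hΩo.measurableSet (fun x hx => ?_) fun x hx => ?_
    · have := hηne x hx
      rw [hfq i x hx]
      field_simp
      ring
    · have := hηne x hx
      rw [hinvd j x hx, hfq i x hx]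
      field_simp
      ring
  · have := hηne x hx
    simp only [q]
    field_simp
  · have := hηne x hx
    field_simp
    ring

end DGM

/-! ### Inward cones and translation in weighted L². -/

namespace DGM
open Filter Topology
variable {d : ℕ}

/-- Near every point of the closure there is an open cone of directions along which `η` does not
decrease by more than a constant factor and which point into `Ω`. -/
theorem exists_inward_cone {Ω : Set (E d)} (hΩo : IsOpen Ω) {η : E d → ℝ} (hη : IsAuxiliary Ω η)
    {x₀ : E d} (hx₀ : x₀ ∈ closure Ω) :
    ∃ (r C : ℝ) (Γ : Set (E d)), 0 < r ∧ 0 ≤ C ∧ IsOpen Γ ∧ 0 ∈ closure Γ ∧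
      ∀ x ∈ Ω, x ∈ Metric.ball x₀ r → ∀ u ∈ Γ, u ∈ Metric.ball 0 r →
        x + u ∈ Ω ∧ η x ≤ C * η (x + u) := by
  have hc : Continuous η := hη.contDiff.continuous
  by_cases hx : x₀ ∈ Ω
  -- Interior point: every small direction is admissible, and C is the ratio of the maximum to the
  -- minimum of η on a closed ball inside Ω.
  · obtain ⟨ρ, hρ, hsub⟩ := Metric.nhds_basis_closedBall.mem_iff.1 (hΩo.mem_nhds hx)
    have hcpt : IsCompact (Metric.closedBall x₀ ρ) := isCompact_closedBall _ _
    have hne : (Metric.closedBall x₀ ρ).Nonempty := ⟨x₀, Metric.mem_closedBall_self hρ.le⟩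
    obtain ⟨a, ha, hmin⟩ := hcpt.exists_isMinOn hne hc.continuousOn
    obtain ⟨b, hb, hmax⟩ := hcpt.exists_isMaxOn hne hc.continuousOn
    have hpa := hη.pos a (hsub ha)
    have hpb := hη.pos b (hsub hb)
    refine ⟨ρ / 2, η b / η a, univ, half_pos hρ, by positivity, isOpen_univ, by simp,
      fun x hxΩ hx u _ hu => ?_⟩
    rw [Metric.mem_ball] at hx hu
    have h1 : x + u ∈ Metric.closedBall x₀ ρ := by
      rw [Metric.mem_closedBall]
      have := dist_triangle (x + u) x x₀
      rw [dist_self_add_left] at this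
      rw [dist_zero_right] at hu
      linarith
    have h2 : x ∈ Metric.closedBall x₀ ρ := Metric.mem_closedBall.2 (by linarith)
    refine ⟨hsub h1, (hmax h2).trans ?_⟩
    rw [div_mul_eq_mul_div, le_div_iff₀ hpa]
    exact mul_le_mul_of_nonneg_left (hmin h1) hpb.le
  · have hne := hη.fderiv_ne x₀ (by rw [hΩo.frontier_eq]; exact ⟨hx₀, hx⟩)
    obtain ⟨v, hv⟩ : ∃ v, 0 < fderiv ℝ η x₀ v := by
      by_contra! hcon
      refine hne ?_
      ext v
      refine le_antisymm (hcon v) ?_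
      have := hcon (-v)
      rw [map_neg] at this
      simpa using this
    have hv0 : v ≠ 0 := by rintro rfl; simp at hv
    have hvn : 0 < ‖v‖ := norm_pos_iff.2 hv0
    -- Boundary point: the cone consists of u with Dη(x₀)u > a‖u‖. Half the slope in the direction v
    -- puts all s v with s > 0 in it, so its closure contains 0.
    let a : ℝ := fderiv ℝ η x₀ v / (2 * ‖v‖)
    have ha : 0 < a := by positivity
    have hcd : Continuous (fderiv ℝ η) := hη.contDiff.continuous_fderiv three_ne_zero
    obtain ⟨ρ, hρ, hclose⟩ := Metric.continuousAt_iff.1 hcd.continuousAt a ha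
    refine ⟨ρ / 2, 1, {u | a * ‖u‖ < fderiv ℝ η x₀ u}, half_pos hρ, zero_le_one,
      isOpen_lt (by fun_prop) (by fun_prop), ?_, fun x hxΩ hx u hu hur => ?_⟩
    · have ht : Tendsto (fun s : ℝ => s • v) (𝓝[>] 0) (𝓝 0) := by
        have : Continuous fun s : ℝ => s • v := by fun_prop
        simpa using (this.tendsto 0).mono_left nhdsWithin_le_nhds
      refine mem_closure_of_tendsto ht ?_
      filter_upwards [self_mem_nhdsWithin] with s hs
      rw [mem_Ioi] at hs
      rw [norm_smul, map_smul, Real.norm_eq_abs, abs_of_pos hs, smul_eq_mul]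
      have : a * ‖v‖ = fderiv ℝ η x₀ v / 2 := by simp only [a]; field_simp
      calc a * (s * ‖v‖) = s * (fderiv ℝ η x₀ v / 2) := by rw [← this]; ring
        _ < _ := by nlinarith
    · rw [Metric.mem_ball] at hx hur
      rw [dist_zero_right] at hur
      change a * ‖u‖ < fderiv ℝ η x₀ u at hu
      have hmem : ∀ t ∈ Icc (0 : ℝ) 1, dist (x + t • u) x₀ < ρ := by
        intro t ht
        have := dist_triangle (x + t • u) x x₀
        rw [dist_self_add_left, norm_smul, Real.norm_eq_abs, abs_of_nonneg ht.1] at this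
        nlinarith [ht.2, norm_nonneg u]
      have hder : ∀ t : ℝ, HasDerivAt (fun t : ℝ => η (x + t • u)) (fderiv ℝ η (x + t • u) u) t := by
        intro t
        have h1 : HasFDerivAt η (fderiv ℝ η (x + t • u)) (x + t • u) :=
          (hη.contDiff.differentiable three_ne_zero _).hasFDerivAt
        have h2 : HasDerivAt (fun t : ℝ => x + t • u) u t := by
          simpa using ((hasDerivAt_id t).smul_const u).const_add x
        exact h1.comp_hasDerivAt t h2
      -- Near x₀ the derivative of η is within a of Dη(x₀), so η does not decrease along directions
      -- of the cone; hence C = 1.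
      have hmono : MonotoneOn (fun t : ℝ => η (x + t • u)) (Icc 0 1) := by
        refine monotoneOn_of_deriv_nonneg (convex_Icc 0 1)
          (fun t _ => (hder t).continuousAt.continuousWithinAt)
          (fun t _ => (hder t).differentiableAt.differentiableWithinAt) fun t ht => ?_
        rw [(hder t).deriv]
        have h3 := hclose (hmem t (interior_subset ht))
        rw [dist_eq_norm] at h3
        have h4 := (fderiv ℝ η (x + t • u) - fderiv ℝ η x₀).le_opNorm u
        rw [sub_apply, Real.norm_eq_abs] at h4
        have h5 := neg_abs_le (fderiv ℝ η (x + t • u) u - fderiv ℝ η x₀ u)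
        nlinarith [norm_nonneg u]
      have hge : ∀ t ∈ Icc (0 : ℝ) 1, η x ≤ η (x + t • u) := by
        intro t ht
        have := hmono ⟨le_rfl, zero_le_one⟩ ht ht.1
        simpa using this
      have hpos := hη.pos x hxΩ
      refine ⟨?_, by simpa using hge 1 ⟨zero_le_one, le_rfl⟩⟩
      -- Along the segment from x to x + u, η stays at least η(x) > 0, so the segment avoids ∂Ω;
      -- being connected, it cannot leave Ω.
      by_contra hnot
      have hpre : IsPreconnected ((fun t : ℝ => x + t • u) '' Icc 0 1) :=
        isPreconnected_Icc.image _ (by fun_prop)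
      have hfr : ∀ y ∈ (fun t : ℝ => x + t • u) '' Icc 0 1, y ∉ frontier Ω := by
        rintro _ ⟨t, ht, rfl⟩ hy
        have h6 := hη.zero _ hy
        have h7 := hge t ht
        simp only at h6
        linarith
      have hmem0 : x ∈ (fun t : ℝ => x + t • u) '' Icc 0 1 := ⟨0, ⟨le_rfl, zero_le_one⟩, by simp⟩
      have hmem1 : x + u ∈ (fun t : ℝ => x + t • u) '' Icc 0 1 := ⟨1, ⟨zero_le_one, le_rfl⟩, by simp⟩
      have hout : ∀ y ∈ (fun t : ℝ => x + t • u) '' Icc 0 1, y ∉ Ω → y ∈ (closure Ω)ᶜ :=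
        fun y hy hyΩ hcl => hfr y hy (by rw [hΩo.frontier_eq]; exact ⟨hcl, hyΩ⟩)
      obtain ⟨y, -, hy1, hy2⟩ := hpre Ω (closure Ω)ᶜ hΩo isClosed_closure.isOpen_compl
        (fun y hy => (em (y ∈ Ω)).imp id (hout y hy)) ⟨x, hmem0, hxΩ⟩
        ⟨x + u, hmem1, hout _ hmem1 hnot⟩
      exact hy2 (subset_closure hy1)

/-- Translation along an inward cone is continuous in weighted `L²`. -/
theorem tendsto_lintegral_weighted_translate {Ω : Set (E d)} (hΩo : IsOpen Ω) {η : E d → ℝ}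
    (hη : IsAuxiliary Ω η) {x₀ : E d} {r C : ℝ} {Γ : Set (E d)} (hr : 0 < r) (hC : 0 ≤ C)
    (hΓ : ∀ x ∈ Ω, x ∈ Metric.ball x₀ r → ∀ u ∈ Γ, u ∈ Metric.ball 0 r →
        x + u ∈ Ω ∧ η x ≤ C * η (x + u)) {w : E d → ℝ}
    (hF : L2S Ω fun x => η x * w x) (hw0 : ∀ x, x ∉ Metric.closedBall x₀ (r / 4) → w x = 0) :
    Tendsto (fun u => ∫⁻ x in Ω, ‖η x * w (x + u) - η x * w x‖ₑ ^ 2) (𝓝[Γ] 0) (𝓝 0) := by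
  have hc : Continuous η := hη.contDiff.continuous
  let F : E d → ℝ := fun x => η x * w x
  let ρ : E d → E d → ℝ := fun u x =>
    (Ω ∩ Metric.ball x₀ r).indicator (fun x => (η x / η (x + u) - 1) * F x) x
  have hsm : MeasurableSet (Ω ∩ Metric.ball x₀ r) :=
    hΩo.measurableSet.inter Metric.isOpen_ball.measurableSet
  have hev : ∀ᶠ u in 𝓝[Γ] (0 : E d), u ∈ Γ ∧ u ∈ Metric.ball (0 : E d) (r / 4) :=
    (eventually_mem_nhdsWithin).and
      (mem_nhdsWithin_of_mem_nhds (Metric.ball_mem_nhds 0 (by positivity)))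
  have t1 : Tendsto (fun u => ∫⁻ x in Ω, ‖F (x + u) - F x‖ₑ ^ 2) (𝓝[Γ] 0) (𝓝 0) := by
    refine tendsto_of_tendsto_of_tendsto_of_le_of_le tendsto_const_nhds
      ((tendsto_lintegral_translate hF.memLp).mono_left nhdsWithin_le_nhds)
      (fun _ => zero_le) fun u => ?_
    exact lintegral_mono' Measure.restrict_le_self le_rfl
  have hFfin : ∫⁻ x in Ω, ‖(C + 1) * F x‖ₑ ^ 2 ≠ ⊤ := by
    have h1 : MemLp (fun x => (C + 1) * F x) 2 (volume.restrict Ω) :=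
      (hF.memLp.restrict Ω).const_mul _
    have := lintegral_rpow_enorm_lt_top_of_eLpNorm_lt_top (by norm_num) (by norm_num) h1.2
    simpa using this.ne
  have hρ1 : ∀ u, u ∈ Γ ∧ u ∈ Metric.ball (0 : E d) (r / 4) → ∀ x, x ∈ Ω ∩ Metric.ball x₀ r →
      0 ≤ η x / η (x + u) ∧ η x / η (x + u) ≤ C ∧ x + u ∈ Ω := by
    rintro u ⟨hu1, hu2⟩ x hx
    have h3 := hΓ x hx.1 hx.2 u hu1 (Metric.ball_subset_ball (by linarith) hu2)
    have hp1 := hη.pos x hx.1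
    have hp2 := hη.pos _ h3.1
    exact ⟨by positivity, by rw [div_le_iff₀ hp2]; exact h3.2, h3.1⟩
  have t2 : Tendsto (fun u => ∫⁻ x in Ω, ‖ρ u x‖ₑ ^ 2) (𝓝[Γ] 0) (𝓝 0) := by
    have := tendsto_lintegral_filter_of_dominated_convergence (μ := volume.restrict Ω)
      (l := 𝓝[Γ] (0 : E d)) (F := fun u x => ‖ρ u x‖ₑ ^ 2) (f := fun _ => 0)
      (fun x => ‖(C + 1) * F x‖ₑ ^ 2)
      (Eventually.of_forall fun u => by
        have : Measurable (ρ u) := by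
          refine Measurable.indicator (Measurable.mul ?_ hF.meas) hsm
          exact (hc.measurable.div (hc.comp (continuous_add_const u)).measurable).sub_const 1
        exact this.enorm.pow_const 2)
      (by
        filter_upwards [hev] with u hu
        refine Eventually.of_forall fun x => ?_
        by_cases hx : x ∈ Ω ∩ Metric.ball x₀ r
        · simp only [ρ, indicator_of_mem hx, enorm_mul]
          gcongr
          rw [Real.enorm_eq_ofReal_abs, Real.enorm_eq_ofReal_abs]
          refine ENNReal.ofReal_le_ofReal ?_
          obtain ⟨h1, h2, -⟩ := hρ1 u hu x hx
          rw [abs_of_nonneg (by linarith : 0 ≤ C + 1)]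
          exact abs_le.2 ⟨by linarith, by linarith⟩
        · simp [ρ, indicator_of_notMem hx])
      hFfin
      (Eventually.of_forall fun x => by
        by_cases hx : x ∈ Ω ∩ Metric.ball x₀ r
        · have hp := hη.pos x hx.1
          have h1 : Tendsto (fun u => (η x / η (x + u) - 1) * F x) (𝓝[Γ] 0)
              (𝓝 ((η x / η (x + 0) - 1) * F x)) := by
            refine Tendsto.mono_left ?_ nhdsWithin_le_nhds
            refine Tendsto.mul_const _ (Tendsto.sub_const (Tendsto.div tendsto_const_nhds ?_ ?_) _)
            · exact (hc.comp (continuous_const_add x)).tendsto 0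
            · simpa using hp.ne'
          rw [add_zero, div_self hp.ne', sub_self, zero_mul] at h1
          have h2 := ((ENNReal.continuous_pow 2).comp continuous_enorm).tendsto (0 : ℝ) |>.comp h1
          simp only [ρ, indicator_of_mem hx]
          simpa [Function.comp_def] using h2
        · simpa [ρ, indicator_of_notMem hx] using tendsto_const_nhds)
    simpa using this
  have hbound : ∀ᶠ u in 𝓝[Γ] (0 : E d), ∫⁻ x in Ω, ‖η x * w (x + u) - η x * w x‖ₑ ^ 2 ≤
      2 * (ENNReal.ofReal C ^ 2 * (∫⁻ x in Ω, ‖F (x + u) - F x‖ₑ ^ 2)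
        + ∫⁻ x in Ω, ‖ρ u x‖ₑ ^ 2) := by
    filter_upwards [hev] with u hu
    have hm1 : Measurable fun x => ‖F (x + u) - F x‖ₑ ^ 2 :=
      ((hF.meas.comp (measurable_add_const u)).sub hF.meas).enorm.pow_const 2
    rw [← lintegral_const_mul _ hm1, ← lintegral_add_left (hm1.const_mul _),
      ← lintegral_const_mul' _ _ (by norm_num)]
    refine setLIntegral_mono' hΩo.measurableSet fun x hx => ?_
    by_cases hxb : x ∈ Metric.ball x₀ r
    · obtain ⟨h1, h2, h3⟩ := hρ1 u hu x ⟨hx, hxb⟩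
      have hp2 := hη.pos _ h3
      -- With F = ηw: a bounded factor times F(x+u) − F(x), handled by unweighted translation, plus
      -- (η(x)/η(x+u) − 1)F(x), handled by dominated convergence.
      have e : η x * w (x + u) - η x * w x =
          (η x / η (x + u)) * (F (x + u) - F x) + ρ u x := by
        simp only [ρ, indicator_of_mem (show x ∈ Ω ∩ Metric.ball x₀ r from ⟨hx, hxb⟩), F]
        field_simp
        ring
      rw [e]
      calc _ ≤ (‖(η x / η (x + u)) * (F (x + u) - F x)‖ₑ + ‖ρ u x‖ₑ) ^ 2 := by
            gcongr; exact enorm_add_le _ _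
        _ ≤ 2 * (‖(η x / η (x + u)) * (F (x + u) - F x)‖ₑ ^ 2 + ‖ρ u x‖ₑ ^ 2) := by
            have := ENNReal.rpow_add_le_mul_rpow_add_rpow
              (‖(η x / η (x + u)) * (F (x + u) - F x)‖ₑ) (‖ρ u x‖ₑ) (p := 2) (by norm_num)
            norm_num at this
            simpa using this
        _ ≤ _ := by
            rw [enorm_mul, mul_pow]
            gcongr
            rw [Real.enorm_eq_ofReal_abs, abs_of_nonneg h1]
            exact ENNReal.ofReal_le_ofReal h2
    · have hw1 : w x = 0 := hw0 x fun h => hxb (by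
        rw [Metric.mem_closedBall] at h; rw [Metric.mem_ball]; linarith)
      have hw2 : w (x + u) = 0 := hw0 _ fun h => hxb (by
        rw [Metric.mem_closedBall] at h
        have h2 := hu.2
        rw [mem_ball_zero_iff] at h2
        have := dist_triangle_left x x₀ (x + u)
        rw [dist_self_add_left] at this
        rw [Metric.mem_ball]; linarith)
      simp [hw1, hw2]
  refine tendsto_of_tendsto_of_tendsto_of_le_of_le' tendsto_const_nhds ?_
    (Eventually.of_forall fun _ => zero_le) hbound
  have h1 := ENNReal.Tendsto.const_mul (a := ENNReal.ofReal C ^ 2) t1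
    (Or.inr (ENNReal.pow_ne_top ENNReal.ofReal_ne_top))
  have h2 := ENNReal.Tendsto.const_mul (a := 2) (h1.add t2) (Or.inr (by norm_num))
  simpa using h2

end DGM

/-! ### Approximation in the weighted Sobolev norm: the local statement. -/

namespace DGM
open Filter Topology
variable {d : ℕ}

theorem eLpNorm_two_eq {α : Type*} [MeasurableSpace α] {μ : Measure α} (f : α → ℝ) :
    eLpNorm f 2 μ = (∫⁻ x, ‖f x‖ₑ ^ 2 ∂μ) ^ (1 / 2 : ℝ) := by
  rw [eLpNorm_eq_lintegral_rpow_enorm_toReal (by norm_num) (by norm_num)]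
  simp

theorem tendsto_eLpNorm_two {α : Type*} [MeasurableSpace α] {μ : Measure α} {f : ℕ → α → ℝ}
    (h : Tendsto (fun n => ∫⁻ x, ‖f n x‖ₑ ^ 2 ∂μ) atTop (𝓝 0)) :
    Tendsto (fun n => eLpNorm (f n) 2 μ) atTop (𝓝 0) := by
  simp only [eLpNorm_two_eq]
  have := (ENNReal.continuous_rpow_const (y := 1 / 2)).tendsto 0 |>.comp h
  simpa [Function.comp_def] using this

theorem tendsto_lintegral_sq_of_eLpNorm {α : Type*} [MeasurableSpace α] {μ : Measure α}
    {f : ℕ → α → ℝ} (h : Tendsto (fun n => eLpNorm (f n) 2 μ) atTop (𝓝 0)) :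
    Tendsto (fun n => ∫⁻ x, ‖f n x‖ₑ ^ 2 ∂μ) atTop (𝓝 0) := by
  have := (ENNReal.continuous_pow 2).tendsto 0 |>.comp h
  simp only [Function.comp_def, eLpNorm_two_eq, ← ENNReal.rpow_natCast, ← ENNReal.rpow_mul] at this
  simpa using this

theorem tendsto_eLpNorm_add {α : Type*} [MeasurableSpace α] {μ : Measure α} {f g : ℕ → α → ℝ}
    (hf : ∀ n, AEStronglyMeasurable (f n) μ) (hg : ∀ n, AEStronglyMeasurable (g n) μ)
    (h : Tendsto (fun n => eLpNorm (f n) 2 μ) atTop (𝓝 0))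
    (h' : Tendsto (fun n => eLpNorm (g n) 2 μ) atTop (𝓝 0)) :
    Tendsto (fun n => eLpNorm (fun x => f n x + g n x) 2 μ) atTop (𝓝 0) := by
  have h2 := h.add h'
  rw [add_zero] at h2
  exact tendsto_of_tendsto_of_tendsto_of_le_of_le tendsto_const_nhds h2 (fun _ => zero_le)
    fun n => eLpNorm_add_le (hf n) (hg n) (by norm_num)

theorem tendsto_eLpNorm_sum {α ι : Type*} [MeasurableSpace α] {μ : Measure α} (s : Finset ι)
    {f : ι → ℕ → α → ℝ} (hf : ∀ i ∈ s, ∀ n, AEStronglyMeasurable (f i n) μ)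
    (h : ∀ i ∈ s, Tendsto (fun n => eLpNorm (f i n) 2 μ) atTop (𝓝 0)) :
    Tendsto (fun n => eLpNorm (fun x => ∑ i ∈ s, f i n x) 2 μ) atTop (𝓝 0) := by
  have h2 := tendsto_finsetSum s h
  simp only [Finset.sum_const_zero] at h2
  refine tendsto_of_tendsto_of_tendsto_of_le_of_le tendsto_const_nhds h2 (fun _ => zero_le)
    fun n => ?_
  have := eLpNorm_sum_le (p := 2) (μ := μ) (s := s) (f := fun i => f i n) (fun i hi => hf i hi n)
    (by norm_num)
  refine le_trans (le_of_eq ?_) this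
  congr 1
  ext x
  simp

theorem tendsto_eLpNorm_bdd_mul {Ω : Set (E d)} (hΩm : MeasurableSet Ω) {f : ℕ → E d → ℝ}
    {ψ : E d → ℝ} {C : ℝ} (hψ : ∀ x ∈ Ω, |ψ x| ≤ C)
    (h : Tendsto (fun n => eLpNorm (f n) 2 (volume.restrict Ω)) atTop (𝓝 0)) :
    Tendsto (fun n => eLpNorm (fun x => ψ x * f n x) 2 (volume.restrict Ω)) atTop (𝓝 0) := by
  have h2 := ENNReal.Tendsto.const_mul (a := ENNReal.ofReal C) h (Or.inr ENNReal.ofReal_ne_top)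
  rw [mul_zero] at h2
  refine tendsto_of_tendsto_of_tendsto_of_le_of_le tendsto_const_nhds h2 (fun _ => zero_le)
    fun n => ?_
  refine eLpNorm_le_mul_eLpNorm_of_ae_le_mul ?_ 2
  refine (ae_restrict_iff' hΩm).2 (Eventually.of_forall fun x hx => ?_)
  rw [norm_mul]
  exact mul_le_mul_of_nonneg_right (hψ x hx) (norm_nonneg _)

/-- `q`, with its weak derivatives, is a limit of test functions on `ℝ^d` in a Sobolev norm on `Ω`
with weight `η` on the second derivatives. -/
def WeightedLimit (Ω : Set (E d)) (η q : E d → ℝ) (qi : Fin d → E d → ℝ)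
    (qij : Fin d → Fin d → E d → ℝ) : Prop :=
  ∃ g : ℕ → E d → ℝ, (∀ n, ContDiff ℝ ∞ (g n) ∧ HasCompactSupport (g n)) ∧
    Tendsto (fun n => eLpNorm (fun x => g n x - q x) 2 (volume.restrict Ω)) atTop (𝓝 0) ∧
    (∀ i, Tendsto (fun n => eLpNorm (fun x => partialD i (g n) x - qi i x) 2 (volume.restrict Ω))
      atTop (𝓝 0)) ∧
    ∀ i j, Tendsto (fun n => eLpNorm (fun x => η x * partialD j (partialD i (g n)) x
      - η x * qij i j x) 2 (volume.restrict Ω)) atTop (𝓝 0)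

/-- Mollification with a kernel supported in Γ, away from the origin: the mollified function at x ∈
Ω sees only values at x + u ∈ Ω, so the weak derivatives on Ω suffice and no extension of v is
needed. -/
theorem weightedLimit_of_local {Ω : Set (E d)} (hΩo : IsOpen Ω) (hΩ : Bornology.IsBounded Ω)
    {η : E d → ℝ} (hη : IsAuxiliary Ω η) {x₀ : E d} {r C : ℝ} {Γ : Set (E d)} (hr : 0 < r)
    (hC : 0 ≤ C) (hΓo : IsOpen Γ) (hΓ0 : 0 ∈ closure Γ)
    (hΓ : ∀ x ∈ Ω, x ∈ Metric.ball x₀ r → ∀ u ∈ Γ, u ∈ Metric.ball 0 r →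
        x + u ∈ Ω ∧ η x ≤ C * η (x + u)) {v : E d → ℝ}
    {vi : Fin d → E d → ℝ} {vij : Fin d → Fin d → E d → ℝ} (hv : L2S Ω v) (hvi : ∀ i, L2S Ω (vi i))
    (hvij : ∀ i j, L2S Ω fun x => η x * vij i j x) (hvm : ∀ i j, Measurable (vij i j))
    (w1 : ∀ i, WD Ω i v (vi i)) (w2 : ∀ i j, WD Ω j (vi i) (vij i j))
    (z0 : ∀ x, x ∉ Metric.closedBall x₀ (r / 4) → v x = 0)
    (z1 : ∀ i x, x ∉ Metric.closedBall x₀ (r / 4) → vi i x = 0)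
    (z2 : ∀ i j x, x ∉ Metric.closedBall x₀ (r / 4) → vij i j x = 0) :
    WeightedLimit Ω η v vi vij := by
  have hηc : Continuous η := hη.contDiff.continuous
  have hex : ∀ n : ℕ, ∃ g : E d → ℝ, ContDiff ℝ ∞ g ∧ HasCompactSupport g ∧
      (∫⁻ x in Ω, ‖g x - v x‖ₑ ^ 2 ≤ ENNReal.ofReal (1 / (n + 1))) ∧
      (∀ i, ∫⁻ x in Ω, ‖partialD i g x - vi i x‖ₑ ^ 2 ≤ ENNReal.ofReal (1 / (n + 1))) ∧
      (∀ i j, ∫⁻ x in Ω, ‖η x * partialD j (partialD i g) x - η x * vij i j x‖ₑ ^ 2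
        ≤ ENNReal.ofReal (1 / (n + 1))) := by
    intro n
    have hp : 0 < ENNReal.ofReal (1 / ((n : ℝ) + 1)) := ENNReal.ofReal_pos.2 (by positivity)
    have hR : ∀ {F : E d → ℝ}, MemLp F 2 volume → ∀ᶠ u in 𝓝[Γ] (0 : E d),
        ∫⁻ x in Ω, ‖F (x + u) - F x‖ₑ ^ 2 ≤ ENNReal.ofReal (1 / ((n : ℝ) + 1)) := by
      intro F hF
      filter_upwards [((tendsto_lintegral_translate hF).mono_left nhdsWithin_le_nhds).eventually
        (ge_mem_nhds hp)] with u hu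
      exact (lintegral_mono' Measure.restrict_le_self le_rfl).trans hu
    have e0 := hR hv.memLp
    have e1 := eventually_all.2 fun i => hR (hvi i).memLp
    have e2 := eventually_all.2 fun i => eventually_all.2 fun j =>
      (tendsto_lintegral_weighted_translate hΩo hη hr hC hΓ (hvij i j) (z2 i j)).eventually
        (ge_mem_nhds hp)
    obtain ⟨δ, hδ, hball⟩ := Metric.mem_nhdsWithin_iff.1 (e0.and (e1.and e2))
    have hδ' : 0 < min δ (r / 4) := lt_min hδ (by positivity)
    obtain ⟨c, hcΓ, hcd⟩ := Metric.mem_closure_iff.1 hΓ0 _ hδ'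
    -- The kernel lives in a small ball around a point c of Γ close to 0; such c exists because 0 is
    -- in the closure of Γ, and the ball fits because Γ is open.
    have hco : IsOpen (Γ ∩ Metric.ball 0 (min δ (r / 4))) := hΓo.inter Metric.isOpen_ball
    obtain ⟨s, hs, hsub⟩ := Metric.nhds_basis_closedBall.mem_iff.1
      (hco.mem_nhds ⟨hcΓ, by rwa [Metric.mem_ball, dist_comm]⟩)
    obtain ⟨K, k1, k2, k3, k4, k5⟩ := exists_kernel c hs
    have hK : ∀ u ∈ tsupport K, u ∈ Γ ∧ u ∈ Metric.ball (0 : E d) δ ∧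
        u ∈ Metric.ball (0 : E d) (r / 4) := fun u hu =>
      ⟨(hsub (k5 hu)).1, Metric.ball_subset_ball (min_le_left _ _) (hsub (k5 hu)).2,
        Metric.ball_subset_ball (min_le_right _ _) (hsub (k5 hu)).2⟩
    have hK0 : ∀ u, K u ≠ 0 → u ∈ tsupport K := fun u hu => subset_tsupport _ hu
    have inΩ : ∀ x ∈ Ω ∩ Metric.ball x₀ r, ∀ u ∈ tsupport K, x + u ∈ Ω := fun x hx u hu =>
      (hΓ x hx.1 hx.2 u (hK u hu).1 (Metric.ball_subset_ball (by linarith) (hK u hu).2.2)).1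
    -- Kernel points have norm below r/4 and v is supported within r/4 of x₀. Outside the ball of
    -- radius r/2 everything vanishes, and inside the ball of radius r the cone condition applies;
    -- the two regions cover Ω.
    have far : ∀ x ∉ Metric.closedBall x₀ (r / 2), ∀ u ∈ tsupport K,
        x + u ∉ Metric.closedBall x₀ (r / 4) := by
      intro x hx u hu h
      have h1 := (hK u hu).2.2
      rw [mem_ball_zero_iff] at h1
      rw [Metric.mem_closedBall] at h
      have h2 := dist_triangle_left x x₀ (x + u)
      rw [dist_self_add_left] at h2
      exact hx (by rw [Metric.mem_closedBall]; linarith)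
    have farm : ∀ w : E d → ℝ, (∀ x, x ∉ Metric.closedBall x₀ (r / 4) → w x = 0) →
        ∀ x ∉ Metric.closedBall x₀ (r / 2), ∀ u, K u * w (x + u) = 0 := by
      intro w hw x hx u
      by_cases hu : K u = 0
      · simp [hu]
      · rw [hw _ (far x hx u (hK0 u hu)), mul_zero]
    have fard : ∀ w : E d → ℝ, (∀ x, x ∉ Metric.closedBall x₀ (r / 4) → w x = 0) →
        ∀ x ∉ Metric.closedBall x₀ (r / 2), moll K w x = 0 := by
      intro w hw x hx
      simp only [moll, farm w hw x hx, integral_zero]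
    have fare : ∀ w : E d → ℝ, (∀ x, x ∉ Metric.closedBall x₀ (r / 4) → w x = 0) →
        ∀ x ∉ Metric.closedBall x₀ (r / 2), ∀ i, partialD i (moll K w) x = 0 := by
      intro w hw x hx i
      have : moll K w =ᶠ[𝓝 x] fun _ => 0 := by
        filter_upwards [Metric.isClosed_closedBall.isOpen_compl.mem_nhds hx] with y hy
        exact fard w hw y hy
      rw [partialD_congr this]
      simp [partialD]
    have hpd : ∀ (w w' : E d → ℝ) (i : Fin d), WD Ω i w w' → LocallyIntegrable w →
        (∀ x, x ∉ Metric.closedBall x₀ (r / 4) → w x = 0) →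
        (∀ x, x ∉ Metric.closedBall x₀ (r / 4) → w' x = 0) →
        ∀ x ∈ Ω, partialD i (moll K w) x = moll K w' x := by
      intro w w' i hw hwl hw0 hw0' x hx
      by_cases hxb : x ∈ Metric.ball x₀ r
      · exact hw.partialD_moll k1 k2 hwl (inΩ x ⟨hx, hxb⟩)
      · have : x ∉ Metric.closedBall x₀ (r / 2) := fun h => hxb
          (Metric.closedBall_subset_ball (by linarith) h)
        rw [fare w hw0 x this, fard w' hw0' x this]
    have hvc : HasCompactSupport v := HasCompactSupport.of_support_subset_isCompact
      hΩ.isCompact_closure fun x hx => subset_closure (by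
        by_contra hxΩ
        exact hx (hv.zero x hxΩ))
    have avg : ∀ {F : E d → ℝ}, L2S Ω F → (∀ u, K u ≠ 0 →
        ∫⁻ x in Ω, ‖F (x + u) - F x‖ₑ ^ 2 ≤ ENNReal.ofReal (1 / ((n : ℝ) + 1))) →
        ∫⁻ x in Ω, ‖moll K F x - F x‖ₑ ^ 2 ≤ ENNReal.ofReal (1 / ((n : ℝ) + 1)) := by
      intro F hF hu
      exact lintegral_average_sub_le (S := Ω) (G := fun x u => F (x + u)) k1.continuous k3 k4
        (hF.meas.comp measurable_add) hF.meas
        (fun x _ => integrable_kernel_mul_translate k1.continuous k2 hF.locallyIntegrable x)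
        hΩo.measurableSet hu
    have inB : ∀ u, K u ≠ 0 → u ∈ Metric.ball (0 : E d) δ ∩ Γ := fun u hu =>
      ⟨(hK u (hK0 u hu)).2.1, (hK u (hK0 u hu)).1⟩
    refine ⟨moll K v, contDiff_moll k1 k2 hv.locallyIntegrable, hasCompactSupport_moll k2 hvc,
      avg hv fun u hu => (hball (inB u hu)).1, fun i => ?_, fun i j => ?_⟩
    · refine (le_of_eq ?_).trans (avg (hvi i) fun u hu => (hball (inB u hu)).2.1 i)
      refine setLIntegral_congr_fun hΩo.measurableSet fun x hx => ?_
      rw [hpd v (vi i) i (w1 i) hv.locallyIntegrable z0 (z1 i) x hx]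
    · have key := lintegral_average_sub_le (S := Ω) (G := fun x u => η x * vij i j (x + u))
        (F := fun x => η x * vij i j x) k1.continuous k3 k4
        ((hηc.measurable.comp measurable_fst).mul ((hvm i j).comp measurable_add)) (hvij i j).meas
        (fun x hx => by
          by_cases hxb : x ∈ Metric.ball x₀ r
          · have hs' : tsupport (fun y => K (y - x)) ⊆ (fun y => y - x) ⁻¹' tsupport K :=
              tsupport_comp_subset_preimage K (by fun_prop)
            -- `vij i j` is locally integrable only inside Ω, which is enough because the translated
            -- kernel is supported there.
            have h0 : Integrable fun y => vij i j y * K (y - x) :=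
              integrable_mul_of_tsupport_subset (w2 i j).locInt'
                (k1.continuous.comp (continuous_sub_right x))
                (k2.comp_homeomorph (Homeomorph.subRight x))
                fun y hy => by simpa using inΩ x ⟨hx, hxb⟩ _ (hs' hy)
            have h1 := (measurePreserving_add_left (volume : Measure (E d)) x).integrable_comp
              h0.aestronglyMeasurable |>.2 h0
            refine (h1.const_mul (η x)).congr (Eventually.of_forall fun u => ?_)
            simp only [Function.comp_apply, add_sub_cancel_left]
            ring
          · have : x ∉ Metric.closedBall x₀ (r / 2) := fun h => hxb
              (Metric.closedBall_subset_ball (by linarith) h)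
            refine (integrable_zero _ _ _).congr (Eventually.of_forall fun u => ?_)
            have := farm (vij i j) (z2 i j) x this u
            simp only [Pi.zero_apply]; rw [mul_left_comm, this, mul_zero])
        hΩo.measurableSet (fun u hu => (hball (inB u hu)).2.2 i j)
      refine (le_of_eq ?_).trans key
      refine setLIntegral_congr_fun hΩo.measurableSet fun x hx => ?_
      have e : partialD j (partialD i (moll K v)) x = moll K (vij i j) x := by
        have : partialD i (moll K v) =ᶠ[𝓝 x] moll K (vi i) := by
          filter_upwards [hΩo.mem_nhds hx] with y hy
          exact hpd v (vi i) i (w1 i) hv.locallyIntegrable z0 (z1 i) y hy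
        rw [partialD_congr this]
        exact hpd (vi i) (vij i j) j (w2 i j) (hvi i).locallyIntegrable (z1 i) (z2 i j) x hx
      rw [e, moll, ← integral_const_mul]
      simp only [mul_left_comm]
  choose g g1 g2 g3 g4 g5 using hex
  have hz : Tendsto (fun n : ℕ => ENNReal.ofReal (1 / ((n : ℝ) + 1))) atTop (𝓝 0) := by
    have := (ENNReal.continuous_ofReal.tendsto 0).comp
      (tendsto_one_div_add_atTop_nhds_zero_nat (𝕜 := ℝ))
    simpa [Function.comp_def] using this
  have sq : ∀ {a : ℕ → ℝ≥0∞}, (∀ n : ℕ, a n ≤ ENNReal.ofReal (1 / ((n : ℝ) + 1))) →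
      Tendsto a atTop (𝓝 0) := fun h =>
    tendsto_of_tendsto_of_tendsto_of_le_of_le tendsto_const_nhds hz (fun _ => zero_le) h
  exact ⟨g, fun n => ⟨g1 n, g2 n⟩, tendsto_eLpNorm_two (sq g3),
    fun i => tendsto_eLpNorm_two (sq fun n => g4 n i),
    fun i j => tendsto_eLpNorm_two (sq fun n => g5 n i j)⟩

end DGM

/-! ### Partition of unity, and density of the products ηg. -/

namespace DGM
open Filter Topology
variable {d : ℕ}

open scoped Manifold in
theorem exists_partition_of_unity {ι : Type} [Fintype ι] {s : Set (E d)} (hs : IsClosed s)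
    (U : ι → Set (E d)) (hU : ∀ i, IsOpen (U i)) (hsU : s ⊆ ⋃ i, U i) :
    ∃ ζ : ι → E d → ℝ, (∀ i, ContDiff ℝ ∞ (ζ i)) ∧ (∀ i, tsupport (ζ i) ⊆ U i) ∧
      ∀ x ∈ s, ∑ i, ζ i x = 1 := by
  obtain ⟨f, hf⟩ := SmoothPartitionOfUnity.exists_isSubordinate 𝓘(ℝ, E d) hs U hU hsU
  refine ⟨fun i => f i, fun i => (f i).contMDiff.contDiff, hf, fun x hx => ?_⟩
  rw [← finsum_eq_sum_of_fintype]
  exact f.sum_eq_one hx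

theorem contDiff_partialD_infty {g : E d → ℝ} (hg : ContDiff ℝ ∞ g) (i : Fin d) :
    ContDiff ℝ ∞ (partialD i g) :=
  contDiff_partialD hg (by norm_num) i

theorem partialD_sum {ι : Type*} [Fintype ι] {f : ι → E d → ℝ} {x : E d}
    (h : ∀ a, DifferentiableAt ℝ (f a) x) (i : Fin d) :
    partialD i (fun x => ∑ a, f a x) x = ∑ a, partialD i (f a) x := by
  unfold partialD
  rw [fderiv_fun_sum fun a _ => h a]
  simp

theorem weightedLimit_sum {Ω : Set (E d)} (hΩo : IsOpen Ω) {η : E d → ℝ} (hηc : Continuous η)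
    {ι : Type*} [Fintype ι] {q : ι → E d → ℝ} {qi : ι → Fin d → E d → ℝ}
    {qij : ι → Fin d → Fin d → E d → ℝ} (hq : ∀ a, Measurable (q a))
    (hqi : ∀ a i, Measurable (qi a i)) (hqij : ∀ a i j, Measurable (qij a i j))
    (h : ∀ a, WeightedLimit Ω η (q a) (qi a) (qij a)) {Q : E d → ℝ} {Qi : Fin d → E d → ℝ}
    {Qij : Fin d → Fin d → E d → ℝ} (hQ : ∀ x ∈ Ω, ∑ a, q a x = Q x)
    (hQi : ∀ i, ∀ x ∈ Ω, ∑ a, qi a i x = Qi i x)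
    (hQij : ∀ i j, ∀ x ∈ Ω, ∑ a, qij a i j x = Qij i j x) : WeightedLimit Ω η Q Qi Qij := by
  choose g hg h0 h1 h2 using h
  have hm := hΩo.measurableSet
  have cg : ∀ n, ContDiff ℝ ∞ fun x => ∑ a, g a n x := fun n =>
    ContDiff.sum fun a _ => (hg a n).1
  have p1 : ∀ n i x, partialD i (fun x => ∑ a, g a n x) x = ∑ a, partialD i (g a n) x :=
    fun n i x => partialD_sum (fun a => (hg a n).1.differentiable (by simp) x) i
  have p2 : ∀ n i j x, partialD j (partialD i (fun x => ∑ a, g a n x)) x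
      = ∑ a, partialD j (partialD i (g a n)) x := by
    intro n i j x
    have : partialD i (fun x => ∑ a, g a n x) = fun x => ∑ a, partialD i (g a n) x :=
      funext (p1 n i)
    rw [this]
    exact partialD_sum
      (fun a => (contDiff_partialD_infty (hg a n).1 i).differentiable (by simp) x) j
  have congr : ∀ {a b : ℕ → E d → ℝ}, (∀ n, ∀ x ∈ Ω, a n x = b n x) →
      Tendsto (fun n => eLpNorm (a n) 2 (volume.restrict Ω)) atTop (𝓝 0) →
      Tendsto (fun n => eLpNorm (b n) 2 (volume.restrict Ω)) atTop (𝓝 0) := by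
    intro a b hab ht
    refine ht.congr fun n => eLpNorm_congr_ae ?_
    exact (ae_restrict_iff' hm).2 (Eventually.of_forall (hab n))
  refine ⟨fun n x => ∑ a, g a n x, fun n => ⟨cg n, ?_⟩, ?_, fun i => ?_, fun i j => ?_⟩
  · refine HasCompactSupport.intro (isCompact_iUnion fun a => (hg a n).2) fun x hx => ?_
    refine Finset.sum_eq_zero fun a _ => image_eq_zero_of_notMem_tsupport fun h => hx ?_
    exact mem_iUnion.2 ⟨a, h⟩
  · refine congr (fun n x hx => ?_) (tendsto_eLpNorm_sum Finset.univ (fun a _ n =>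
      ((hg a n).1.continuous.measurable.sub (hq a)).aestronglyMeasurable) (fun a _ => h0 a))
    simp only [Pi.sub_apply]
    rw [Finset.sum_sub_distrib, hQ x hx]
  · refine congr (fun n x hx => ?_) (tendsto_eLpNorm_sum Finset.univ (fun a _ n =>
      ((contDiff_partialD_infty (hg a n).1 i).continuous.measurable.sub
        (hqi a i)).aestronglyMeasurable) (fun a _ => h1 a i))
    simp only [Pi.sub_apply]
    rw [Finset.sum_sub_distrib, hQi i x hx, p1]
  · refine congr (fun n x hx => ?_) (tendsto_eLpNorm_sum Finset.univ (fun a _ n =>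
      ((hηc.measurable.mul (contDiff_partialD_infty
        (contDiff_partialD_infty (hg a n).1 i) j).continuous.measurable).sub
        (hηc.measurable.mul (hqij a i j))).aestronglyMeasurable) (fun a _ => h2 a i j))
    simp only [Pi.sub_apply, Pi.mul_apply]
    rw [Finset.sum_sub_distrib, ← Finset.mul_sum, ← Finset.mul_sum, hQij i j x hx, p2]

/-- Compactness of the closure gives finitely many balls with inward cones; each localized piece ζ_a
q is approximated separately. In the Leibniz terms of its second derivative, lower-order factors are
in L² and multiplication by η keeps them there. -/
theorem weightedLimit_of_weak {Ω : Set (E d)} (hΩo : IsOpen Ω) (hΩ : Bornology.IsBounded Ω)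
    {η : E d → ℝ} (hη : IsAuxiliary Ω η) {q : E d → ℝ} {qi : Fin d → E d → ℝ}
    {qij : Fin d → Fin d → E d → ℝ} (hq : L2S Ω q) (hqi : ∀ i, L2S Ω (qi i))
    (hqij : ∀ i j, L2S Ω fun x => η x * qij i j x) (hqm : ∀ i j, Measurable (qij i j))
    (w1 : ∀ i, WD Ω i q (qi i)) (w2 : ∀ i j, WD Ω j (qi i) (qij i j)) :
    WeightedLimit Ω η q qi qij := by
  have hηc : Continuous η := hη.contDiff.continuous
  choose! r C Γ hr hC hΓo hΓ0 hΓ using fun (x : E d) (hx : x ∈ closure Ω) =>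
    exists_inward_cone hΩo hη hx
  obtain ⟨t, ht, hcov⟩ := hΩ.isCompact_closure.elim_nhds_subcover
    (fun x => Metric.ball x (r x / 4)) fun x hx => Metric.ball_mem_nhds x (by
      have := hr x hx; positivity)
  obtain ⟨ζ, z1, z2, z3⟩ := exists_partition_of_unity (ι := Fin t.card)
    (isClosed_closure (s := Ω)) (fun i => Metric.ball (t.equivFin.symm i : E d)
      (r (t.equivFin.symm i) / 4)) (fun i => Metric.isOpen_ball) (by
      intro x hx
      obtain ⟨y, hy, hxy⟩ := mem_iUnion₂.1 (hcov hx)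
      exact mem_iUnion.2 ⟨t.equivFin ⟨y, hy⟩, by simpa using hxy⟩)
  have s1 : ∀ a, ContDiff ℝ 1 (ζ a) := fun a => contDiff_infty.1 (z1 a) 1
  have s2 : ∀ a i, ContDiff ℝ ∞ (partialD i (ζ a)) := fun a i => contDiff_partialD_infty (z1 a) i
  have s21 : ∀ a i, ContDiff ℝ 1 (partialD i (ζ a)) := fun a i => contDiff_infty.1 (s2 a i) 1
  have s3c : ∀ a i j, Continuous (partialD j (partialD i (ζ a))) := fun a i j =>
    continuous_partialD (s21 a i) j
  let v : Fin t.card → E d → ℝ := fun a x => ζ a x * q x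
  let vi : Fin t.card → Fin d → E d → ℝ := fun a i x => ζ a x * qi i x + partialD i (ζ a) x * q x
  let vij : Fin t.card → Fin d → Fin d → E d → ℝ := fun a i j x =>
    (ζ a x * qij i j x + partialD j (ζ a) x * qi i x)
      + (partialD i (ζ a) x * qi j x + partialD j (partialD i (ζ a)) x * q x)
  have one : ∀ x ∈ Ω, ∑ a, ζ a x = 1 := fun x hx => z3 x (subset_closure hx)
  -- The cutoffs sum to 1 on the open set Ω, so their derivatives sum to 0 there and the Leibniz
  -- terms disappear after summation.
  have d1 : ∀ i, ∀ x ∈ Ω, ∑ a, partialD i (ζ a) x = 0 := by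
    intro i x hx
    have : (fun x => ∑ a, ζ a x) =ᶠ[𝓝 x] fun _ => 1 := by
      filter_upwards [hΩo.mem_nhds hx] with y hy using one y hy
    have h := partialD_congr this i
    rw [partialD_sum fun a => ((s1 a).differentiable one_ne_zero) x] at h
    rw [h]; simp [partialD]
  have d2 : ∀ i j, ∀ x ∈ Ω, ∑ a, partialD j (partialD i (ζ a)) x = 0 := by
    intro i j x hx
    have : (fun x => ∑ a, partialD i (ζ a) x) =ᶠ[𝓝 x] fun _ => 0 := by
      filter_upwards [hΩo.mem_nhds hx] with y hy using d1 i y hy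
    have h := partialD_congr this j
    rw [partialD_sum fun a => ((s21 a i).differentiable one_ne_zero) x] at h
    rw [h]; simp [partialD]
  refine weightedLimit_sum hΩo hηc (q := v) (qi := vi) (qij := vij)
    (fun a => (z1 a).continuous.measurable.mul hq.meas)
    (fun a i => ((z1 a).continuous.measurable.mul (hqi i).meas).add
      ((s2 a i).continuous.measurable.mul hq.meas))
    (fun a i j => (((z1 a).continuous.measurable.mul (hqm i j)).add
      ((s2 a j).continuous.measurable.mul (hqi i).meas)).add
      (((s2 a i).continuous.measurable.mul (hqi j).meas).add
        ((s3c a i j).measurable.mul hq.meas)))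
    (fun a => ?_) (fun x hx => ?_) (fun i x hx => ?_) (fun i j x hx => ?_)
  · obtain ⟨y, hy⟩ : ∃ y : E d, y = (t.equivFin.symm a : t) := ⟨_, rfl⟩
    have hyt : y ∈ closure Ω := ht y (hy ▸ (t.equivFin.symm a).2)
    have z2 := z2 a
    rw [← hy] at z2
    have far : ∀ x, x ∉ Metric.closedBall y (r y / 4) → x ∉ tsupport (ζ a) := fun x hx h =>
      hx (Metric.ball_subset_closedBall (z2 h))
    have f0 : ∀ x, x ∉ Metric.closedBall y (r y / 4) → ζ a x = 0 := fun x hx =>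
      image_eq_zero_of_notMem_tsupport (far x hx)
    have f1 : ∀ i x, x ∉ Metric.closedBall y (r y / 4) → partialD i (ζ a) x = 0 := fun i x hx =>
      partialD_eq_zero_of_notMem (far x hx) i
    have f2 : ∀ i j x, x ∉ Metric.closedBall y (r y / 4) → partialD j (partialD i (ζ a)) x = 0 :=
      fun i j x hx =>
        partialD_eq_zero_of_notMem (fun h => far x hx (tsupport_partialD_subset _ i h)) j
    refine weightedLimit_of_local hΩo hΩ hη (hr y hyt) (hC y hyt) (hΓo y hyt) (hΓ0 y hyt) (hΓ y hyt)
      (hq.cont_mul hΩ (z1 a).continuous)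
      (fun i => ((hqi i).cont_mul hΩ (z1 a).continuous).add (hq.cont_mul hΩ (s2 a i).continuous))
      (fun i j => ?_) (fun i j => (((z1 a).continuous.measurable.mul (hqm i j)).add
      ((s2 a j).continuous.measurable.mul (hqi i).meas)).add
      (((s2 a i).continuous.measurable.mul (hqi j).meas).add
        ((s3c a i j).measurable.mul hq.meas)))
      (fun i => (w1 i).mul hΩo (s1 a).contDiffOn)
      (fun i j => ((w2 i j).mul hΩo (s1 a).contDiffOn).add ((w1 j).mul hΩo (s21 a i).contDiffOn))
      (fun x hx => by simp [v, f0 x hx]) (fun i x hx => by simp [vi, f0 x hx, f1 i x hx])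
      (fun i j x hx => by simp [vij, f0 x hx, f1 i x hx, f1 j x hx, f2 i j x hx])
    have := (((hqij i j).cont_mul hΩ (z1 a).continuous).add
      (((hqi i).cont_mul hΩ (s2 a j).continuous).cont_mul hΩ hηc)).add
      ((((hqi j).cont_mul hΩ (s2 a i).continuous).cont_mul hΩ hηc).add
      ((hq.cont_mul hΩ (s3c a i j)).cont_mul hΩ hηc))
    convert this using 2 with x
    ring
  · rw [← Finset.sum_mul, one x hx, one_mul]
  · simp only [vi]
    rw [Finset.sum_add_distrib, ← Finset.sum_mul, ← Finset.sum_mul, one x hx, d1 i x hx]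
    ring
  · simp only [vij]
    rw [Finset.sum_add_distrib, Finset.sum_add_distrib, Finset.sum_add_distrib, ← Finset.sum_mul,
      ← Finset.sum_mul, ← Finset.sum_mul, ← Finset.sum_mul, one x hx, d1 i x hx, d1 j x hx,
      d2 i j x hx]
    ring

/-- Functions `η g` with `g` a test function on `ℝ^d` are dense in `H² ∩ H¹₀`. -/
theorem exists_aux_mul_tendsto {Ω : Set (E d)} (hΩo : IsOpen Ω) (hΩ : Bornology.IsBounded Ω)
    {η : E d → ℝ} (hη : IsAuxiliary Ω η) {f : E d → ℝ} {fi : Fin d → E d → ℝ}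
    {fij : Fin d → Fin d → E d → ℝ} (hf : H2Data Ω f fi fij) (h0 : ∀ k, WD univ k f (fi k)) :
    ∃ g : ℕ → E d → ℝ, (∀ n, ContDiff ℝ ∞ (g n) ∧ HasCompactSupport (g n)) ∧
    Tendsto (fun n => eLpNorm (fun x => η x * g n x - f x) 2 (volume.restrict Ω)) atTop (𝓝 0) ∧
    (∀ i, Tendsto (fun n => eLpNorm (fun x => partialD i (fun y => η y * g n y) x - fi i x) 2
      (volume.restrict Ω)) atTop (𝓝 0)) ∧
    ∀ i j, Tendsto (fun n => eLpNorm (fun x => partialD j (partialD i (fun y => η y * g n y)) x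
      - fij i j x) 2 (volume.restrict Ω)) atTop (𝓝 0) := by
  obtain ⟨q, qi, qij, hq, hqi, hqij, hqm, w1, w2, e0, e1, e2⟩ := exists_quotient hΩo hΩ hη hf h0
  obtain ⟨g, hg, t0, t1, t2⟩ := weightedLimit_of_weak hΩo hΩ hη hq hqi hqij hqm w1 w2
  have hηc : Continuous η := hη.contDiff.continuous
  have hm := hΩo.measurableSet
  have c2 := fun i => partialD_contDiff_two hη i
  have c2c := fun i => (c2 i).continuous
  have c1c := fun i k => (partialD_partialD_contDiff_one hη k i).continuous
  have gd := fun n => ((hg n).1.differentiable (by simp))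
  have gd1 := fun n i => ((contDiff_partialD_infty (hg n).1 i).differentiable (by simp))
  have ηd := hη.contDiff.differentiable three_ne_zero
  have p1 : ∀ n i x, partialD i (fun y => η y * g n y) x
      = η x * partialD i (g n) x + partialD i η x * g n x := fun n i x =>
    partialD_mul (ηd x) (gd n x) i
  have p2 : ∀ n i j x, partialD j (partialD i (fun y => η y * g n y)) x
      = (η x * partialD j (partialD i (g n)) x + partialD j η x * partialD i (g n) x)
      + (partialD i η x * partialD j (g n) x + partialD j (partialD i η) x * g n x) := by
    intro n i j x
    have : partialD i (fun y => η y * g n y)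
      = fun x => η x * partialD i (g n) x + partialD i η x * g n x := funext (p1 n i)
    rw [this, partialD_add ((ηd x).fun_mul (gd1 n i x))
      (((c2 i).differentiable two_ne_zero x).fun_mul (gd n x)), partialD_mul (ηd x) (gd1 n i x),
      partialD_mul ((c2 i).differentiable two_ne_zero x) (gd n x)]
  have congr : ∀ {a b : ℕ → E d → ℝ}, (∀ n, ∀ x ∈ Ω, a n x = b n x) →
      Tendsto (fun n => eLpNorm (a n) 2 (volume.restrict Ω)) atTop (𝓝 0) →
      Tendsto (fun n => eLpNorm (b n) 2 (volume.restrict Ω)) atTop (𝓝 0) := by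
    intro a b hab ht
    refine ht.congr fun n => eLpNorm_congr_ae ?_
    exact (ae_restrict_iff' hm).2 (Eventually.of_forall (hab n))
  have M : ∀ {ψ : E d → ℝ} {a : ℕ → E d → ℝ}, Continuous ψ →
      Tendsto (fun n => eLpNorm (a n) 2 (volume.restrict Ω)) atTop (𝓝 0) →
      Tendsto (fun n => eLpNorm (fun x => ψ x * a n x) 2 (volume.restrict Ω)) atTop (𝓝 0) := by
    intro ψ a hψ ha
    obtain ⟨C, -, hC⟩ := exists_bound_on hΩ hψ
    exact tendsto_eLpNorm_bdd_mul hm hC ha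
  have m0 : ∀ n, Measurable fun x => g n x - q x := fun n =>
    (hg n).1.continuous.measurable.sub hq.meas
  have m1 : ∀ i n, Measurable fun x => partialD i (g n) x - qi i x := fun i n =>
    (contDiff_partialD_infty (hg n).1 i).continuous.measurable.sub (hqi i).meas
  have m2 : ∀ i j n, Measurable fun x => η x * partialD j (partialD i (g n)) x - η x * qij i j x :=
    fun i j n => (hηc.measurable.mul (contDiff_partialD_infty
        (contDiff_partialD_infty (hg n).1 i) j).continuous.measurable).sub (hqij i j).meas
  refine ⟨g, hg, ?_, fun i => ?_, fun i j => ?_⟩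
  · refine congr (fun n x hx => ?_) (M hηc t0)
    rw [e0 x hx]; ring
  · refine congr (fun n x hx => ?_) (tendsto_eLpNorm_add
      (fun n => (hηc.measurable.mul (m1 i n)).aestronglyMeasurable)
      (fun n => ((c2c i).measurable.mul (m0 n)).aestronglyMeasurable) (M hηc (t1 i)) (M (c2c i) t0))
    simp only [Pi.mul_apply]
    rw [p1, e1 i x hx]; ring
  · refine congr (fun n x hx => ?_) (tendsto_eLpNorm_add
      (fun n => ((m2 i j n).add ((c2c j).measurable.mul (m1 i n))).aestronglyMeasurable)
      (fun n => (((c2c i).measurable.mul (m1 j n)).add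
        ((c1c i j).measurable.mul (m0 n))).aestronglyMeasurable)
      (tendsto_eLpNorm_add (fun n => (m2 i j n).aestronglyMeasurable)
        (fun n => ((c2c j).measurable.mul (m1 i n)).aestronglyMeasurable) (t2 i j) (M (c2c j) (t1 i)))
      (tendsto_eLpNorm_add (fun n => ((c2c i).measurable.mul (m1 j n)).aestronglyMeasurable)
        (fun n => ((c1c i j).measurable.mul (m0 n)).aestronglyMeasurable)
        (M (c2c i) (t1 j)) (M (c1c i j) t0)))
    simp only [Pi.add_apply, Pi.mul_apply]
    rw [p2, e2 i j x hx]; ring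

end DGM

/-! ### Ridge functions: vanishing moments, and smoothing of the profile. -/

namespace DGM
open Filter Topology
variable {d : ℕ}

section Ridge

variable {α : Type*} [MeasurableSpace α] {μ : Measure α} {𝕜 : Type*} [RCLike 𝕜] {y : α → ℝ} {M : ℝ}

/-- The integral of a ridge function against a density. -/
noncomputable def ridgeInt (μ : Measure α) (y K : α → ℝ) (τ : 𝕜 → 𝕜) (b z : 𝕜) : 𝕜 :=
  ∫ x, (K x : 𝕜) * τ (z * (y x : 𝕜) + b) ∂μ

/-- As y is essentially bounded, the arguments stay in a compact set for w near z; this is the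
domination for differentiating under the integral. The field is left general since the profile is
real for σ and complex for the exponential. -/
theorem exists_ridge_bound (hy : ∀ᵐ x ∂μ, |y x| ≤ M) {τ : 𝕜 → 𝕜} (hτ : Continuous τ) (b z : 𝕜) :
    ∃ C, ∀ᵐ x ∂μ, ∀ w ∈ Metric.ball z 1, ‖τ (w * (y x : 𝕜) + b)‖ ≤ C := by
  obtain ⟨C, hC⟩ := (isCompact_closedBall (0 : 𝕜) ((‖z‖ + 1) * M + ‖b‖)).exists_bound_of_continuousOn
    hτ.continuousOn
  refine ⟨C, ?_⟩
  filter_upwards [hy] with x hx w hw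
  refine hC _ ?_
  rw [mem_closedBall_zero_iff]
  have h1 : ‖w‖ ≤ ‖z‖ + 1 := by
    have := norm_sub_norm_le w z
    rw [Metric.mem_ball, dist_eq_norm] at hw
    linarith
  calc ‖w * (y x : 𝕜) + b‖ ≤ ‖w‖ * |y x| + ‖b‖ := by
        refine (norm_add_le _ _).trans ?_
        rw [norm_mul, RCLike.norm_ofReal]
    _ ≤ _ := by gcongr

theorem integrable_ridge (hym : Measurable y) (hy : ∀ᵐ x ∂μ, |y x| ≤ M) {K : α → ℝ}
    (hK : Integrable K μ) {τ : 𝕜 → 𝕜} (hτ : Continuous τ) (b z : 𝕜) :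
    Integrable (fun x => (K x : 𝕜) * τ (z * (y x : 𝕜) + b)) μ := by
  obtain ⟨C, hC⟩ := exists_ridge_bound hy hτ b z
  refine hK.ofReal.mul_bdd (c := C) ?_ ?_
  · exact (hτ.measurable.comp ((measurable_const.mul
      (RCLike.measurable_ofReal.comp hym)).add_const b)).aestronglyMeasurable
  · filter_upwards [hC] with x hx using hx z (Metric.mem_ball_self one_pos)

theorem hasDerivAt_ridgeInt (hym : Measurable y) (hy : ∀ᵐ x ∂μ, |y x| ≤ M) {K : α → ℝ}
    (hK : Integrable K μ) {τ : 𝕜 → 𝕜} (hτ : ContDiff 𝕜 1 τ) (b z : 𝕜) :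
    HasDerivAt (ridgeInt μ y K τ b) (ridgeInt μ y (fun x => y x * K x) (deriv τ) b z) z := by
  have hτd : Continuous (deriv τ) := hτ.continuous_deriv le_rfl
  obtain ⟨C, hC⟩ := exists_ridge_bound hy hτd b z
  have hyK : Integrable (fun x => y x * K x) μ := hK.bdd_mul hym.aestronglyMeasurable hy
  refine (hasDerivAt_integral_of_dominated_loc_of_deriv_le (Metric.ball_mem_nhds z one_pos)
    (bound := fun x => |y x * K x| * C)
    (F' := fun w x => ((y x * K x : ℝ) : 𝕜) * deriv τ (w * (y x : 𝕜) + b))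
    (Eventually.of_forall fun w => (integrable_ridge hym hy hK hτ.continuous b w).1)
    (integrable_ridge hym hy hK hτ.continuous b z)
    (integrable_ridge hym hy hyK hτd b z).1 ?_ (hyK.norm.mul_const C)
    (Eventually.of_forall fun x w _ => ?_)).2
  · filter_upwards [hC] with x hx w hw
    rw [norm_mul, RCLike.norm_ofReal]
    gcongr
    exact hx w hw
  · have h1 : HasDerivAt (fun w : 𝕜 => w * (y x : 𝕜) + b) (y x : 𝕜) w := by
      simpa using ((hasDerivAt_id w).mul_const (y x : 𝕜)).add_const b
    have h2 := (((hτ.differentiable one_ne_zero) (w * (y x : 𝕜) + b)).hasDerivAt.comp w h1).const_mul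
      (K x : 𝕜)
    refine h2.congr_deriv ?_
    push_cast
    ring

/-- The functional `φ ↦ ∫ A φ(y) + B φ'(y) + C φ''(y)` evaluated at `s ↦ τ (z s + b)`. -/
noncomputable def ridgeFun (μ : Measure α) (y A B C : α → ℝ) (τ : 𝕜 → 𝕜) (b z : 𝕜) : 𝕜 :=
  ridgeInt μ y A τ b z + z * ridgeInt μ y B (deriv τ) b z
    + z ^ 2 * ridgeInt μ y C (deriv (deriv τ)) b z

theorem contDiff_deriv_infty {τ : 𝕜 → 𝕜} (hτ : ContDiff 𝕜 ∞ τ) : ContDiff 𝕜 ∞ (deriv τ) :=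
  (contDiff_infty_iff_deriv.1 hτ).2

/-- The z-derivative of τ(zs + b) is s τ'(zs + b). Precomposing the functional with φ ↦ sφ gives a
functional of the same form, with the triple yA + B, yB + 2C, yC and the profile τ'. -/
theorem hasDerivAt_ridgeFun (hym : Measurable y) (hy : ∀ᵐ x ∂μ, |y x| ≤ M) {A B C : α → ℝ}
    (hA : Integrable A μ) (hB : Integrable B μ) (hC : Integrable C μ) {τ : 𝕜 → 𝕜}
    (hτ : ContDiff 𝕜 ∞ τ) (b z : 𝕜) :
    HasDerivAt (ridgeFun μ y A B C τ b) (ridgeFun μ y (fun x => y x * A x + B x)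
      (fun x => y x * B x + 2 * C x) (fun x => y x * C x) (deriv τ) b z) z := by
  have hτ1 := contDiff_deriv_infty hτ
  have hτ2 := contDiff_deriv_infty hτ1
  have hyb : ∀ {K : α → ℝ}, Integrable K μ → Integrable (fun x => y x * K x) μ := fun hK =>
    hK.bdd_mul hym.aestronglyMeasurable hy
  have a1 : ridgeInt μ y (fun x => y x * A x + B x) (deriv τ) b z
      = ridgeInt μ y (fun x => y x * A x) (deriv τ) b z + ridgeInt μ y B (deriv τ) b z := by
    unfold ridgeInt
    rw [← integral_add (integrable_ridge hym hy (hyb hA) hτ1.continuous b z)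
      (integrable_ridge hym hy hB hτ1.continuous b z)]
    congr with x
    push_cast
    ring
  have a2 : ridgeInt μ y (fun x => y x * B x + 2 * C x) (deriv (deriv τ)) b z
      = ridgeInt μ y (fun x => y x * B x) (deriv (deriv τ)) b z
        + 2 * ridgeInt μ y C (deriv (deriv τ)) b z := by
    unfold ridgeInt
    rw [← integral_const_mul, ← integral_add (integrable_ridge hym hy (hyb hB) hτ2.continuous b z)
      ((integrable_ridge hym hy hC hτ2.continuous b z).const_mul 2)]
    congr with x
    push_cast
    ring
  have d0 := hasDerivAt_ridgeInt hym hy hA (contDiff_infty.1 hτ 1) b z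
  have d1 := (hasDerivAt_id z).mul (hasDerivAt_ridgeInt hym hy hB (contDiff_infty.1 hτ1 1) b z)
  have d2 := (hasDerivAt_pow 2 z).mul
    (hasDerivAt_ridgeInt hym hy hC (contDiff_infty.1 hτ2 1) b z)
  refine ((d0.add d1).add d2).congr_deriv ?_
  rw [ridgeFun, a1, a2]
  simp only [id]
  push_cast
  ring

/-- The n-th z-derivative at 0 is τ⁽ⁿ⁾(b) times the functional evaluated at sⁿ. The latter does not
depend on the profile, so it vanishes as soon as τ⁽ⁿ⁾(b) ≠ 0 for one b, and then the derivative for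
the exponential vanishes too. The triple is generalized because each induction step changes it. -/
theorem iteratedDeriv_ridgeFun_exp (hym : Measurable y) (hy : ∀ᵐ x ∂μ, |y x| ≤ M) (n : ℕ) :
    ∀ {A B C : α → ℝ} {τ : ℝ → ℝ}, Integrable A μ → Integrable B μ → Integrable C μ →
      ContDiff ℝ ∞ τ → (∀ b z, ridgeFun μ y A B C τ b z = 0) → (∃ b, iteratedDeriv n τ b ≠ 0) →
      iteratedDeriv n (ridgeFun μ y A B C Complex.exp 0) 0 = 0 := by
  induction n with
  | zero =>
    intro A B C τ hA hB hC hτ h ⟨b, hb⟩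
    -- At z = 0 only the zeroth-order term survives, namely τ(b)∫A.
    have h0 := h b 0
    simp only [ridgeFun, ridgeInt, zero_mul, zero_add, RCLike.ofReal_real_eq_id, id,
      integral_mul_const] at h0
    simp only [iteratedDeriv_zero] at hb ⊢
    have hA0 : ∫ x, A x ∂μ = 0 := by simpa [hb] using h0
    have : ∫ x, (A x : ℂ) ∂μ = 0 := by rw [integral_complex_ofReal, hA0]; simp
    simpa [ridgeFun, ridgeInt] using this
  | succ n ih =>
    intro A B C τ hA hB hC hτ h hb
    have hyb : ∀ {K : α → ℝ}, Integrable K μ → Integrable (fun x => y x * K x) μ := fun hK =>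
      hK.bdd_mul hym.aestronglyMeasurable hy
    have e : deriv (ridgeFun μ y A B C Complex.exp 0) = ridgeFun μ y (fun x => y x * A x + B x)
        (fun x => y x * B x + 2 * C x) (fun x => y x * C x) Complex.exp 0 := by
      funext z
      have := (hasDerivAt_ridgeFun hym hy hA hB hC Complex.contDiff_exp 0 z).deriv
      rwa [Complex.deriv_exp] at this
    rw [iteratedDeriv_succ', e]
    rw [iteratedDeriv_succ'] at hb
    refine ih ((hyb hA).add hB) ((hyb hB).add (hC.const_mul 2)) (hyb hC)
      (contDiff_deriv_infty hτ) (fun b z => ?_) hb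
    refine (hasDerivAt_ridgeFun hym hy hA hB hC hτ b z).unique ?_
    rw [show ridgeFun μ y A B C τ b = fun _ => 0 from funext (h b)]
    exact hasDerivAt_const z 0

/-- The functional on exp(zs) is an entire function of z, and all its Taylor coefficients at 0
vanish. -/
theorem ridgeFun_exp_eq_zero (hym : Measurable y) (hy : ∀ᵐ x ∂μ, |y x| ≤ M) {A B C : α → ℝ}
    {τ : ℝ → ℝ} (hA : Integrable A μ) (hB : Integrable B μ) (hC : Integrable C μ)
    (hτ : ContDiff ℝ ∞ τ) (h : ∀ b z, ridgeFun μ y A B C τ b z = 0)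
    (hn : ∀ n, ∃ b, iteratedDeriv n τ b ≠ 0) (z : ℂ) :
    ridgeFun μ y A B C Complex.exp 0 z = 0 := by
  have hd : Differentiable ℂ (ridgeFun μ y A B C Complex.exp 0) := fun w =>
    (hasDerivAt_ridgeFun hym hy hA hB hC Complex.contDiff_exp 0 w).differentiableAt
  rw [← Complex.taylorSeries_eq_of_entire' 0 z hd]
  simp [iteratedDeriv_ridgeFun_exp hym hy _ hA hB hC hτ h (hn _)]

end Ridge

section Smoothing

/-- A bounded function on the line with constant derivative has derivative zero. -/
theorem eq_zero_of_hasDerivAt_const {f : ℝ → ℝ} {c C : ℝ} (hf : ∀ x, HasDerivAt f c x)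
    (hC : ∀ x, |f x| ≤ C) : c = 0 := by
  have h : ∀ x, f x = f 0 + c * x := by
    intro x
    have : ∀ x, HasDerivAt (fun x => f x - c * x) 0 x := fun x => by
      
      have := (hf x).fun_sub ((hasDerivAt_id x).const_mul c)
      simp only [mul_one, sub_self] at this
      exact this
    have := is_const_of_deriv_eq_zero (fun x => (this x).differentiableAt)
      (fun x => (this x).deriv) x 0
    simp only [mul_zero, sub_zero] at this
    linarith
  by_contra hc
  have h1 := hC ((2 * C + 1) / c)
  have h2 := hC 0
  rw [h, mul_div_cancel₀ _ hc] at h1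
  rw [abs_le] at h1 h2
  linarith

/-- Otherwise τ is a polynomial. If a derivative vanishes, the previous one is constant, and being
the derivative of a bounded function it is zero; descending to the first derivative makes τ
constant. -/
theorem exists_iteratedDeriv_ne_zero {τ : ℝ → ℝ} (hτ : ContDiff ℝ ∞ τ)
    (hb : ∀ n, ∃ C, ∀ x, |iteratedDeriv n τ x| ≤ C) (hc : ¬ ∃ s, ∀ t, τ t = s) (n : ℕ) :
    ∃ b, iteratedDeriv n τ b ≠ 0 := by
  by_contra! h
  have hd : ∀ m x, HasDerivAt (iteratedDeriv m τ) (iteratedDeriv (m + 1) τ x) x := fun m x => by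
    rw [iteratedDeriv_succ]
    exact (hτ.differentiable_iteratedDeriv m (by exact_mod_cast WithTop.coe_lt_top _) x).hasDerivAt
  have key : ∀ m, (∀ b, iteratedDeriv (m + 1) τ b = 0) → ∀ b, iteratedDeriv 1 τ b = 0 := by
    intro m
    induction m with
    | zero => exact fun h => h
    | succ m ih =>
      intro h
      refine ih ?_
      have h1 : ∀ b, iteratedDeriv (m + 1) τ b = iteratedDeriv (m + 1) τ 0 := fun b =>
        is_const_of_deriv_eq_zero (fun x => (hd (m + 1) x).differentiableAt)
          (fun x => by rw [(hd (m + 1) x).deriv, h]) b 0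
      obtain ⟨C, hC⟩ := hb m
      have h2 : iteratedDeriv (m + 1) τ 0 = 0 :=
        eq_zero_of_hasDerivAt_const (fun x => by simpa only [h1 x] using hd m x) hC
      intro b
      rw [h1, h2]
  have h1 : ∀ b, iteratedDeriv 1 τ b = 0 := key n fun b => by
    rw [iteratedDeriv_succ, show iteratedDeriv n τ = fun _ => 0 from funext h]
    simp
  refine hc ⟨τ 0, fun t => ?_⟩
  refine is_const_of_deriv_eq_zero (hτ.differentiable (by simp)) (fun x => ?_) t 0
  rw [← iteratedDeriv_one, h1]

/-- Convolution of a bounded function with a kernel. -/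
noncomputable def smoothing (ρ σ : ℝ → ℝ) (s : ℝ) : ℝ := ∫ t, ρ t * σ (s - t)

theorem smoothing_eq (ρ σ : ℝ → ℝ) :
    smoothing ρ σ = convolution ρ σ (ContinuousLinearMap.lsmul ℝ ℝ) volume := by
  funext s
  simp [smoothing, convolution]

theorem contDiff_smoothing {ρ σ : ℝ → ℝ} (hρ : ContDiff ℝ ∞ ρ) (hρc : HasCompactSupport ρ)
    (hσ : Continuous σ) : ContDiff ℝ ∞ (smoothing ρ σ) := by
  rw [smoothing_eq]
  exact hρc.contDiff_convolution_left _ hρ hσ.locallyIntegrable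

theorem iteratedDeriv_smoothing {σ : ℝ → ℝ} (hσ : Continuous σ) (n : ℕ) : ∀ {ρ : ℝ → ℝ},
    ContDiff ℝ ∞ ρ → HasCompactSupport ρ →
    iteratedDeriv n (smoothing ρ σ) = smoothing (iteratedDeriv n ρ) σ := by
  induction n with
  | zero => intro ρ _ _; simp
  | succ n ih =>
    intro ρ hρ hρc
    have : deriv (smoothing ρ σ) = smoothing (deriv ρ) σ := by
      funext s
      rw [smoothing_eq, smoothing_eq]
      exact (hρc.hasDerivAt_convolution_left _ (contDiff_infty.1 hρ 1) hσ.locallyIntegrable s).deriv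
    rw [iteratedDeriv_succ', this, ih (contDiff_deriv_infty hρ) hρc.deriv, ← iteratedDeriv_succ']

theorem integrable_smoothing {ρ σ : ℝ → ℝ} (hρ : Integrable ρ) (hσ : Continuous σ) {C : ℝ}
    (hC : ∀ x, |σ x| ≤ C) (s : ℝ) : Integrable fun t => ρ t * σ (s - t) :=
  hρ.mul_bdd (c := C) (hσ.comp (continuous_const.sub continuous_id)).aestronglyMeasurable
    (Eventually.of_forall fun _ => hC _)

theorem abs_smoothing_le {ρ σ : ℝ → ℝ} (hρ : Integrable ρ) {C : ℝ}
    (hC : ∀ x, |σ x| ≤ C) (s : ℝ) : |smoothing ρ σ s| ≤ (∫ t, |ρ t|) * C := by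
  rw [← integral_mul_const]
  refine norm_integral_le_of_norm_le (f := fun t => ρ t * σ (s - t)) (hρ.norm.mul_const C) (Eventually.of_forall fun t => ?_)
  rw [norm_mul]
  exact mul_le_mul_of_nonneg_left (hC _) (norm_nonneg _)

/-- Here the derivative falls on σ, which expresses the functional on smoothed profiles through the
original one. In `iteratedDeriv_smoothing` it falls on ρ, which gives bounds on derivatives of all
orders. -/
theorem deriv_smoothing {ρ σ : ℝ → ℝ} (hρ : Integrable ρ) (hσ : ContDiff ℝ 1 σ) {C C' : ℝ}
    (hC : ∀ x, |σ x| ≤ C) (hC' : ∀ x, |deriv σ x| ≤ C') :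
    deriv (smoothing ρ σ) = smoothing ρ (deriv σ) := by
  funext s
  refine (hasDerivAt_integral_of_dominated_loc_of_deriv_le (s := univ) univ_mem
    (bound := fun t => |ρ t| * C') (F' := fun s t => ρ t * deriv σ (s - t))
    (Eventually.of_forall fun s => (integrable_smoothing hρ hσ.continuous hC s).1)
    (integrable_smoothing hρ hσ.continuous hC s)
    (integrable_smoothing hρ (hσ.continuous_deriv le_rfl) hC' s).1
    (Eventually.of_forall fun t s _ => ?_) (hρ.norm.mul_const C')
    (Eventually.of_forall fun t s _ => ?_)).2.deriv
  · rw [norm_mul]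
    exact mul_le_mul_of_nonneg_left (hC' _) (norm_nonneg _)
  · have h1 : HasDerivAt (fun s : ℝ => s - t) 1 s := (hasDerivAt_id s).sub_const t
    simpa using (((hσ.differentiable one_ne_zero) (s - t)).hasDerivAt.comp s h1).const_mul (ρ t)

/-- If all smoothings were constant, so would be their limit σ along an approximate identity. -/
theorem exists_smoothing_nonconst {σ : ℝ → ℝ} (hσ : Continuous σ) (hc : ¬ ∃ s, ∀ t, σ t = s) :
    ∃ ρ : ℝ → ℝ, ContDiff ℝ ∞ ρ ∧ HasCompactSupport ρ ∧ ¬ ∃ s, ∀ t, smoothing ρ σ t = s := by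
  by_contra! h
  let φ : ℕ → ContDiffBump (0 : ℝ) := fun n =>
    ⟨1 / ((n : ℝ) + 1) / 2, 1 / ((n : ℝ) + 1), by positivity, half_lt_self (by positivity)⟩
  have hφ : Tendsto (fun n => (φ n).rOut) atTop (𝓝 0) := tendsto_one_div_add_atTop_nhds_zero_nat
  have lim := fun x => ContDiffBump.convolution_tendsto_right_of_continuous (μ := volume) hφ hσ x
  refine hc ⟨σ 0, fun t => tendsto_nhds_unique (lim t) ((lim 0).congr fun n => ?_)⟩
  obtain ⟨s, hs⟩ := h ((φ n).normed volume) (φ n).contDiff_normed (φ n).hasCompactSupport_normed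
  rw [← smoothing_eq, hs, hs]

end Smoothing

end DGM

/-! ### From ridge functions to all test functions by Fourier inversion. -/

namespace DGM
open Filter Topology
variable {d : ℕ}

/-- Fubini: smoothing the profile averages the functional over the shifts b − t, so vanishing for
all b is inherited. -/
theorem ridgeInt_smoothing {α : Type*} [MeasurableSpace α] {μ : Measure α} [SFinite μ]
    {y K : α → ℝ} (hym : Measurable y) (hK : Integrable K μ) {ρ τ : ℝ → ℝ} (hρ : Integrable ρ)
    (hτ : Continuous τ) {C : ℝ} (hC : ∀ x, |τ x| ≤ C) (b z : ℝ) :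
    Integrable (fun t => ρ t * ridgeInt μ y K τ (b - t) z) ∧
    ridgeInt μ y K (smoothing ρ τ) b z = ∫ t, ρ t * ridgeInt μ y K τ (b - t) z := by
  have hi : Integrable (fun p : α × ℝ => K p.1 * ρ p.2 * τ (z * y p.1 + (b - p.2)))
      (μ.prod volume) := by
    refine (hK.mul_prod hρ).mul_bdd (c := C) ?_ (Eventually.of_forall fun _ => hC _)
    exact (hτ.measurable.comp ((measurable_const.mul (hym.comp measurable_fst)).add
      (measurable_const.sub measurable_snd))).aestronglyMeasurable
  have e : ∀ t, ∫ x, K x * ρ t * τ (z * y x + (b - t)) ∂μ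
      = ρ t * ridgeInt μ y K τ (b - t) z := fun t => by
    rw [ridgeInt, ← integral_const_mul]
    congr with x
    simp only [RCLike.ofReal_real_eq_id, id]
    ring
  refine ⟨by simpa only [e] using hi.integral_prod_right, ?_⟩
  simp_rw [← e]
  rw [← integral_integral_swap hi]
  unfold ridgeInt smoothing
  congr with x
  simp only [RCLike.ofReal_real_eq_id, id]
  rw [← integral_const_mul]
  congr with t
  rw [mul_assoc, add_sub_assoc]

theorem IsCnb.iteratedDeriv_bound {n : ℕ} {σ : ℝ → ℝ} (h : IsCnb n σ) {k : ℕ} (hk : k ≤ n) :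
    ∃ C, ∀ x, |iteratedDeriv k σ x| ≤ C := by
  obtain ⟨C, hC⟩ := h.2 k hk
  exact ⟨C, fun x => by
    have := hC x
    rwa [norm_iteratedFDeriv_eq_norm_iteratedDeriv] at this⟩

/-- σ has only four derivatives, while the moment argument needs all orders. It is applied to a
smooth non-constant convolution ρ ∗ σ, all of whose derivatives are bounded. -/
theorem ridgeFun_exp_of_ridge {α : Type*} [MeasurableSpace α] {μ : Measure α} [SFinite μ]
    {y A B C : α → ℝ} {M : ℝ} (hym : Measurable y) (hy : ∀ᵐ x ∂μ, |y x| ≤ M) (hA : Integrable A μ)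
    (hB : Integrable B μ) (hC : Integrable C μ) {σ : ℝ → ℝ} (hσ : IsCnb 4 σ)
    (hc : ¬ ∃ s, ∀ t, σ t = s) (h : ∀ b z, ridgeFun μ y A B C σ b z = 0) (z : ℂ) :
    ridgeFun μ y A B C Complex.exp 0 z = 0 := by
  obtain ⟨ρ, hρ, hρc, hnc⟩ := exists_smoothing_nonconst hσ.1.continuous hc
  have s1 : ContDiff ℝ 3 (deriv σ) := (contDiff_succ_iff_deriv.1 hσ.1).2.2
  have s2 : ContDiff ℝ 2 (deriv (deriv σ)) := (contDiff_succ_iff_deriv.1 s1).2.2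
  obtain ⟨C0, hC0⟩ := hσ.iteratedDeriv_bound (k := 0) (by norm_num)
  obtain ⟨C1, hC1⟩ := hσ.iteratedDeriv_bound (k := 1) (by norm_num)
  obtain ⟨C2, hC2⟩ := hσ.iteratedDeriv_bound (k := 2) (by norm_num)
  simp only [iteratedDeriv_zero, iteratedDeriv_succ] at hC0 hC1 hC2
  have hρi : ∀ n, Integrable (iteratedDeriv n ρ) := fun n => by
    rw [iteratedDeriv_eq_iterate]
    have : ∀ n, ContDiff ℝ ∞ (deriv^[n] ρ) ∧ HasCompactSupport (deriv^[n] ρ) := fun n => by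
      induction n with
      | zero => exact ⟨hρ, hρc⟩
      | succ n ih =>
        rw [Function.iterate_succ']
        exact ⟨contDiff_deriv_infty ih.1, ih.2.deriv⟩
    exact (this n).1.continuous.integrable_of_hasCompactSupport (this n).2
  have hρ0 : Integrable ρ := by simpa using hρi 0
  refine ridgeFun_exp_eq_zero hym hy hA hB hC (τ := smoothing ρ σ)
    (contDiff_smoothing hρ hρc hσ.1.continuous) (fun b z => ?_)
    (exists_iteratedDeriv_ne_zero (contDiff_smoothing hρ hρc hσ.1.continuous) (fun n => ?_) hnc) z
  · have d1 := deriv_smoothing hρ0 (hσ.1.of_le (by norm_num)) hC0 hC1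
    have d2 := deriv_smoothing hρ0 (s1.of_le (by norm_num)) hC1 hC2
    obtain ⟨i0, e0⟩ := ridgeInt_smoothing hym hA hρ0 hσ.1.continuous hC0 b z
    obtain ⟨i1, e1⟩ := ridgeInt_smoothing hym hB hρ0 s1.continuous hC1 b z
    obtain ⟨i2, e2⟩ := ridgeInt_smoothing hym hC hρ0 s2.continuous hC2 b z
    have i01 : Integrable fun t => ρ t * ridgeInt μ y A σ (b - t) z
        + z * (ρ t * ridgeInt μ y B (deriv σ) (b - t) z) := i0.add (i1.const_mul z)
    rw [ridgeFun, d1, d2, e0, e1, e2, ← integral_const_mul, ← integral_const_mul,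
      ← integral_add i0 (i1.const_mul z), ← integral_add i01 (i2.const_mul (z ^ 2))]
    rw [← integral_zero ℝ ℝ]
    congr with t
    have := h (b - t) z
    rw [ridgeFun] at this
    rw [← mul_zero (ρ t), ← this]
    ring
  · rw [iteratedDeriv_smoothing hσ.1.continuous n hρ hρc]
    exact ⟨_, abs_smoothing_le (hρi n) hC0⟩

section Fourier

open scoped FourierTransform SchwartzMap LineDeriv

noncomputable def fHat (f : E d → ℝ) : E d → ℂ := 𝓕 fun x => (f x : ℂ)

noncomputable def toSch {f : E d → ℝ} (hf : ContDiff ℝ ∞ f) (hc : HasCompactSupport f) : 𝓢(E d, ℂ) :=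
  HasCompactSupport.toSchwartzMap (f := fun x => (f x : ℂ)) (hc.comp_left Complex.ofReal_zero)
    (Complex.ofRealCLM.contDiff.comp hf)

theorem fourier_toSch {f : E d → ℝ} (hf : ContDiff ℝ ∞ f) (hc : HasCompactSupport f) (v : E d) :
    𝓕 (toSch hf hc) v = fHat f v := rfl

theorem integrable_fHat {f : E d → ℝ} (hf : ContDiff ℝ ∞ f) (hc : HasCompactSupport f) :
    Integrable (fHat f) := (𝓕 (toSch hf hc)).integrable

theorem fHat_inversion {f : E d → ℝ} (hf : ContDiff ℝ ∞ f) (hc : HasCompactSupport f) (x : E d) :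
    (f x : ℂ) = ∫ v, Complex.exp (2 * Real.pi * Complex.I * (inner ℝ v x : ℝ)) * fHat f v := by
  have h : 𝓕⁻ (fHat f) x = (f x : ℂ) := by
    have : 𝓕⁻ (𝓕 (fun x => (f x : ℂ))) = fun x => (f x : ℂ) :=
      (Complex.continuous_ofReal.comp hf.continuous).fourierInv_fourier_eq
        (toSch hf hc).integrable (integrable_fHat hf hc)
    exact congrFun this x
  rw [← h, Real.fourierInv_eq']
  congr with v
  rw [smul_eq_mul]
  congr 2
  push_cast
  ring

theorem fHat_partialD {f : E d → ℝ} (hf : ContDiff ℝ ∞ f) (hc : HasCompactSupport f) (i : Fin d)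
    (v : E d) : fHat (partialD i f) v = 2 * Real.pi * Complex.I * v i * fHat f v := by
  have h := congrArg (fun s : 𝓢(E d, ℂ) => s v)
    (SchwartzMap.fourier_lineDerivOp_eq (toSch hf hc) (EuclideanSpace.single i (1 : ℝ)))
  have t : (inner ℝ · (EuclideanSpace.single i (1 : ℝ)) : E d → ℝ).HasTemperateGrowth := by fun_prop
  have e : (∂_{EuclideanSpace.single i (1 : ℝ)} (toSch hf hc))
      = toSch (contDiff_partialD_infty hf i) (hasCompactSupport_partialD hc i) := by
    ext x
    rw [SchwartzMap.lineDerivOp_apply_eq_fderiv]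
    have := (Complex.ofRealCLM.hasFDerivAt.comp x
      (hf.differentiable (by simp) x).hasFDerivAt).fderiv
    exact congrArg (fun L => L (EuclideanSpace.single i (1 : ℝ))) this
  rw [e] at h
  simp only [smul_apply, SchwartzMap.smulLeftCLM_apply_apply t] at h
  simpa [t, fourier_toSch, mul_assoc, EuclideanSpace.inner_single_right] using h

/-- Fourier inversion for f and Fubini: the pairing of H with f is a superposition of pairings of H
with the exponentials exp(2πi v·x). -/
theorem integral_mul_eq_fourier {μ : Measure (E d)} [SFinite μ] {H : E d → ℝ} (hH : Integrable H μ)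
    {f : E d → ℝ} (hf : ContDiff ℝ ∞ f) (hc : HasCompactSupport f) :
    Integrable (fun v => fHat f v
      * ridgeInt μ (fun x => inner ℝ v x) H Complex.exp 0 (2 * Real.pi * Complex.I)) ∧
    ((∫ x, H x * f x ∂μ : ℝ) : ℂ) = ∫ v, fHat f v
      * ridgeInt μ (fun x => inner ℝ v x) H Complex.exp 0 (2 * Real.pi * Complex.I) := by
  have hi : Integrable (fun p : E d × E d => ((H p.1 : ℂ) * fHat f p.2)
      * Complex.exp (2 * Real.pi * Complex.I * (inner ℝ p.2 p.1 : ℝ))) (μ.prod volume) := by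
    refine (hH.ofReal.mul_prod (integrable_fHat hf hc)).mul_bdd (c := 1) ?_
      (Eventually.of_forall fun p => ?_)
    · exact Continuous.aestronglyMeasurable (by fun_prop)
    · rw [show 2 * (Real.pi : ℂ) * Complex.I * (inner ℝ p.2 p.1 : ℝ)
        = ((2 * Real.pi * inner ℝ p.2 p.1 : ℝ) : ℂ) * Complex.I by push_cast; ring,
        Complex.norm_exp_ofReal_mul_I]
  have e : ∀ v, ∫ x, ((H x : ℂ) * fHat f v)
      * Complex.exp (2 * Real.pi * Complex.I * (inner ℝ v x : ℝ)) ∂μ = fHat f v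
      * ridgeInt μ (fun x => inner ℝ v x) H Complex.exp 0 (2 * Real.pi * Complex.I) := fun v => by
    rw [ridgeInt, ← integral_const_mul]
    congr with x
    simp only [add_zero, Complex.coe_algebraMap]
    ring_nf
  refine ⟨by simpa only [e] using hi.integral_prod_right, ?_⟩
  simp_rw [← e]
  rw [← integral_integral_swap hi, ← integral_complex_ofReal]
  congr with x
  push_cast
  rw [fHat_inversion hf hc, ← integral_const_mul]
  congr with v
  ring

end Fourier

theorem measurable_inner_right (w : E d) : Measurable fun x : E d => (inner ℝ w x : ℝ) :=
  (continuous_const.inner continuous_id).measurable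

/-- A second-order functional of an integrable density which vanishes on all ridge functions of a
bounded non-constant profile vanishes on all test functions. -/
theorem integral_eq_zero_of_ridge {μ : Measure (E d)} [SFinite μ] {R : ℝ}
    (hR : ∀ᵐ x ∂μ, ‖x‖ ≤ R) {H : E d → ℝ} {Hi : Fin d → E d → ℝ} {Hij : Fin d → Fin d → E d → ℝ}
    (h0 : Integrable H μ) (h1 : ∀ i, Integrable (Hi i) μ) (h2 : ∀ i j, Integrable (Hij i j) μ)
    {σ : ℝ → ℝ} (hσ : IsCnb 4 σ) (hc : ¬ ∃ s, ∀ t, σ t = s)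
    (h : ∀ (w : E d) (b : ℝ), ∫ x, (H x * σ (inner ℝ w x + b)
      + ∑ i, Hi i x * (w i * deriv σ (inner ℝ w x + b))
      + ∑ i, ∑ j, Hij i j x * (w i * w j * deriv (deriv σ) (inner ℝ w x + b))) ∂μ = 0)
    {g : E d → ℝ} (hg : ContDiff ℝ ∞ g) (hgc : HasCompactSupport g) :
    ∫ x, (H x * g x + ∑ i, Hi i x * partialD i g x
      + ∑ i, ∑ j, Hij i j x * partialD j (partialD i g) x) ∂μ = 0 := by
  have s1 : ContDiff ℝ 3 (deriv σ) := (contDiff_succ_iff_deriv.1 hσ.1).2.2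
  have s2 : ContDiff ℝ 2 (deriv (deriv σ)) := (contDiff_succ_iff_deriv.1 s1).2.2
  have hy : ∀ w : E d, ∀ᵐ x ∂μ, |(inner ℝ w x : ℝ)| ≤ ‖w‖ * R := fun w => by
    filter_upwards [hR] with x hx
    exact (abs_real_inner_le_norm w x).trans (by gcongr)
  have iB : ∀ w : E d, Integrable (fun x => ∑ i, Hi i x * w i) μ := fun w =>
    integrable_finsetSum _ fun i _ => (h1 i).mul_const _
  have iC : ∀ w : E d, Integrable (fun x => ∑ i, ∑ j, Hij i j x * (w i * w j)) μ := fun w =>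
    integrable_finsetSum _ fun i _ => integrable_finsetSum _ fun j _ => (h2 i j).mul_const _
  have key : ∀ (w : E d) (z : ℂ), ridgeFun μ (fun x => inner ℝ w x) H (fun x => ∑ i, Hi i x * w i)
      (fun x => ∑ i, ∑ j, Hij i j x * (w i * w j)) Complex.exp 0 z = 0 := by
    intro w z
    refine ridgeFun_exp_of_ridge (measurable_inner_right w) (hy w) h0 (iB w) (iC w) hσ hc
      (fun b z => ?_) z
    -- Scaling the direction w by z turns the hypothesis into the vanishing of the one-dimensional
    -- functional with s = w·x, whose densities are contractions with w.
    rw [← h (z • w) b, ridgeFun, ridgeInt, ridgeInt, ridgeInt]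
    have j0 := integrable_ridge (measurable_inner_right w) (hy w) h0 hσ.1.continuous b z
    have j1 := (integrable_ridge (measurable_inner_right w) (hy w) (iB w) s1.continuous b z).const_mul
      z
    have j2 := (integrable_ridge (measurable_inner_right w) (hy w) (iC w) s2.continuous b z).const_mul
      (z ^ 2)
    have j01 : Integrable (fun x => H x * σ (z * inner ℝ w x + b) + z * ((∑ i, Hi i x * w i)
      * deriv σ (z * inner ℝ w x + b))) μ := j0.add j1
    simp only [RCLike.ofReal_real_eq_id, id] at j0 j1 j2 ⊢
    rw [← integral_const_mul, ← integral_const_mul, ← integral_add j0 j1, ← integral_add j01 j2]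
    congr with x
    simp only [inner_smul_left, PiLp.smul_apply, smul_eq_mul,
      Finset.sum_mul, Finset.mul_sum, conj_trivial]
    congr 1
    · congr 1
      exact Finset.sum_congr rfl fun i _ => by ring
    · exact Finset.sum_congr rfl fun i _ => Finset.sum_congr rfl fun j _ => by ring
  have hgi := fun i => contDiff_partialD_infty hg i
  have hgci := fun i => hasCompactSupport_partialD hgc i
  have hgij := fun i j => contDiff_partialD_infty (hgi i) j
  have hgcij := fun i j => hasCompactSupport_partialD (hgci i) j
  have bd : ∀ {f : E d → ℝ} {K : E d → ℝ}, ContDiff ℝ ∞ f → HasCompactSupport f →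
      Integrable K μ → Integrable (fun x => K x * f x) μ := by
    intro f K hf hc hK
    obtain ⟨C, hC⟩ := hf.continuous.bounded_above_of_compact_support hc
    exact hK.mul_bdd hf.continuous.aestronglyMeasurable (Eventually.of_forall hC)
  set θ : ℂ := 2 * Real.pi * Complex.I with hθ
  let F : (E d → ℝ) → E d → ℂ := fun K v => ridgeInt μ (fun x => inner ℝ v x) K Complex.exp 0 θ
  obtain ⟨i0, e0⟩ := integral_mul_eq_fourier h0 hg hgc
  have I1 := fun i => (integral_mul_eq_fourier (h1 i) (hgi i) (hgci i)).1
  have e1 := fun i => (integral_mul_eq_fourier (h1 i) (hgi i) (hgci i)).2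
  have I2 := fun i j => (integral_mul_eq_fourier (h2 i j) (hgij i j) (hgcij i j)).1
  have e2 := fun i j => (integral_mul_eq_fourier (h2 i j) (hgij i j) (hgcij i j)).2
  rw [← hθ] at i0 e0
  simp only [← hθ] at I1 e1 I2 e2
  have J1 := fun i => bd (hgi i) (hgci i) (h1 i)
  have J2 := fun i j => bd (hgij i j) (hgcij i j) (h2 i j)
  have S1 : Integrable (fun x => ∑ i, Hi i x * partialD i g x) μ :=
    integrable_finsetSum _ fun i _ => J1 i
  have S2 : Integrable (fun x => ∑ i, ∑ j, Hij i j x * partialD j (partialD i g) x) μ :=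
    integrable_finsetSum _ fun i _ => integrable_finsetSum _ fun j _ => J2 i j
  have S01 : Integrable (fun x => H x * g x + ∑ i, Hi i x * partialD i g x) μ :=
    (bd hg hgc h0).add S1
  rw [integral_add S01 S2, integral_add (bd hg hgc h0) S1, integral_finsetSum _ fun i _ => J1 i,
    integral_finsetSum _ fun i _ => integrable_finsetSum _ fun j _ => J2 i j]
  simp_rw [integral_finsetSum _ fun j _ => J2 _ j]
  rw [← Complex.ofReal_eq_zero]
  push_cast
  simp_rw [e0, e1, e2]
  have T1 : Integrable (fun v => ∑ i, fHat (partialD i g) v * F (Hi i) v) :=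
    integrable_finsetSum _ fun i _ => I1 i
  have T2 : Integrable (fun v => ∑ i, ∑ j, fHat (partialD j (partialD i g)) v * F (Hij i j) v) :=
    integrable_finsetSum _ fun i _ => integrable_finsetSum _ fun j _ => I2 i j
  have T01 : Integrable (fun v => fHat g v * F H v + ∑ i, fHat (partialD i g) v * F (Hi i) v) :=
    i0.add T1
  -- Derivatives of g become factors 2πi v_i, so at each frequency the sum is the transform of g
  -- times the functional on exp(2πi v·x), which is zero by `key`.
  have : ∀ v, fHat g v * F H v + ∑ i, fHat (partialD i g) v * F (Hi i) v
      + ∑ i, ∑ j, fHat (partialD j (partialD i g)) v * F (Hij i j) v = 0 := by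
    intro v
    have hk := key v θ
    have hexp := Complex.continuous_exp
    have r1 : ridgeInt μ (fun x => inner ℝ v x) (fun x => ∑ i, Hi i x * v i) Complex.exp 0 θ
        = ∑ i, v i * F (Hi i) v := by
      simp only [F, ridgeInt, ← integral_const_mul]
      rw [← integral_finsetSum _ fun i _ => (integrable_ridge (measurable_inner_right v) (hy v)
        (h1 i) hexp 0 θ).const_mul _]
      congr with x
      simp only [Complex.coe_algebraMap]
      push_cast
      rw [Finset.sum_mul]
      exact Finset.sum_congr rfl fun i _ => by ring
    have r2 : ridgeInt μ (fun x => inner ℝ v x) (fun x => ∑ i, ∑ j, Hij i j x * (v i * v j))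
        Complex.exp 0 θ = ∑ i, ∑ j, v i * v j * F (Hij i j) v := by
      simp only [F, ridgeInt, ← integral_const_mul]
      have hh := fun i j => (integrable_ridge (measurable_inner_right v) (hy v)
        (h2 i j) hexp 0 θ).const_mul ((v i : ℂ) * v j)
      simp_rw [← integral_finsetSum _ fun j _ => hh _ j]
      rw [← integral_finsetSum _ fun i _ => integrable_finsetSum _ fun j _ => hh i j]
      congr with x
      simp only [Complex.coe_algebraMap]
      push_cast
      rw [Finset.sum_mul]
      refine Finset.sum_congr rfl fun i _ => ?_
      rw [Finset.sum_mul]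
      exact Finset.sum_congr rfl fun j _ => by ring
    rw [ridgeFun, Complex.deriv_exp, Complex.deriv_exp, r1, r2] at hk
    rw [← mul_zero (fHat g v), ← hk]
    simp_rw [fHat_partialD (hgi _) (hgci _), fHat_partialD hg hgc, ← hθ]
    rw [mul_add, mul_add, Finset.mul_sum, Finset.mul_sum, Finset.mul_sum, Finset.mul_sum]
    congr 1
    · congr 1
      exact Finset.sum_congr rfl fun i _ => by ring
    · refine Finset.sum_congr rfl fun i _ => ?_
      rw [Finset.mul_sum, Finset.mul_sum]
      exact Finset.sum_congr rfl fun j _ => by ring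
  have z := integral_add T01 T2
  rw [integral_add i0 T1, integral_finsetSum _ fun i _ => I1 i,
    integral_finsetSum _ fun i _ => integrable_finsetSum _ fun j _ => I2 i j] at z
  simp_rw [integral_finsetSum _ fun j _ => I2 _ j] at z
  rw [← z]
  simp_rw [this]
  exact integral_zero _ _

end DGM

/-! ### The positivity argument at a stationary point. -/

namespace DGM
open Filter Topology
variable {d : ℕ}

section Stationary

variable {P ι : Type*} [MeasurableSpace P] [Fintype ι] {π : Measure P} {Ω : Set (E d)}

theorem hasDerivAt_line {f : E d → ℝ} (hf : ContDiff ℝ 1 f) (y : E d) (i : Fin d) (t : ℝ) :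
    HasDerivAt (fun t : ℝ => f (y + t • EuclideanSpace.single i (1 : ℝ)))
      (partialD i f (y + t • EuclideanSpace.single i (1 : ℝ))) t := by
  have h1 : HasDerivAt (fun t : ℝ => y + t • EuclideanSpace.single i (1 : ℝ))
      (EuclideanSpace.single i (1 : ℝ)) t := by
    simpa using ((hasDerivAt_id t).smul_const (EuclideanSpace.single i (1 : ℝ))).const_add y
  exact ((hf.differentiable one_ne_zero _).hasFDerivAt).comp_hasDerivAt t h1

/-- If the average of a family of functions vanishes on an open set, so does the average of the
partial derivatives. -/
theorem integral_partialD_eq_zero (hΩ : IsOpen Ω) {Ψ : P → E d → ℝ} {V : P → ℝ}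
    (hc : ∀ p, ContDiff ℝ 1 (Ψ p)) (hm : ∀ y, Measurable fun p => Ψ p y) (i : Fin d)
    (hm' : ∀ y, Measurable fun p => partialD i (Ψ p) y) (hV : Integrable V π)
    (b : ∀ᵐ p ∂π, ∀ y ∈ Ω, |Ψ p y| ≤ V p) (b' : ∀ᵐ p ∂π, ∀ y ∈ Ω, |partialD i (Ψ p) y| ≤ V p)
    (h : ∀ y ∈ Ω, ∫ p, Ψ p y ∂π = 0) : ∀ y ∈ Ω, ∫ p, partialD i (Ψ p) y ∂π = 0 := by
  intro y hy
  let l : ℝ → E d := fun t => y + t • EuclideanSpace.single i (1 : ℝ)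
  have l0 : l 0 = y := by simp [l]
  have hs : l ⁻¹' Ω ∈ 𝓝 (0 : ℝ) := by
    refine (by fun_prop : Continuous l).continuousAt.preimage_mem_nhds ?_
    rw [l0]; exact hΩ.mem_nhds hy
  have hd := (hasDerivAt_integral_of_dominated_loc_of_deriv_le (μ := π) hs
    (F := fun t p => Ψ p (l t)) (F' := fun t p => partialD i (Ψ p) (l t)) (bound := V)
    (Eventually.of_forall fun t => (hm (l t)).aestronglyMeasurable) ?_
    (hm' (l 0)).aestronglyMeasurable ?_ hV
    (Eventually.of_forall fun p t _ => hasDerivAt_line (hc p) y i t)).2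
  · have h0 : HasDerivAt (fun t => ∫ p, Ψ p (l t) ∂π) 0 0 := by
      refine (hasDerivAt_const (0 : ℝ) (0 : ℝ)).congr_of_eventuallyEq ?_
      filter_upwards [hs] with t ht using h _ ht
    simpa only [l0] using hd.unique h0
  · refine hV.mono' (hm (l 0)).aestronglyMeasurable ?_
    filter_upwards [b] with p hp
    exact hp _ (by rwa [l0])
  · filter_upwards [b'] with p hp t ht using hp _ ht

theorem eq_zero_of_ae_eq_zero {μ : Measure (E d)} (hΩ : IsOpen Ω) (hμ : volume.restrict Ω ≪ μ)
    {f : E d → ℝ} (hf : ContinuousOn f Ω) (h : ∀ᵐ y ∂μ, f y = 0) : ∀ y ∈ Ω, f y = 0 :=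
  Measure.eqOn_open_of_ae_eq (μ := volume) (hμ.ae_le h) hΩ hf continuousOn_const

theorem PDEOp.classical_abs_le {A : PDEOp d} {B W : ℝ} (hB0 : 0 ≤ B) {x : E d} {f : E d → ℝ}
    (ha : ∀ i j, |A.a i j x| ≤ B) (hb : ∀ i, |A.b i x| ≤ B) (hc : |A.c x| ≤ B)
    (h0 : |f x| ≤ W) (h1 : ∀ i, |partialD i f x| ≤ W)
    (h2 : ∀ i j, |partialD j (partialD i f) x| ≤ W) :
    |A.classical f x| ≤ ((d : ℝ) * d + d + 1) * B * W := by
  have m : ∀ {s t : ℝ}, |s| ≤ B → |t| ≤ W → |s * t| ≤ B * W := fun hs ht => by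
    rw [abs_mul]; exact mul_le_mul hs ht (abs_nonneg _) hB0
  have e2 : |∑ i, ∑ j, A.a i j x * partialD j (partialD i f) x| ≤ (d : ℝ) * d * (B * W) := by
    refine (Finset.abs_sum_le_sum_abs _ _).trans ?_
    calc _ ≤ ∑ i : Fin d, ∑ j : Fin d, B * W := Finset.sum_le_sum fun i _ =>
          (Finset.abs_sum_le_sum_abs _ _).trans (Finset.sum_le_sum fun j _ => m (ha i j) (h2 i j))
      _ = _ := by simp; ring
  have e1 : |∑ i, A.b i x * partialD i f x| ≤ (d : ℝ) * (B * W) := by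
    refine (Finset.abs_sum_le_sum_abs _ _).trans ?_
    calc _ ≤ ∑ i : Fin d, B * W := Finset.sum_le_sum fun i _ => m (hb i) (h1 i)
      _ = _ := by simp
  have e0 := m hc h0
  calc |A.classical f x| ≤ (d : ℝ) * d * (B * W) + d * (B * W) + B * W :=
        (abs_add_le _ _).trans (add_le_add ((abs_add_le _ _).trans (add_le_add e2 e1)) e0)
    _ = _ := by ring

/-- The kernel is an average of products (𝒜ψ_m)(x) ψ_m(y). The stationarity condition is a statement
in y to which 𝒜 can be applied once more; paired with h it becomes the sum of squares 𝔼 Σ F_m². W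
bounds the features and their derivatives up to order two, and square integrability of W is what
every Fubini and domination step uses. -/
theorem ae_integral_eq_zero_of_stationary {μ : Measure (E d)} [IsFiniteMeasure μ]
    [IsFiniteMeasure π] (hΩ : IsOpen Ω) (hμΩ : ∀ᵐ x ∂μ, x ∈ Ω) (hμ : volume.restrict Ω ≪ μ)
    {A : PDEOp d} (hAm : A.IsMeasurable) {B : ℝ} (hB0 : 0 ≤ B) (ha : ∀ i j x, |A.a i j x| ≤ B)
    (hb : ∀ i x, |A.b i x| ≤ B) (hc : ∀ x, |A.c x| ≤ B) {h : E d → ℝ} (hhm : Measurable h)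
    (hh : Integrable h μ) {ψ : ι → P → E d → ℝ} (hψ : ∀ m p, ContDiff ℝ 2 (ψ m p))
    (m0 : ∀ m, Measurable fun z : P × E d => ψ m z.1 z.2)
    (m1 : ∀ m i, Measurable fun z : P × E d => partialD i (ψ m z.1) z.2)
    (m2 : ∀ m i j, Measurable fun z : P × E d => partialD j (partialD i (ψ m z.1)) z.2)
    {W : P → ℝ} (hW : Measurable W) (hW0 : ∀ p, 0 ≤ W p) (hW2 : Integrable (fun p => W p ^ 2) π)
    (b0 : ∀ᵐ p ∂π, ∀ m, ∀ x ∈ Ω, |ψ m p x| ≤ W p)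
    (b1 : ∀ᵐ p ∂π, ∀ m i, ∀ x ∈ Ω, |partialD i (ψ m p) x| ≤ W p)
    (b2 : ∀ᵐ p ∂π, ∀ m i j, ∀ x ∈ Ω, |partialD j (partialD i (ψ m p)) x| ≤ W p)
    (hs : ∀ᵐ y ∂μ, ∫ x, h x * ∫ p, ∑ m, A.classical (ψ m p) x * ψ m p y ∂π ∂μ = 0) :
    ∀ᵐ p ∂π, ∀ m, ∫ x, h x * A.classical (ψ m p) x ∂μ = 0 := by
  obtain ⟨K, hK⟩ : ∃ K, K = ((d : ℝ) * d + d + 1) * B := ⟨_, rfl⟩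
  have hK0 : 0 ≤ K := by rw [hK]; positivity
  have hWi : Integrable W π := by
    refine ((integrable_const 1).add hW2).mono' hW.aestronglyMeasurable
      (Eventually.of_forall fun p => ?_)
    rw [Real.norm_eq_abs, abs_of_nonneg (hW0 p)]
    simp only [Pi.add_apply]
    nlinarith [sq_nonneg (W p - 1)]
  let T : ι → P → E d → ℝ := fun m p x => A.classical (ψ m p) x
  have Tm : ∀ m, Measurable fun z : P × E d => T m z.1 z.2 := fun m => by
    refine ((Finset.measurable_sum _ fun i _ => Finset.measurable_sum _ fun j _ =>
      ((hAm.1 i j).comp measurable_snd).mul (m2 m i j)).add (Finset.measurable_sum _ fun i _ =>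
      ((hAm.2.1 i).comp measurable_snd).mul (m1 m i))).add
      ((hAm.2.2.comp measurable_snd).mul (m0 m))
  have Tb : ∀ᵐ p ∂π, ∀ m, ∀ x ∈ Ω, |T m p x| ≤ K * W p := by
    filter_upwards [b0, b1, b2] with p h0 h1 h2 m x hx
    rw [hK]
    exact PDEOp.classical_abs_le hB0 (fun i j => ha i j x) (fun i => hb i x) (hc x) (h0 m x hx)
      (fun i => h1 m i x hx) (fun i j => h2 m i j x hx)
  let F : ι → P → ℝ := fun m p => ∫ x, h x * T m p x ∂μ
  have Fm : ∀ m, Measurable (F m) := fun m =>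
    ((((hhm.comp measurable_snd).mul (Tm m)).stronglyMeasurable).integral_prod_right').measurable
  obtain ⟨N, hN⟩ : ∃ N, N = K * ∫ x, |h x| ∂μ := ⟨_, rfl⟩
  have hN0 : 0 ≤ N := by rw [hN]; positivity
  have Fb : ∀ᵐ p ∂π, ∀ m, |F m p| ≤ N * W p := by
    filter_upwards [Tb] with p hp m
    have : ∀ᵐ x ∂μ, ‖h x * T m p x‖ ≤ |h x| * (K * W p) := by
      filter_upwards [hμΩ] with x hx
      rw [norm_mul]
      exact mul_le_mul_of_nonneg_left (hp m x hx) (abs_nonneg _)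
    refine (norm_integral_le_of_norm_le (hh.norm.mul_const _) this).trans_eq ?_
    rw [integral_mul_const, hN]
    simp only [Real.norm_eq_abs]
    ring
  -- products of two quantities controlled by the weight
  have dom : ∀ {f : ι → P → ℝ}, ∀ p, (∀ m, |F m p| ≤ N * W p) → (∀ m, |f m p| ≤ W p) →
      |∑ m, F m p * f m p| ≤ Fintype.card ι * N * W p ^ 2 := by
    intro f p h1 h2
    refine (Finset.abs_sum_le_sum_abs _ _).trans ?_
    calc _ ≤ ∑ m : ι, N * W p * W p := Finset.sum_le_sum fun m _ => by
          rw [abs_mul]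
          exact mul_le_mul (h1 m) (h2 m) (abs_nonneg _) (mul_nonneg hN0 (hW0 p))
      _ = _ := by simp; ring
  have Vi : Integrable (fun p => Fintype.card ι * N * W p ^ 2) π := hW2.const_mul _
  have dom' : ∀ {f : ι → P → E d → ℝ}, (∀ᵐ p ∂π, ∀ m, ∀ x ∈ Ω, |f m p x| ≤ W p) →
      ∀ᵐ p ∂π, ∀ y ∈ Ω, |∑ m, F m p * f m p y| ≤ Fintype.card ι * N * W p ^ 2 := by
    intro f hf
    filter_upwards [hf, Fb] with p h1 h2 y hy
    exact dom (f := fun m p => f m p y) p h2 fun m => h1 m y hy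
  have b1' : ∀ i, ∀ᵐ p ∂π, ∀ m, ∀ x ∈ Ω, |partialD i (ψ m p) x| ≤ W p := fun i =>
    b1.mono fun p hp m => hp m i
  have b2' : ∀ i j, ∀ᵐ p ∂π, ∀ m, ∀ x ∈ Ω, |partialD j (partialD i (ψ m p)) x| ≤ W p :=
    fun i j => b2.mono fun p hp m => hp m i j
  have sm : ∀ {f : ι → P → E d → ℝ}, (∀ m, Measurable fun z : P × E d => f m z.1 z.2) →
      Measurable fun z : P × E d => ∑ m, F m z.1 * f m z.1 z.2 := fun hf =>
    Finset.measurable_sum _ fun m _ => ((Fm m).comp measurable_fst).mul (hf m)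
  have sec : ∀ {f : P × E d → ℝ}, Measurable f → ∀ y, Measurable fun p => f (p, y) := fun hf y =>
    hf.comp (measurable_id.prodMk measurable_const)
  have c1 : ∀ m p i, ContDiff ℝ 1 (partialD i (ψ m p)) := fun m p i =>
    contDiff_partialD (hψ m p) (by norm_num) i
  -- the averaged network vanishes on `Ω`
  have S0' : ∀ᵐ y ∂μ, ∫ p, ∑ m, F m p * ψ m p y ∂π = 0 := by
    filter_upwards [hs, hμΩ] with y hy hyΩ
    rw [← hy]
    have hi : Integrable (fun z : E d × P => h z.1 * ∑ m, T m z.2 z.1 * ψ m z.2 y) (μ.prod π) := by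
      have hb : Integrable (fun z : E d × P => |h z.1| * (Fintype.card ι * K * W z.2 ^ 2))
          (μ.prod π) := hh.norm.mul_prod (hW2.const_mul _)
      refine hb.mono' ?_ ?_
      · refine ((hhm.comp measurable_fst).mul (Finset.measurable_sum _ fun m _ =>
          ((Tm m).comp measurable_swap).mul
            ((sec (m0 m) y).comp measurable_snd))).aestronglyMeasurable
      · have q1 : ∀ᵐ z ∂μ.prod π, z.1 ∈ Ω := Measure.quasiMeasurePreserving_fst.ae hμΩ
        have q2 := Measure.quasiMeasurePreserving_snd (μ := μ).ae Tb
        have q3 := Measure.quasiMeasurePreserving_snd (μ := μ).ae b0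
        filter_upwards [q1, q2, q3] with z z1 z2 z3
        rw [norm_mul]
        refine mul_le_mul_of_nonneg_left ?_ (abs_nonneg _)
        refine (Finset.abs_sum_le_sum_abs _ _).trans ?_
        calc _ ≤ ∑ m : ι, K * W z.2 * W z.2 := Finset.sum_le_sum fun m _ => by
              rw [abs_mul]
              exact mul_le_mul (z2 m _ z1) (z3 m _ hyΩ) (abs_nonneg _) (mul_nonneg hK0 (hW0 _))
          _ = _ := by simp; ring
    have e1 : ∀ x, h x * ∫ p, ∑ m, A.classical (ψ m p) x * ψ m p y ∂π
        = ∫ p, h x * ∑ m, T m p x * ψ m p y ∂π := fun x => (integral_const_mul _ _).symm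
    simp_rw [e1]
    rw [integral_integral_swap hi]
    refine integral_congr_ae ?_
    filter_upwards [Tb] with p hp
    have ii : ∀ m, Integrable (fun x => h x * T m p x * ψ m p y) μ := fun m => by
      refine Integrable.mul_const ?_ _
      refine (hh.norm.mul_const (K * W p)).mono' (hhm.mul
        ((Tm m).comp (measurable_const.prodMk measurable_id))).aestronglyMeasurable ?_
      filter_upwards [hμΩ] with x hx
      rw [norm_mul]
      exact mul_le_mul_of_nonneg_left (hp m x hx) (abs_nonneg _)
    simp only [F, ← integral_mul_const]
    rw [← integral_finsetSum _ fun m _ => ii m]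
    congr with x
    rw [Finset.mul_sum]
    exact Finset.sum_congr rfl fun m _ => by ring
  -- Differentiation in y requires vanishing on an open set; the average is continuous on Ω and
  -- Lebesgue measure there is absolutely continuous with respect to μ.
  have S0 : ∀ y ∈ Ω, ∫ p, ∑ m, F m p * ψ m p y ∂π = 0 := by
    refine eq_zero_of_ae_eq_zero hΩ hμ ?_ S0'
    refine continuousOn_of_dominated (bound := fun p => Fintype.card ι * N * W p ^ 2)
      (fun y _ => (sec (sm m0) y).aestronglyMeasurable) (fun y hy => ?_) Vi
      (Eventually.of_forall fun p => ?_)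
    · filter_upwards [dom' b0] with p hp using hp y hy
    · exact (continuous_finsetSum _ fun m _ =>
        continuous_const.mul (hψ m p).continuous).continuousOn
  have pd : ∀ {f : ι → P → E d → ℝ}, (∀ m p, ContDiff ℝ 1 (f m p)) → ∀ i p y,
      partialD i (fun y => ∑ m, F m p * f m p y) y = ∑ m, F m p * partialD i (f m p) y := by
    intro f hf i p y
    rw [partialD_sum fun m => ((hf m p).differentiable one_ne_zero y).const_mul _]
    refine Finset.sum_congr rfl fun m _ => ?_
    unfold partialD
    rw [fderiv_const_mul ((hf m p).differentiable one_ne_zero y)]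
    rfl
  have step : ∀ {f : ι → P → E d → ℝ} (i : Fin d), (∀ m p, ContDiff ℝ 1 (f m p)) →
      (∀ m, Measurable fun z : P × E d => f m z.1 z.2) →
      (∀ m, Measurable fun z : P × E d => partialD i (f m z.1) z.2) →
      (∀ᵐ p ∂π, ∀ m, ∀ x ∈ Ω, |f m p x| ≤ W p) →
      (∀ᵐ p ∂π, ∀ m, ∀ x ∈ Ω, |partialD i (f m p) x| ≤ W p) →
      (∀ y ∈ Ω, ∫ p, ∑ m, F m p * f m p y ∂π = 0) →
      ∀ y ∈ Ω, ∫ p, ∑ m, F m p * partialD i (f m p) y ∂π = 0 := by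
    intro f i hf n0 n1 u0 u1 hz
    have := integral_partialD_eq_zero (π := π) hΩ (Ψ := fun p y => ∑ m, F m p * f m p y)
      (fun p => ContDiff.sum fun m _ => contDiff_const.mul (hf m p)) (fun y => sec (sm n0) y) i
      (fun y => by
        simp_rw [pd hf]
        exact sec (sm (f := fun m p => partialD i (f m p)) n1) y) Vi (dom' u0)
      (by simpa only [pd hf] using dom' (f := fun m p => partialD i (f m p)) u1) hz
    simpa only [pd hf] using this
  have S1 : ∀ i, ∀ y ∈ Ω, ∫ p, ∑ m, F m p * partialD i (ψ m p) y ∂π = 0 := fun i =>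
    step i (fun m p => (hψ m p).of_le (by norm_num)) m0 (fun m => m1 m i) b0 (b1' i) S0
  have S2 : ∀ i j, ∀ y ∈ Ω, ∫ p, ∑ m, F m p * partialD j (partialD i (ψ m p)) y ∂π = 0 :=
    fun i j => step (f := fun m p => partialD i (ψ m p)) j (fun m p => c1 m p i) (fun m => m1 m i)
      (fun m => m2 m i j) (b1' i) (b2' i j) (S1 i)
  have ig : ∀ {f : ι → P → E d → ℝ}, (∀ m, Measurable fun z : P × E d => f m z.1 z.2) →
      (∀ᵐ p ∂π, ∀ m, ∀ x ∈ Ω, |f m p x| ≤ W p) → ∀ y ∈ Ω,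
      Integrable (fun p => ∑ m, F m p * f m p y) π := fun hf hb y hy =>
    Vi.mono' (sec (sm hf) y).aestronglyMeasurable ((dom' hb).mono fun p hp => hp y hy)
  -- 𝒜 is applied in y under the expectation, its coefficients at y being constants for the integral
  -- over p.
  have ST : ∀ y ∈ Ω, ∫ p, ∑ m, F m p * T m p y ∂π = 0 := by
    intro y hy
    have e : ∀ p, ∑ m, F m p * T m p y
        = (∑ i, ∑ j, A.a i j y * ∑ m, F m p * partialD j (partialD i (ψ m p)) y)
          + (∑ i, A.b i y * ∑ m, F m p * partialD i (ψ m p) y)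
          + A.c y * ∑ m, F m p * ψ m p y := by
      intro p
      simp only [T, PDEOp.classical, mul_add, Finset.sum_add_distrib, Finset.mul_sum]
      congr 1
      · congr 1
        · rw [Finset.sum_comm]
          refine Finset.sum_congr rfl fun i _ => ?_
          rw [Finset.sum_comm]
          exact Finset.sum_congr rfl fun j _ => Finset.sum_congr rfl fun m _ => by ring
        · rw [Finset.sum_comm]
          exact Finset.sum_congr rfl fun j _ => Finset.sum_congr rfl fun m _ => by ring
      · exact Finset.sum_congr rfl fun m _ => by ring
    have i2 := fun i j => (ig (f := fun m p => partialD j (partialD i (ψ m p)))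
      (fun m => m2 m i j) (b2' i j) y hy).const_mul (A.a i j y)
    have i1 := fun i => (ig (f := fun m p => partialD i (ψ m p)) (fun m => m1 m i) (b1' i) y
      hy).const_mul (A.b i y)
    have i0 := (ig m0 b0 y hy).const_mul (A.c y)
    have j2 : Integrable (fun p => ∑ i, ∑ j, A.a i j y
        * ∑ m, F m p * partialD j (partialD i (ψ m p)) y) π :=
      integrable_finsetSum _ fun i _ => integrable_finsetSum _ fun j _ => i2 i j
    have j1 : Integrable (fun p => ∑ i, A.b i y * ∑ m, F m p * partialD i (ψ m p) y) π :=
      integrable_finsetSum _ fun i _ => i1 i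
    have j12 : Integrable (fun p => (∑ i, ∑ j, A.a i j y
        * ∑ m, F m p * partialD j (partialD i (ψ m p)) y)
        + ∑ i, A.b i y * ∑ m, F m p * partialD i (ψ m p) y) π := j2.add j1
    simp_rw [e]
    rw [integral_add j12 i0, integral_add j2 j1, integral_finsetSum _ fun i _ => i1 i,
      integral_finsetSum _ fun i _ => integrable_finsetSum _ fun j _ => i2 i j]
    simp_rw [integral_finsetSum _ fun j _ => i2 _ j, integral_const_mul, S0 y hy, S1 _ y hy,
      S2 _ _ y hy]
    simp
  -- integrate against `h`
  have hi : Integrable (fun z : E d × P => h z.1 * ∑ m, F m z.2 * T m z.2 z.1) (μ.prod π) := by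
    have hb : Integrable (fun z : E d × P => |h z.1| * (Fintype.card ι * N * K * W z.2 ^ 2))
        (μ.prod π) := hh.norm.mul_prod (hW2.const_mul _)
    refine hb.mono' ((hhm.comp measurable_fst).mul
      ((sm Tm).comp measurable_swap)).aestronglyMeasurable ?_
    have q1 : ∀ᵐ z ∂μ.prod π, z.1 ∈ Ω := Measure.quasiMeasurePreserving_fst.ae hμΩ
    have q2 := Measure.quasiMeasurePreserving_snd (μ := μ).ae Tb
    have q3 := Measure.quasiMeasurePreserving_snd (μ := μ).ae Fb
    filter_upwards [q1, q2, q3] with z z1 z2 z3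
    rw [norm_mul]
    refine mul_le_mul_of_nonneg_left ?_ (abs_nonneg _)
    refine (Finset.abs_sum_le_sum_abs _ _).trans ?_
    calc _ ≤ ∑ m : ι, N * W z.2 * (K * W z.2) := Finset.sum_le_sum fun m _ => by
          rw [abs_mul]
          exact mul_le_mul (z3 m) (z2 m _ z1) (abs_nonneg _) (mul_nonneg hN0 (hW0 _))
      _ = _ := by simp; ring
  -- Integrating 𝒜ψ_m(p) against h reproduces F_m(p), whence the square.
  have hsq : ∀ᵐ p ∂π, ∫ x, h x * ∑ m, F m p * T m p x ∂μ = ∑ m, F m p ^ 2 := by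
    filter_upwards [Tb] with p hp
    have ii : ∀ m, Integrable (fun x => F m p * (h x * T m p x)) μ := fun m => by
      refine Integrable.const_mul ?_ _
      refine (hh.norm.mul_const (K * W p)).mono' (hhm.mul
        ((Tm m).comp (measurable_const.prodMk measurable_id))).aestronglyMeasurable ?_
      filter_upwards [hμΩ] with x hx
      rw [norm_mul]
      exact mul_le_mul_of_nonneg_left (hp m x hx) (abs_nonneg _)
    have : ∀ m, F m p ^ 2 = ∫ x, F m p * (h x * T m p x) ∂μ := fun m => by
      rw [integral_const_mul, sq]
    simp_rw [this]
    rw [← integral_finsetSum _ fun m _ => ii m]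
    congr with x
    rw [Finset.mul_sum]
    exact Finset.sum_congr rfl fun m _ => by ring
  have tot : ∫ p, ∑ m, F m p ^ 2 ∂π = 0 := by
    rw [← integral_congr_ae hsq, ← integral_integral_swap hi]
    simp_rw [integral_const_mul]
    rw [← integral_zero (E d) ℝ (μ := μ)]
    refine integral_congr_ae ?_
    filter_upwards [hμΩ] with x hx
    rw [ST x hx, mul_zero]
  have sqi : Integrable (fun p => ∑ m, F m p ^ 2) π := by
    refine (hi.swap.integral_prod_left).congr hsq
  have := (integral_eq_zero_iff_of_nonneg (fun p => Finset.sum_nonneg fun m _ => sq_nonneg _)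
    sqi).1 tot
  filter_upwards [this] with p hp m
  have hp' : ∑ m, F m p ^ 2 = 0 := hp
  rw [Finset.sum_eq_zero_iff_of_nonneg fun m _ => sq_nonneg _] at hp'
  exact pow_eq_zero_iff two_ne_zero |>.1 (hp' m (Finset.mem_univ m))

end Stationary

end DGM

/-! ### Differentiation in the parameters, and the features of a hidden unit. -/

namespace DGM
open Filter Topology
variable {d : ℕ}

section DirectionalDerivative

variable {V : Type*} [NormedAddCommGroup V] [NormedSpace ℝ V]

/-- The derivative of a function in a fixed direction. -/
noncomputable def dirD (u : V) (f : V → ℝ) : V → ℝ := fun z => fderiv ℝ f z u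

theorem contDiff_dirD {n m : ℕ∞ω} {f : V → ℝ} (hf : ContDiff ℝ n f) (hmn : m + 1 ≤ n) (u : V) :
    ContDiff ℝ m (dirD u f) :=
  (hf.fderiv_right hmn).clm_apply contDiff_const

theorem dirD_comm {f : V → ℝ} (hf : ContDiff ℝ 2 f) (u v : V) :
    dirD u (dirD v f) = dirD v (dirD u f) := by
  funext x
  have hs : IsSymmSndFDerivAt ℝ f x := hf.contDiffAt.isSymmSndFDerivAt (by simp)
  have hd : DifferentiableAt ℝ (fderiv ℝ f) x :=
    ((hf.fderiv_right (m := 1) (by norm_num)).differentiable one_ne_zero) x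
  have key : ∀ v w : V, fderiv ℝ (fun y => fderiv ℝ f y v) x w = fderiv ℝ (fderiv ℝ f) x w v := by
    intro v w
    rw [fderiv_clm_apply hd (differentiableAt_const v)]
    simp
  change fderiv ℝ (fun y => fderiv ℝ f y _) x _ = fderiv ℝ (fun y => fderiv ℝ f y _) x _
  rw [key, key]
  exact hs _ _

variable {P : Type*} [NormedAddCommGroup P] [NormedSpace ℝ P]

/-- Spatial derivatives are seen as directional derivatives of one function on the product space.
This yields joint continuity and measurability, and lets parameter and space derivatives be
exchanged by `dirD_comm`. -/
theorem partialD_eq_dirD {f : P × E d → ℝ} (hf : ContDiff ℝ 1 f) (i : Fin d) (p : P) :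
    partialD i (fun x => f (p, x)) = fun x => dirD (0, EuclideanSpace.single i (1 : ℝ)) f (p, x) := by
  funext x
  have h := (hf.differentiable one_ne_zero (p, x)).hasFDerivAt.comp x
    (hasFDerivAt_prodMk_right p x)
  exact congrArg (fun L => L (EuclideanSpace.single i (1 : ℝ))) h.fderiv

theorem fderiv_left_eq_dirD {f : P × E d → ℝ} (hf : ContDiff ℝ 1 f) (u p : P) (x : E d) :
    fderiv ℝ (fun q => f (q, x)) p u = dirD (u, 0) f (p, x) := by
  have h := HasFDerivAt.comp (f := fun q : P => (q, x)) p
    (hf.differentiable one_ne_zero (p, x)).hasFDerivAt (hasFDerivAt_prodMk_left p x)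
  exact congrArg (fun L => L u) h.fderiv

theorem partialD_partialD_eq_dirD {f : P × E d → ℝ} (hf : ContDiff ℝ 2 f) (i j : Fin d) (p : P) :
    partialD j (partialD i (fun x => f (p, x))) = fun x =>
      dirD (0, EuclideanSpace.single j (1 : ℝ)) (dirD (0, EuclideanSpace.single i (1 : ℝ)) f)
        (p, x) := by
  rw [partialD_eq_dirD (hf.of_le (by norm_num)), partialD_eq_dirD (contDiff_dirD hf (by norm_num) _)]

/-- Differentiation in a parameter commutes with a differential operator in the space variable. -/
theorem fderiv_classical (A : PDEOp d) {f : P × E d → ℝ} (hf : ContDiff ℝ 3 f) (u p : P)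
    (x : E d) : fderiv ℝ (fun q => A.classical (fun x => f (q, x)) x) p u
      = A.classical (fun x => dirD (u, 0) f (p, x)) x := by
  have hf1 : ContDiff ℝ 1 f := hf.of_le (by norm_num)
  have hf2 : ContDiff ℝ 2 f := hf.of_le (by norm_num)
  have hu : ContDiff ℝ 2 (dirD (u, (0 : E d)) f) := contDiff_dirD hf (by norm_num) _
  have h1 : ∀ i : Fin d, ContDiff ℝ 2 (dirD ((0 : P), EuclideanSpace.single i (1 : ℝ)) f) :=
    fun i => contDiff_dirD hf (by norm_num) _
  have h2 : ∀ i j : Fin d, ContDiff ℝ 1 (dirD ((0 : P), EuclideanSpace.single j (1 : ℝ))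
      (dirD (0, EuclideanSpace.single i (1 : ℝ)) f)) := fun i j => contDiff_dirD (h1 i) (by norm_num) _
  have dl : ∀ {g : P × E d → ℝ}, ContDiff ℝ 1 g → DifferentiableAt ℝ (fun q => g (q, x)) p :=
    fun hg => DifferentiableAt.comp (f := fun q : P => (q, x)) p (hg.differentiable one_ne_zero _)
      (by fun_prop)
  have hui : ∀ i : Fin d, ContDiff ℝ 1 (dirD ((0 : P), EuclideanSpace.single i (1 : ℝ))
      (dirD (u, 0) f)) := fun i => contDiff_dirD hu (by norm_num) _
  have n1 := fun i => partialD_eq_dirD ((h1 i).of_le (by norm_num : (1 : ℕ∞ω) ≤ 2))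
  have n2 := fun i => partialD_eq_dirD (hui i)
  simp only [PDEOp.classical, partialD_eq_dirD hf1, n1, n2,
    partialD_eq_dirD (hu.of_le (by norm_num : (1 : ℕ∞ω) ≤ 2))]
  have k2 : ∀ i j : Fin d, HasFDerivAt (fun q => A.a i j x
      * dirD ((0 : P), EuclideanSpace.single j (1 : ℝ))
        (dirD (0, EuclideanSpace.single i (1 : ℝ)) f) (q, x)) _ p := fun i j =>
    (dl (h2 i j)).hasFDerivAt.const_mul (A.a i j x)
  have k1 : ∀ i : Fin d, HasFDerivAt (fun q => A.b i x
      * dirD ((0 : P), EuclideanSpace.single i (1 : ℝ)) f (q, x)) _ p := fun i =>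
    (dl ((h1 i).of_le (by norm_num))).hasFDerivAt.const_mul (A.b i x)
  have k0 := (dl hf1).hasFDerivAt.const_mul (A.c x)
  have k := ((HasFDerivAt.fun_sum fun i (_ : i ∈ Finset.univ) =>
    HasFDerivAt.fun_sum fun j (_ : j ∈ Finset.univ) => k2 i j).fun_add
    (HasFDerivAt.fun_sum fun i (_ : i ∈ Finset.univ) => k1 i)).fun_add k0
  rw [k.fderiv]
  simp only [add_apply, sum_apply, smul_apply, smul_eq_mul]
  have e1 : ∀ i : Fin d, fderiv ℝ (fun q => dirD ((0 : P), EuclideanSpace.single i (1 : ℝ)) f (q, x)) p u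
      = dirD (0, EuclideanSpace.single i (1 : ℝ)) (dirD (u, 0) f) (p, x) := fun i => by
    rw [fderiv_left_eq_dirD ((h1 i).of_le (by norm_num)), dirD_comm hf2]
  have e2 : ∀ i j : Fin d, fderiv ℝ (fun q => dirD ((0 : P), EuclideanSpace.single j (1 : ℝ))
        (dirD (0, EuclideanSpace.single i (1 : ℝ)) f) (q, x)) p u
      = dirD (0, EuclideanSpace.single j (1 : ℝ)) (dirD (0, EuclideanSpace.single i (1 : ℝ))
        (dirD (u, 0) f)) (p, x) := fun i j => by
    rw [fderiv_left_eq_dirD (h2 i j), dirD_comm (h1 i), dirD_comm hf2]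
  simp_rw [e1, e2, fderiv_left_eq_dirD hf1]

end DirectionalDerivative

theorem partialD_partialD_mul {f g : E d → ℝ} (hf : ContDiff ℝ 2 f) (hg : ContDiff ℝ 2 g)
    (i j : Fin d) (x : E d) : partialD j (partialD i (fun y => f y * g y)) x
      = (f x * partialD j (partialD i g) x + partialD j f x * partialD i g x)
      + (partialD i f x * partialD j g x + partialD j (partialD i f) x * g x) := by
  have df := hf.differentiable two_ne_zero
  have dg := hg.differentiable two_ne_zero
  have dfi := (contDiff_partialD (m := 1) hf (by norm_num) i).differentiable one_ne_zero
  have dgi := (contDiff_partialD (m := 1) hg (by norm_num) i).differentiable one_ne_zero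
  have : partialD i (fun y => f y * g y)
      = fun x => f x * partialD i g x + partialD i f x * g x :=
    funext fun x => partialD_mul (df x) (dg x) i
  rw [this, partialD_add ((df x).fun_mul (dgi x)) ((dfi x).fun_mul (dg x)),
    partialD_mul (df x) (dgi x), partialD_mul (dfi x) (dg x)]

theorem partialD_ridge {τ : ℝ → ℝ} (hτ : Differentiable ℝ τ) (k : ℝ) (w : E d) (b : ℝ) (i : Fin d) :
    partialD i (fun x => k * τ (inner ℝ w x + b))
      = fun x => (k * w i) * deriv τ (inner ℝ w x + b) := by
  funext x
  have h1 : HasFDerivAt (fun x : E d => inner ℝ w x + b) (innerSL ℝ w) x :=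
    ((innerSL ℝ w).hasFDerivAt).add_const b
  have h2 := ((hτ (inner ℝ w x + b)).hasDerivAt.comp_hasFDerivAt x h1).const_mul k
  have h3 := congrArg (fun L => L (EuclideanSpace.single i (1 : ℝ))) h2.fderiv
  refine h3.trans ?_
  simp [EuclideanSpace.inner_single_right]
  ring

theorem partialD_partialD_ridge {τ : ℝ → ℝ} (hτ : ContDiff ℝ 2 τ) (k : ℝ) (w : E d) (b : ℝ)
    (i j : Fin d) : partialD j (partialD i (fun x => k * τ (inner ℝ w x + b)))
      = fun x => (k * w i * w j) * deriv (deriv τ) (inner ℝ w x + b) := by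
  have h1 : ContDiff ℝ 1 (deriv τ) := (contDiff_succ_iff_deriv.1 hτ).2.2
  rw [partialD_ridge (hτ.differentiable two_ne_zero), partialD_ridge (h1.differentiable one_ne_zero)]

section Network

/-- The coordinate directions of the parameter space. -/
noncomputable def paramDir : Option (Option (Fin d)) → Param d
  | none => (1, 0, 0)
  | some none => (0, 0, 1)
  | some (some k) => (0, EuclideanSpace.single k 1, 0)

theorem gradDot_eq (F G : Param d → ℝ) (p : Param d) :
    gradDot F G p = ∑ m, fderiv ℝ F p (paramDir m) * fderiv ℝ G p (paramDir m) := by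
  simp only [gradDot, Fintype.sum_option, paramDir]
  ring

/-- The derivatives of η(x) c σ(w·x + b) in c, b and w_k are ησ, ηcσ' and ηx_k cσ'. All have the
form amplitude in x, times coefficient in c, times ridge profile; in the index type, `none` is c,
`some none` is b and `some (some k)` is w_k. -/
noncomputable def featAmp (η : E d → ℝ) : Option (Option (Fin d)) → E d → ℝ
  | none => η
  | some none => η
  | some (some k) => fun x => η x * x k

noncomputable def featCoef : Option (Option (Fin d)) → ℝ → ℝ
  | none => fun _ => 1
  | some _ => id

noncomputable def featProfile (σ : ℝ → ℝ) : Option (Option (Fin d)) → ℝ → ℝ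
  | none => σ
  | some _ => deriv σ

/-- The derivative of a hidden unit with respect to a parameter. -/
noncomputable def feature (η : E d → ℝ) (σ : ℝ → ℝ) (m : Option (Option (Fin d))) (p : Param d) (x : E d) : ℝ :=
  featAmp η m x * (featCoef m p.1 * featProfile σ m (inner ℝ p.2.1 x + p.2.2))

theorem contDiff_featAmp {η : E d → ℝ} (hη : ContDiff ℝ 3 η) (m : Option (Option (Fin d))) :
    ContDiff ℝ 3 (featAmp η m) := by
  rcases m with _ | _ | k
  · exact hη
  · exact hη
  · exact hη.mul (by fun_prop)

theorem contDiff_featProfile {σ : ℝ → ℝ} (hσ : ContDiff ℝ 4 σ) (m : Option (Option (Fin d))) :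
    ContDiff ℝ 3 (featProfile σ m) := by
  rcases m with _ | m
  · exact hσ.of_le (by norm_num)
  · exact (contDiff_succ_iff_deriv.1 hσ).2.2

theorem contDiff_featCoef (m : Option (Option (Fin d))) : ContDiff ℝ 3 (featCoef m) := by
  rcases m with _ | m
  · exact contDiff_const
  · exact contDiff_id

theorem contDiff_unit {η : E d → ℝ} (hη : ContDiff ℝ 3 η) {σ : ℝ → ℝ} (hσ : ContDiff ℝ 4 σ) :
    ContDiff ℝ 3 fun z : Param d × E d => unit η σ z.1 z.2 := by
  have hσ' : ContDiff ℝ 3 σ := hσ.of_le (by norm_num)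
  unfold unit
  exact (hη.comp contDiff_snd).mul (contDiff_fst.fst.mul (hσ'.comp
    ((contDiff_fst.snd.fst.inner ℝ contDiff_snd).add contDiff_fst.snd.snd)))

theorem contDiff_feature {η : E d → ℝ} (hη : ContDiff ℝ 3 η) {σ : ℝ → ℝ} (hσ : ContDiff ℝ 4 σ)
    (m : Option (Option (Fin d))) : ContDiff ℝ 3 fun z : Param d × E d => feature η σ m z.1 z.2 :=
  ((contDiff_featAmp hη m).comp contDiff_snd).mul
    (((contDiff_featCoef m).comp contDiff_fst.fst).mul ((contDiff_featProfile hσ m).comp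
    ((contDiff_fst.snd.fst.inner ℝ contDiff_snd).add contDiff_fst.snd.snd)))

theorem dirD_unit {η : E d → ℝ} (hη : ContDiff ℝ 3 η) {σ : ℝ → ℝ} (hσ : ContDiff ℝ 4 σ)
    (m : Option (Option (Fin d))) (p : Param d) (x : E d) :
    dirD (paramDir m, 0) (fun z : Param d × E d => unit η σ z.1 z.2) (p, x) = feature η σ m p x := by
  have hu := contDiff_unit hη hσ
  rw [← fderiv_left_eq_dirD (hu.of_le (by norm_num))]
  have hd : DifferentiableAt ℝ (fun q => unit η σ q x) p :=
    DifferentiableAt.comp (f := fun q : Param d => (q, x)) (g := fun z : Param d × E d =>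
      unit η σ z.1 z.2) p ((hu.differentiable three_ne_zero) (p, x)) (by fun_prop)
  rw [← hd.lineDeriv_eq_fderiv, lineDeriv]
  have σd := hσ.differentiable four_ne_zero
  rcases m with _ | _ | k
  · simp [unit, paramDir, feature, featAmp, featCoef, featProfile]
  · have h1 : HasDerivAt (fun t : ℝ => inner ℝ p.2.1 x + (p.2.2 + t)) 1 0 :=
      ((hasDerivAt_id (0 : ℝ)).const_add p.2.2).const_add _
    have := (((σd (inner ℝ p.2.1 x + (p.2.2 + 0))).hasDerivAt.comp (0 : ℝ) h1).const_mul p.1).const_mul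
      (η x)
    simpa [unit, paramDir, feature, featAmp, featCoef, featProfile, Function.comp_def]
      using this.deriv
  · have h1 : HasDerivAt (fun t : ℝ => (inner ℝ p.2.1 x + t * x k) + p.2.2) (x k) 0 := by
      simpa using (((hasDerivAt_id (0 : ℝ)).mul_const (x k)).const_add (inner ℝ p.2.1 x)).add_const
        p.2.2
    have := (((σd ((inner ℝ p.2.1 x + 0 * x k) + p.2.2)).hasDerivAt.comp (0 : ℝ) h1).const_mul
      p.1).const_mul (η x)
    have h2 := this.deriv
    simp only [Function.comp_def] at h2
    simp only [unit, paramDir, feature, featAmp, featCoef, featProfile, Prod.smul_mk, Prod.fst_add,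
      Prod.snd_add, smul_zero, add_zero, inner_add_left, inner_smul_left,
      EuclideanSpace.inner_single_left, conj_trivial, one_mul, id]
    rw [h2]
    simp
    ring

/-- Writes the kernel as the average of a finite sum of products of features, the form needed for
the positivity argument. -/
theorem kernelU_eq {η : E d → ℝ} (hη : ContDiff ℝ 3 η) {σ : ℝ → ℝ} (hσ : ContDiff ℝ 4 σ)
    (A : PDEOp d) (π : Measure (Param d)) (x y : E d) : kernelU A η σ π x y
      = ∫ p, ∑ m, A.classical (feature η σ m p) x * feature η σ m p y ∂π := by
  have hu := contDiff_unit hη hσ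
  unfold kernelU
  congr with p
  rw [gradDot_eq]
  refine Finset.sum_congr rfl fun m _ => ?_
  rw [fderiv_classical A hu, fderiv_left_eq_dirD (hu.of_le (by norm_num)) _ _ y]
  simp_rw [dirD_unit hη hσ]

end Network

end DGM

/-! ### Moment bounds for the features, and use of the full support of (w, b). -/

namespace DGM
open Filter Topology
variable {d : ℕ}

theorem abs_apply_le_norm (w : E d) (i : Fin d) : |w i| ≤ ‖w‖ := by
  simpa using PiLp.norm_apply_le w i

/-- Each derivative of the ridge factor costs at most one power of ‖w‖, and the Leibniz rule for
second derivatives has four terms; hence the square and the constant 4. -/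
theorem amp_mul_ridge_bounds {a : E d → ℝ} (ha : ContDiff ℝ 2 a) {τ : ℝ → ℝ} (hτ : ContDiff ℝ 2 τ)
    {M S K k b : ℝ} {w x : E d} (m0 : |a x| ≤ M) (m1 : ∀ i, |partialD i a x| ≤ M)
    (m2 : ∀ i j, |partialD j (partialD i a) x| ≤ M) (s0 : ∀ t, |τ t| ≤ S)
    (s1 : ∀ t, |deriv τ t| ≤ S) (s2 : ∀ t, |deriv (deriv τ) t| ≤ S) (hk : |k| ≤ K) :
    |a x * (k * τ (inner ℝ w x + b))| ≤ 4 * M * K * S * (1 + ‖w‖) ^ 2 ∧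
    (∀ i, |partialD i (fun x => a x * (k * τ (inner ℝ w x + b))) x|
      ≤ 4 * M * K * S * (1 + ‖w‖) ^ 2) ∧
    ∀ i j, |partialD j (partialD i (fun x => a x * (k * τ (inner ℝ w x + b)))) x|
      ≤ 4 * M * K * S * (1 + ‖w‖) ^ 2 := by
  have hM := (abs_nonneg _).trans m0
  have hS := (abs_nonneg _).trans (s0 0)
  have hK := (abs_nonneg _).trans hk
  have hw := norm_nonneg w
  have hR : ContDiff ℝ 2 fun x : E d => k * τ (inner ℝ w x + b) :=
    contDiff_const.mul (hτ.comp ((contDiff_const.inner ℝ contDiff_id).add contDiff_const))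
  have hP : 0 ≤ M * K * S := by positivity
  have r0 : |k * τ (inner ℝ w x + b)| ≤ K * S * (1 + ‖w‖) ^ 2 := by
    rw [abs_mul]
    calc |k| * |τ (inner ℝ w x + b)| ≤ K * S := mul_le_mul hk (s0 _) (abs_nonneg _) hK
      _ ≤ _ := le_mul_of_one_le_right (by positivity) (by nlinarith)
  have r1 : ∀ i, |partialD i (fun x => k * τ (inner ℝ w x + b)) x| ≤ K * S * (1 + ‖w‖) ^ 2 := by
    intro i
    rw [partialD_ridge (hτ.differentiable two_ne_zero), abs_mul, abs_mul]
    calc |k| * |w i| * |deriv τ (inner ℝ w x + b)| ≤ K * ‖w‖ * S := by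
          gcongr
          · exact abs_apply_le_norm w i
          · exact s1 _
      _ = K * S * ‖w‖ := by ring
      _ ≤ _ := mul_le_mul_of_nonneg_left (by nlinarith) (by positivity)
  have r2 : ∀ i j, |partialD j (partialD i (fun x => k * τ (inner ℝ w x + b))) x|
      ≤ K * S * (1 + ‖w‖) ^ 2 := by
    intro i j
    rw [partialD_partialD_ridge hτ, abs_mul, abs_mul, abs_mul]
    calc |k| * |w i| * |w j| * |deriv (deriv τ) (inner ℝ w x + b)| ≤ K * ‖w‖ * ‖w‖ * S := by
          gcongr
          · exact abs_apply_le_norm w i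
          · exact abs_apply_le_norm w j
          · exact s2 _
      _ = K * S * ‖w‖ ^ 2 := by ring
      _ ≤ _ := mul_le_mul_of_nonneg_left (by nlinarith) (by positivity)
  have mm : ∀ {s t : ℝ}, |s| ≤ M → |t| ≤ K * S * (1 + ‖w‖) ^ 2 →
      |s * t| ≤ M * K * S * (1 + ‖w‖) ^ 2 := fun hs ht => by
    rw [abs_mul]
    refine (mul_le_mul hs ht (abs_nonneg _) hM).trans_eq (by ring)
  have hT : 0 ≤ M * K * S * (1 + ‖w‖) ^ 2 := by positivity
  refine ⟨?_, fun i => ?_, fun i j => ?_⟩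
  · have := mm m0 r0
    linarith
  · rw [partialD_mul (ha.differentiable two_ne_zero x) (hR.differentiable two_ne_zero x)]
    have h1 := mm m0 (r1 i)
    have h2 := mm (m1 i) r0
    have := abs_add_le (a x * partialD i (fun x => k * τ (inner ℝ w x + b)) x)
      (partialD i a x * (k * τ (inner ℝ w x + b)))
    linarith
  · rw [partialD_partialD_mul ha hR]
    have h1 := mm m0 (r2 i j)
    have h2 := mm (m1 j) (r1 i)
    have h3 := mm (m1 i) (r1 j)
    have h4 := mm (m2 i j) r0
    refine (abs_add_le _ _).trans ?_
    refine (add_le_add (abs_add_le _ _) (abs_add_le _ _)).trans ?_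
    linarith

theorem feature_bounds {Ω : Set (E d)} (hΩ : Bornology.IsBounded Ω) {η : E d → ℝ}
    (hη : ContDiff ℝ 3 η) {σ : ℝ → ℝ} (hσ : IsCnb 4 σ) (K : ℝ) :
    ∃ C, 0 ≤ C ∧ ∀ p : Param d, |p.1| < K → ∀ m, ∀ x ∈ Ω,
      |feature η σ m p x| ≤ C * (1 + ‖p.2.1‖) ^ 2 ∧
      (∀ i, |partialD i (feature η σ m p) x| ≤ C * (1 + ‖p.2.1‖) ^ 2) ∧
      ∀ i j, |partialD j (partialD i (feature η σ m p)) x| ≤ C * (1 + ‖p.2.1‖) ^ 2 := by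
  have key : ∀ m : Option (Option (Fin d)), ∃ C, 0 ≤ C ∧ ∀ p : Param d, |p.1| < K → ∀ x ∈ Ω,
      |feature η σ m p x| ≤ C * (1 + ‖p.2.1‖) ^ 2 ∧
      (∀ i, |partialD i (feature η σ m p) x| ≤ C * (1 + ‖p.2.1‖) ^ 2) ∧
      ∀ i j, |partialD j (partialD i (feature η σ m p)) x| ≤ C * (1 + ‖p.2.1‖) ^ 2 := by
    intro m
    have ha := contDiff_featAmp hη m
    have ha1 : ∀ i, ContDiff ℝ 2 (partialD i (featAmp η m)) := fun i =>
      contDiff_partialD ha (by norm_num) i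
    obtain ⟨M0, hM0, k0⟩ := exists_bound_on hΩ ha.continuous
    choose M1 hM1 k1 using fun i => exists_bound_on hΩ (ha1 i).continuous
    choose M2 hM2 k2 using fun i j => exists_bound_on hΩ
      (contDiff_partialD (m := 1) (ha1 i) (by norm_num) j).continuous
    obtain ⟨M, hM⟩ : ∃ M, M = M0 + ∑ i, M1 i + ∑ i, ∑ j, M2 i j := ⟨_, rfl⟩
    have s1 : 0 ≤ ∑ i, M1 i := Finset.sum_nonneg fun i _ => hM1 i
    have s2 : 0 ≤ ∑ i, ∑ j, M2 i j :=
      Finset.sum_nonneg fun i _ => Finset.sum_nonneg fun j _ => hM2 i j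
    have u1 : ∀ i, M1 i ≤ M := fun i => by
      have := Finset.single_le_sum (fun i _ => hM1 i) (Finset.mem_univ i)
      linarith
    have u2 : ∀ i j, M2 i j ≤ M := fun i j => by
      have h1 := Finset.single_le_sum (fun j _ => hM2 i j) (Finset.mem_univ j)
      have h2 := Finset.single_le_sum (f := fun i => ∑ j, M2 i j)
        (fun i _ => Finset.sum_nonneg fun j _ => hM2 i j) (Finset.mem_univ i)
      linarith
    obtain ⟨C0, hC0⟩ := hσ.iteratedDeriv_bound (k := 0) (by norm_num)
    obtain ⟨C1, hC1⟩ := hσ.iteratedDeriv_bound (k := 1) (by norm_num)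
    obtain ⟨C2, hC2⟩ := hσ.iteratedDeriv_bound (k := 2) (by norm_num)
    obtain ⟨C3, hC3⟩ := hσ.iteratedDeriv_bound (k := 3) (by norm_num)
    simp only [iteratedDeriv_zero, iteratedDeriv_succ] at hC0 hC1 hC2 hC3
    obtain ⟨S, t0, t1, t2⟩ : ∃ S, (∀ t, |featProfile σ m t| ≤ S) ∧
        (∀ t, |deriv (featProfile σ m) t| ≤ S) ∧ ∀ t, |deriv (deriv (featProfile σ m)) t| ≤ S := by
      rcases m with _ | m
      -- For the parameter c the profile is σ; for the others it is σ', which calls for the third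
      -- derivative of σ.
      · exact ⟨max C0 (max C1 C2), fun t => (hC0 t).trans (by simp),
          fun t => (hC1 t).trans (by simp), fun t => (hC2 t).trans (by simp)⟩
      · exact ⟨max C1 (max C2 C3), fun t => (hC1 t).trans (by simp),
          fun t => (hC2 t).trans (by simp), fun t => (hC3 t).trans (by simp)⟩
    have hS : 0 ≤ S := (abs_nonneg _).trans (t0 0)
    have hMn : 0 ≤ M := by linarith
    have hK : 0 ≤ max 1 K := le_max_of_le_left zero_le_one
    refine ⟨4 * M * max 1 K * S, by positivity, fun p hp x hx => ?_⟩
    refine amp_mul_ridge_bounds (ha.of_le (by norm_num))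
      ((contDiff_featProfile hσ.1 m).of_le (by norm_num)) ((k0 x hx).trans (by linarith))
      (fun i => (k1 i x hx).trans (u1 i)) (fun i j => (k2 i j x hx).trans (u2 i j)) t0 t1 t2 ?_
    rcases m with _ | m
    · simp [featCoef]
    · exact hp.le.trans (le_max_right _ _)
  choose C hC h using key
  refine ⟨∑ m, C m, Finset.sum_nonneg fun m _ => hC m, fun p hp m x hx => ?_⟩
  have le : C m * (1 + ‖p.2.1‖) ^ 2 ≤ (∑ m, C m) * (1 + ‖p.2.1‖) ^ 2 := by
    gcongr
    exact Finset.single_le_sum (fun m _ => hC m) (Finset.mem_univ m)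
  obtain ⟨h0, h1, h2⟩ := h m p hp x hx
  exact ⟨h0.trans le, fun i => (h1 i).trans le, fun i j => (h2 i j).trans le⟩

/-- (1 + t)⁴ ≤ 8 + 8t⁴ together with ‖w‖⁴ ≤ d Σ |w_k|⁴ reduces the claim to the fourth moments of w.
-/
theorem integrable_weight {π : Measure (Param d)} (hπ : IsInitLaw π) (C : ℝ) :
    Integrable (fun p : Param d => (C * (1 + ‖p.2.1‖) ^ 2) ^ 2) π := by
  have := hπ.prob
  have hs : Integrable (fun p : Param d => ∑ k, |p.2.1 k| ^ 4) π :=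
    integrable_finsetSum _ fun k _ => hπ.w_moment k
  have hb := (((integrable_const (8 : ℝ)).add (hs.const_mul (8 * d))).const_mul (C ^ 2))
  refine hb.mono' (by fun_prop) (Eventually.of_forall fun p => ?_)
  rw [Real.norm_eq_abs, abs_of_nonneg (by positivity), mul_pow]
  refine mul_le_mul_of_nonneg_left ?_ (sq_nonneg C)
  have e : ‖p.2.1‖ ^ 2 = ∑ k, p.2.1 k ^ 2 := by
    rw [EuclideanSpace.norm_sq_eq]
    simp
  have h4 : (‖p.2.1‖ ^ 2) ^ 2 ≤ d * ∑ k, |p.2.1 k| ^ 4 := by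
    rw [e]
    refine (sq_sum_le_card_mul_sum_sq (s := Finset.univ)).trans_eq ?_
    simp only [Finset.card_univ, Fintype.card_fin]
    congr 1
    refine Finset.sum_congr rfl fun k _ => ?_
    rw [← pow_mul, ← abs_pow, abs_of_nonneg (by positivity)]
  simp only [Pi.add_apply]
  generalize ‖p.2.1‖ = t at *
  nlinarith [sq_nonneg (t - 1), sq_nonneg (t ^ 2 - 1), sq_nonneg (t ^ 2 - t)]

/-- The feature of the parameter c is η σ(w·x + b). Its pairing with h is continuous in (w, b) and
zero almost surely, so the set where it is nonzero is open of probability zero, hence empty. -/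
theorem integral_classical_unit_eq_zero {Ω : Set (E d)} {μ : Measure (E d)} (hΩo : IsOpen Ω)
    (hΩ : Bornology.IsBounded Ω) (hμ : IsSamplingMeasure Ω μ) {η : E d → ℝ} (hη : IsAuxiliary Ω η)
    {A : PDEOp d} (hAm : A.IsMeasurable) {B : ℝ} (hB0 : 0 ≤ B) (ha : ∀ i j x, |A.a i j x| ≤ B)
    (hb : ∀ i x, |A.b i x| ≤ B) (hc : ∀ x, |A.c x| ≤ B) {σ : ℝ → ℝ} (hσ : IsCnb 4 σ)
    {π : Measure (Param d)} (hπ : IsInitLaw π) {h : E d → ℝ} (hhm : Measurable h)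
    (hh : Integrable h μ) (hs : ∀ᵐ y ∂μ, ∫ x, h x * kernelU A η σ π x y ∂μ = 0) (w : E d) (b : ℝ) :
    ∫ x, h x * A.classical (fun x => η x * σ (inner ℝ w x + b)) x ∂μ = 0 := by
  have := hμ.finite
  have := hπ.prob
  have hη3 : ContDiff ℝ 3 η := hη.contDiff
  have hμΩ : ∀ᵐ x ∂μ, x ∈ Ω := hμ.ac.ae_le (ae_restrict_mem hΩo.measurableSet)
  obtain ⟨K, hK⟩ := hπ.c_bdd
  obtain ⟨C, hC0, hC⟩ := feature_bounds hΩ hη3 hσ K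
  have cf : ∀ m, ContDiff ℝ 3 fun z : Param d × E d => feature η σ m z.1 z.2 :=
    contDiff_feature hη3 hσ.1
  have cf1 : ∀ m, ContDiff ℝ 1 fun z : Param d × E d => feature η σ m z.1 z.2 := fun m =>
    (cf m).of_le (by norm_num)
  have cf2 : ∀ m, ContDiff ℝ 2 fun z : Param d × E d => feature η σ m z.1 z.2 := fun m =>
    (cf m).of_le (by norm_num)
  have e1 : ∀ m (i : Fin d) (p : Param d) (x : E d), partialD i (feature η σ m p) x = _ :=
    fun m i p x => congrFun (partialD_eq_dirD (cf1 m) i p) x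
  have e2 : ∀ m (i j : Fin d) (p : Param d) (x : E d),
      partialD j (partialD i (feature η σ m p)) x = _ :=
    fun m i j p x => congrFun (partialD_partialD_eq_dirD (cf2 m) i j p) x
  have c1 : ∀ m (i : Fin d), ContDiff ℝ 2 (dirD ((0 : Param d), EuclideanSpace.single i (1 : ℝ))
      fun z : Param d × E d => feature η σ m z.1 z.2) := fun m i =>
    contDiff_dirD (cf m) (by norm_num) _
  have c2 : ∀ m (i j : Fin d), ContDiff ℝ 1 (dirD ((0 : Param d), EuclideanSpace.single j (1 : ℝ))
      (dirD ((0 : Param d), EuclideanSpace.single i (1 : ℝ))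
      fun z : Param d × E d => feature η σ m z.1 z.2)) := fun m i j =>
    contDiff_dirD (c1 m i) (by norm_num) _
  have main := ae_integral_eq_zero_of_stationary (π := π) (ψ := feature η σ)
    (W := fun p => C * (1 + ‖p.2.1‖) ^ 2) hΩo hμΩ hμ.ac' hAm hB0 ha hb hc hhm hh
    (fun m p => (cf2 m).comp (contDiff_prodMk_right p)) (fun m => (cf m).continuous.measurable)
    (fun m i => by simp only [e1]; exact (c1 m i).continuous.measurable)
    (fun m i j => by simp only [e2]; exact (c2 m i j).continuous.measurable)
    (Continuous.measurable (by fun_prop)) (fun p => by positivity) (integrable_weight hπ C)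
    (hK.mono fun p hp m x hx => (hC p hp m x hx).1)
    (hK.mono fun p hp m i x hx => (hC p hp m x hx).2.1 i)
    (hK.mono fun p hp m i j x hx => (hC p hp m x hx).2.2 i j)
    (by simpa only [kernelU_eq hη3 hσ.1] using hs)
  obtain ⟨C', hC'0, hC'⟩ := feature_bounds hΩ hη3 hσ 1
  -- The value 0 for c is arbitrary: this feature does not depend on c.
  let F : E d × ℝ → ℝ := fun q => ∫ x, h x * A.classical (feature η σ none ((0 : ℝ), q)) x ∂μ
  have hF : Continuous F := by
    refine continuous_iff_continuousAt.2 fun q => ?_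
    refine continuousAt_of_dominated (bound := fun x =>
      |h x| * (((d : ℝ) * d + d + 1) * B * (C' * (1 + (‖q.1‖ + 1)) ^ 2))) ?_ ?_
      (hh.norm.mul_const _) (Eventually.of_forall fun x => ?_)
    · refine Eventually.of_forall fun q' => (hhm.mul ?_).aestronglyMeasurable
      have m : ∀ {f : Param d × E d → ℝ}, Continuous f →
          Measurable fun x => f (((0 : ℝ), q'), x) := fun hf =>
        (hf.comp (continuous_const.prodMk continuous_id)).measurable
      unfold PDEOp.classical
      simp only [e1, e2]
      exact ((Finset.measurable_sum _ fun i _ => Finset.measurable_sum _ fun j _ =>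
        (hAm.1 i j).mul (m (c2 none i j).continuous)).add (Finset.measurable_sum _ fun i _ =>
        (hAm.2.1 i).mul (m (c1 none i).continuous))).add (hAm.2.2.mul (m (cf none).continuous))
    · filter_upwards [Metric.ball_mem_nhds q one_pos] with q' hq'
      filter_upwards [hμΩ] with x hx
      rw [norm_mul]
      refine mul_le_mul_of_nonneg_left ?_ (abs_nonneg _)
      obtain ⟨h0, h1, h2⟩ := hC' ((0 : ℝ), q') (by simp) none x hx
      refine (PDEOp.classical_abs_le hB0 (fun i j => ha i j x) (fun i => hb i x) (hc x) h0 h1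
        h2).trans ?_
      have : ‖q'.1‖ ≤ ‖q.1‖ + 1 := by
        have h3 := norm_sub_norm_le q'.1 q.1
        have h4 : dist q'.1 q.1 ≤ dist q' q := by rw [Prod.dist_eq]; exact le_max_left _ _
        rw [Metric.mem_ball] at hq'
        rw [dist_eq_norm] at h4
        linarith
      dsimp only
      gcongr
    · refine ContinuousAt.mul continuousAt_const ?_
      have m : ∀ {f : Param d × E d → ℝ}, Continuous f →
          Continuous fun q' : E d × ℝ => f (((0 : ℝ), q'), x) := fun hf =>
        hf.comp ((continuous_const.prodMk continuous_id).prodMk continuous_const)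
      unfold PDEOp.classical
      simp only [e1, e2]
      exact (((continuous_finsetSum _ fun i _ => continuous_finsetSum _ fun j _ =>
        continuous_const.mul (m (c2 none i j).continuous)).add (continuous_finsetSum _ fun i _ =>
        continuous_const.mul (m (c1 none i).continuous))).add
        (continuous_const.mul (m (cf none).continuous))).continuousAt
  have hF0 : ∀ q, F q = 0 := by
    intro q
    by_contra hq
    have hD : IsOpen {q | F q ≠ 0} := isOpen_ne_fun hF continuous_const
    have := hπ.full_support _ hD ⟨q, hq⟩
    refine this.ne' ?_
    have hz : ∀ᵐ p ∂π, F p.2 = 0 := by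
      filter_upwards [main] with p hp using hp none
    exact measure_eq_zero_iff_ae_notMem.2 (hz.mono fun p hp => by simp [hp])
  have e : feature η σ none ((0 : ℝ), w, b) = fun x => η x * σ (inner ℝ w x + b) := by
    funext x
    simp [feature, featAmp, featCoef, featProfile]
  simpa only [F, e] using hF0 (w, b)

end DGM

/-! ### Orthogonality of the residual to the images of ηg. -/

namespace DGM
open Filter Topology
variable {d : ℕ}

/-- Leibniz' rule arranged by the order of the derivative of φ, so that φ ↦ ∫ h 𝒜[ηφ] takes the form
used in `integral_eq_zero_of_ridge`. As `a` need not be symmetric, both index orders enter the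
first-order term. -/
theorem PDEOp.classical_mul (A : PDEOp d) {η φ : E d → ℝ} (hη : ContDiff ℝ 2 η)
    (hφ : ContDiff ℝ 2 φ) (x : E d) : A.classical (fun x => η x * φ x) x
      = A.classical η x * φ x
      + ∑ i, (A.b i x * η x + ∑ j, A.a i j x * partialD j η x + ∑ j, A.a j i x * partialD j η x)
        * partialD i φ x
      + ∑ i, ∑ j, (A.a i j x * η x) * partialD j (partialD i φ) x := by
  have e : ∑ i, (∑ j, A.a j i x * partialD j η x) * partialD i φ x
      = ∑ i, ∑ j, A.a i j x * partialD i η x * partialD j φ x := by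
    simp_rw [Finset.sum_mul]
    exact Finset.sum_comm
  simp only [PDEOp.classical, partialD_partialD_mul hη hφ,
    partialD_mul (hη.differentiable two_ne_zero x) (hφ.differentiable two_ne_zero x)]
  simp only [add_mul, mul_add, Finset.sum_add_distrib]
  rw [e]
  simp only [Finset.sum_mul]
  have r1 : ∀ i, A.b i x * (η x * partialD i φ x) = A.b i x * η x * partialD i φ x := fun i => by ring
  have r2 : ∀ i, A.b i x * (partialD i η x * φ x) = A.b i x * partialD i η x * φ x := fun i => by ring
  have r3 : ∀ i j, A.a i j x * (η x * partialD j (partialD i φ) x)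
      = A.a i j x * η x * partialD j (partialD i φ) x := fun i j => by ring
  have r4 : ∀ i j, A.a i j x * (partialD j η x * partialD i φ x)
      = A.a i j x * partialD j η x * partialD i φ x := fun i j => by ring
  have r5 : ∀ i j, A.a i j x * (partialD i η x * partialD j φ x)
      = A.a i j x * partialD i η x * partialD j φ x := fun i j => by ring
  have r6 : ∀ i j, A.a i j x * (partialD j (partialD i η) x * φ x)
      = A.a i j x * partialD j (partialD i η) x * φ x := fun i j => by ring
  simp only [r1, r2, r3, r4, r5, r6]
  ring

/-- The residual of a stationary point is orthogonal to the image of `η g`, for test functions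
`g` on the whole space. -/
theorem integral_classical_aux_mul_eq_zero {Ω : Set (E d)} {μ : Measure (E d)} (hΩo : IsOpen Ω)
    (hΩ : Bornology.IsBounded Ω) (hμ : IsSamplingMeasure Ω μ) {η : E d → ℝ} (hη : IsAuxiliary Ω η)
    {A : PDEOp d} (hAm : A.IsMeasurable) {B : ℝ} (hB0 : 0 ≤ B) (ha : ∀ i j x, |A.a i j x| ≤ B)
    (hb : ∀ i x, |A.b i x| ≤ B) (hc : ∀ x, |A.c x| ≤ B) {σ : ℝ → ℝ} (hσ : IsCnb 4 σ)
    (hσc : ¬ ∃ s : ℝ, ∀ t, σ t = s)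
    {π : Measure (Param d)} (hπ : IsInitLaw π) {h : E d → ℝ} (hhm : Measurable h)
    (hh : Integrable h μ) (hs : ∀ᵐ y ∂μ, ∫ x, h x * kernelU A η σ π x y ∂μ = 0) {g : E d → ℝ}
    (hg : ContDiff ℝ ∞ g) (hgc : HasCompactSupport g) :
    ∫ x, h x * A.classical (fun x => η x * g x) x ∂μ = 0 := by
  have := hμ.finite
  have hη2 : ContDiff ℝ 2 η := hη.contDiff.of_le (by norm_num)
  have hμΩ : ∀ᵐ x ∂μ, x ∈ Ω := hμ.ac.ae_le (ae_restrict_mem hΩo.measurableSet)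
  have hηi : ∀ i, ContDiff ℝ 1 (partialD i η) := fun i => contDiff_partialD hη2 (by norm_num) i
  have int : ∀ {a ψ : E d → ℝ}, Measurable a → (∀ x, |a x| ≤ B) → Continuous ψ →
      Integrable (fun x => h x * (a x * ψ x)) μ := by
    intro a ψ am ab hψ
    obtain ⟨C, hC0, hC⟩ := exists_bound_on hΩ hψ
    refine hh.mul_bdd (c := B * C) (am.mul hψ.measurable).aestronglyMeasurable ?_
    filter_upwards [hμΩ] with x hx
    rw [norm_mul]
    exact mul_le_mul (ab x) (hC x hx) (norm_nonneg _) hB0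
  obtain ⟨R, hR⟩ := hΩ.exists_norm_le
  have h0 : Integrable (fun x => h x * A.classical η x) μ := by
    simp only [PDEOp.classical, mul_add, Finset.mul_sum]
    exact ((integrable_finsetSum _ fun i _ => integrable_finsetSum _ fun j _ =>
      int (hAm.1 i j) (ha i j) (continuous_partialD (hηi i) j)).add
      (integrable_finsetSum _ fun i _ => int (hAm.2.1 i) (hb i) (hηi i).continuous)).add
      (int hAm.2.2 hc hη2.continuous)
  have h1 : ∀ i, Integrable (fun x => h x * (A.b i x * η x + ∑ j, A.a i j x * partialD j η x
      + ∑ j, A.a j i x * partialD j η x)) μ := fun i => by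
    simp only [mul_add, Finset.mul_sum]
    exact ((int (hAm.2.1 i) (hb i) hη2.continuous).add (integrable_finsetSum _ fun j _ =>
      int (hAm.1 i j) (ha i j) (hηi j).continuous)).add (integrable_finsetSum _ fun j _ =>
      int (hAm.1 j i) (ha j i) (hηi j).continuous)
  have h2 : ∀ i j, Integrable (fun x => h x * (A.a i j x * η x)) μ := fun i j =>
    int (hAm.1 i j) (ha i j) hη2.continuous
  have hσ2 : ContDiff ℝ 2 σ := hσ.1.of_le (by norm_num)
  have key := integral_eq_zero_of_ridge (hμΩ.mono fun x hx => hR x hx) h0 h1 h2 hσ hσc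
    (fun w b => ?_) hg hgc
  · rw [← key]
    congr with x
    rw [A.classical_mul hη2 (contDiff_infty.1 hg 2), mul_add, mul_add, Finset.mul_sum,
      Finset.mul_sum]
    simp only [Finset.mul_sum, mul_assoc]
  · rw [← integral_classical_unit_eq_zero hΩo hΩ hμ hη hAm hB0 ha hb hc hσ hπ hhm hh hs w b]
    congr with x
    have hφ : ContDiff ℝ 2 fun x : E d => 1 * σ (inner ℝ w x + b) :=
      contDiff_const.mul (hσ2.comp ((contDiff_const.inner ℝ contDiff_id).add contDiff_const))
    have e := A.classical_mul hη2 hφ x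
    have hσ1 : ContDiff ℝ 1 (deriv σ) := (contDiff_succ_iff_deriv.1 hσ2).2.2
    simp only [partialD_ridge (hσ2.differentiable two_ne_zero),
      partialD_ridge (hσ1.differentiable one_ne_zero)] at e
    simp only [one_mul] at e
    rw [e, mul_add, mul_add, Finset.mul_sum, Finset.mul_sum]
    simp only [Finset.mul_sum, mul_assoc]

end DGM

/-! ### The chosen weak derivatives, and comparison of μ with Lebesgue measure. -/

namespace DGM
open Filter Topology
variable {d : ℕ}

section WeakDerivatives

variable {Ω : Set (E d)}

theorem setIntegral_mul_eq_of_tsupport {f φ : E d → ℝ} (h : tsupport φ ⊆ Ω) :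
    ∫ x in Ω, f x * φ x = ∫ x, f x * φ x :=
  setIntegral_eq_integral_of_forall_compl_eq_zero fun x hx => by
    rw [image_eq_zero_of_notMem_tsupport fun hx' => hx (h hx'), mul_zero]

theorem hasWeakPartial_iff (hΩ : IsOpen Ω) {i : Fin d} {f g : E d → ℝ} :
    HasWeakPartial Ω i f g ↔ WD Ω i f g := by
  have e : ∀ φ : E d → ℝ, tsupport φ ⊆ Ω → ((∫ x in Ω, f x * partialD i φ x
      = - ∫ x in Ω, g x * φ x) ↔ ∫ x, f x * partialD i φ x = - ∫ x, g x * φ x) := fun φ hφ => by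
    rw [setIntegral_mul_eq_of_tsupport hφ,
      setIntegral_mul_eq_of_tsupport ((tsupport_partialD_subset φ i).trans hφ)]
  refine ⟨fun h => WD.of_smooth hΩ h.1 h.2.1 fun φ h1 h2 h3 => (e φ h3).1 (h.2.2 φ ⟨h1, h2, h3⟩),
    fun h => ⟨h.locInt, h.locInt', fun φ hφ => (e φ hφ.2.2).2
      (h.ibp φ (contDiff_infty.1 hφ.1 1) hφ.2.1 hφ.2.2)⟩⟩

theorem WD.of_contDiff (V : Set (E d)) {φ : E d → ℝ} (hφ : ContDiff ℝ 1 φ) (i : Fin d) :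
    WD V i φ (partialD i φ) := by
  refine ⟨hφ.continuous.locallyIntegrable.locallyIntegrableOn _,
    (continuous_partialD hφ i).locallyIntegrable.locallyIntegrableOn _, fun ψ h1 h2 _ => ?_⟩
  have hc := h1.continuous
  have hi : ∀ {a b : E d → ℝ}, Continuous a → Continuous b → HasCompactSupport b →
      Integrable fun x => a x * b x := fun ha hb hbc =>
    (ha.mul hb).integrable_of_hasCompactSupport hbc.mul_left
  exact integral_mul_fderiv_eq_neg_fderiv_mul_of_integrable
    (hi (continuous_partialD hφ i) hc h2)
    (hi hφ.continuous (continuous_partialD h1 i) (hasCompactSupport_partialD h2 i))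
    (hi hφ.continuous hc h2) (fun x _ => hφ.differentiable one_ne_zero x)
    (fun x _ => h1.differentiable one_ne_zero x)

/-- The fundamental lemma of the calculus of variations. It makes the arbitrary choice in
`weakPartial` harmless: any known weak derivative agrees with it almost everywhere. -/
theorem WD.ae_eq (hΩ : IsOpen Ω) {i : Fin d} {f g g' : E d → ℝ} (h : WD Ω i f g)
    (h' : WD Ω i f g') : ∀ᵐ x ∂(volume.restrict Ω), g x = g' x := by
  rw [ae_restrict_iff' hΩ.measurableSet]
  have := hΩ.ae_eq_zero_of_integral_contDiff_smul_eq_zero (h.locInt'.sub h'.locInt')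
    fun φ h1 h2 h3 => ?_
  · filter_upwards [this] with x hx hxΩ
    exact sub_eq_zero.1 (hx hxΩ)
  · have k1 := h.ibp φ (contDiff_infty.1 h1 1) h2 h3
    have k2 := h'.ibp φ (contDiff_infty.1 h1 1) h2 h3
    have j1 := integrable_mul_of_tsupport_subset h.locInt' h1.continuous h2 h3
    have j2 := integrable_mul_of_tsupport_subset h'.locInt' h1.continuous h2 h3
    have : ∫ x, (g x * φ x - g' x * φ x) = 0 := by
      rw [integral_sub j1 j2]
      linarith
    rw [← this]
    congr with x
    simp only [Pi.sub_apply, smul_eq_mul]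
    ring

theorem WD.weakPartial (hΩ : IsOpen Ω) {i : Fin d} {f g : E d → ℝ} (h : WD Ω i f g) :
    WD Ω i f (weakPartial Ω i f) := by
  have hex : ∃ g, HasWeakPartial Ω i f g := ⟨g, (hasWeakPartial_iff hΩ).2 h⟩
  rw [DGM.weakPartial, dif_pos hex]
  exact (hasWeakPartial_iff hΩ).1 hex.choose_spec

theorem WD.weakPartial_ae_eq (hΩ : IsOpen Ω) {i : Fin d} {f g : E d → ℝ} (h : WD Ω i f g) :
    ∀ᵐ x ∂(volume.restrict Ω), DGM.weakPartial Ω i f x = g x :=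
  (h.weakPartial hΩ).ae_eq hΩ h

/-- `fi` and `fij` are the weak derivatives of first and second order of `f`. -/
structure WeakJet (Ω : Set (E d)) (f : E d → ℝ) (fi : Fin d → E d → ℝ)
    (fij : Fin d → Fin d → E d → ℝ) : Prop where
  fst : ∀ i, WD Ω i f (fi i)
  snd : ∀ i j, WD Ω j (fi i) (fij i j)

theorem WeakJet.of_contDiff (Ω : Set (E d)) {φ : E d → ℝ} (hφ : ContDiff ℝ 2 φ) :
    WeakJet Ω φ (fun i => partialD i φ) fun i j => partialD j (partialD i φ) :=
  ⟨fun i => WD.of_contDiff Ω (hφ.of_le (by norm_num)) i,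
    fun i j => WD.of_contDiff Ω (contDiff_partialD hφ (by norm_num) i) j⟩

theorem WeakJet.of_memH2 (hΩ : IsOpen Ω) {μ : Measure (E d)} {f : E d → ℝ} (h : MemH2 Ω μ f) :
    WeakJet Ω f (fun i => weakPartial Ω i f) fun i j => weakPartial Ω j (weakPartial Ω i f) :=
  ⟨fun i => (hasWeakPartial_iff hΩ).1 (h.1.2 i).1, fun i j => (hasWeakPartial_iff hΩ).1 (h.2 i j).1⟩

variable {f f' : E d → ℝ} {fi fi' : Fin d → E d → ℝ} {fij fij' : Fin d → Fin d → E d → ℝ}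

theorem WeakJet.add (h : WeakJet Ω f fi fij) (h' : WeakJet Ω f' fi' fij') :
    WeakJet Ω (fun x => f x + f' x) (fun i x => fi i x + fi' i x)
      fun i j x => fij i j x + fij' i j x :=
  ⟨fun i => (h.fst i).add (h'.fst i), fun i j => (h.snd i j).add (h'.snd i j)⟩

theorem WeakJet.ae_eq_fst (hΩ : IsOpen Ω) (h : WeakJet Ω f fi fij) :
    ∀ᵐ x ∂(volume.restrict Ω), ∀ i, weakPartial Ω i f x = fi i x :=
  ae_all_iff.2 fun i => (h.fst i).weakPartial_ae_eq hΩ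

/-- Second derivatives in `MemH2` are those of the chosen function `weakPartial Ω i f`, which equals
`fi i` only almost everywhere. -/
theorem WeakJet.wd_snd (hΩ : IsOpen Ω) (h : WeakJet Ω f fi fij) (i j : Fin d) :
    WD Ω j (weakPartial Ω i f) (fij i j) :=
  (h.snd i j).congr_ae hΩ.measurableSet
    (((h.fst i).weakPartial_ae_eq hΩ).mono fun _ hx => hx.symm) (Eventually.of_forall fun _ => rfl)

theorem WeakJet.ae_eq_snd (hΩ : IsOpen Ω) (h : WeakJet Ω f fi fij) :
    ∀ᵐ x ∂(volume.restrict Ω), ∀ i j, weakPartial Ω j (weakPartial Ω i f) x = fij i j x :=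
  ae_all_iff.2 fun i => ae_all_iff.2 fun j => (h.wd_snd hΩ i j).weakPartial_ae_eq hΩ

theorem WeakJet.memH2 (hΩ : IsOpen Ω) (h : WeakJet Ω f fi fij) {μ : Measure (E d)}
    (hμ : μ ≪ volume.restrict Ω) (h0 : MemLp f 2 μ) (h1 : ∀ i, MemLp (fi i) 2 μ)
    (h2 : ∀ i j, MemLp (fij i j) 2 μ) : MemH2 Ω μ f := by
  have e1 : ∀ᵐ x ∂μ, ∀ i, weakPartial Ω i f x = fi i x := hμ.ae_le (h.ae_eq_fst hΩ)
  have e2 : ∀ᵐ x ∂μ, ∀ i j, weakPartial Ω j (weakPartial Ω i f) x = fij i j x :=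
    hμ.ae_le (h.ae_eq_snd hΩ)
  refine ⟨⟨h0, fun i => ⟨(hasWeakPartial_iff hΩ).2 ((h.fst i).weakPartial hΩ), ?_⟩⟩,
    fun i j => ⟨(hasWeakPartial_iff hΩ).2 ((h.wd_snd hΩ i j).weakPartial hΩ), ?_⟩⟩
  · exact (h1 i).ae_eq (e1.mono fun x hx => (hx i).symm)
  · exact (h2 i j).ae_eq (e2.mono fun x hx => (hx i j).symm)

theorem WeakJet.weak_ae_eq (hΩ : IsOpen Ω) (h : WeakJet Ω f fi fij) (A : PDEOp d) :
    ∀ᵐ x ∂(volume.restrict Ω), A.weak Ω f x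
      = (∑ i, ∑ j, A.a i j x * fij i j x) + (∑ i, A.b i x * fi i x) + A.c x * f x := by
  filter_upwards [h.ae_eq_fst hΩ, h.ae_eq_snd hΩ] with x h1 h2
  simp only [PDEOp.weak, h1, h2]

end WeakDerivatives

section SamplingMeasure

variable {Ω : Set (E d)} {μ : Measure (E d)}

/-- The logarithmic bound K puts the density between e^(−K) and e^K, so L²(μ) and L²(Ω) have
equivalent norms. -/
theorem IsSamplingMeasure.exists_le (hμ : IsSamplingMeasure Ω μ) :
    ∃ C : ℝ≥0∞, C ≠ ⊤ ∧ μ ≤ C • volume.restrict Ω ∧ volume.restrict Ω ≤ C • μ := by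
  have := hμ.finite
  obtain ⟨K, hK⟩ := hμ.log_bdd
  set ν := volume.restrict Ω with hν
  have hpos : ∀ᵐ x ∂ν, 0 < μ.rnDeriv ν x := hμ.ac'.ae_le (Measure.rnDeriv_pos hμ.ac)
  have hwd : ν.withDensity (μ.rnDeriv ν) = μ := Measure.withDensity_rnDeriv_eq μ ν hμ.ac
  have hb : ∀ᵐ x ∂ν, ENNReal.ofReal (Real.exp (-K)) ≤ μ.rnDeriv ν x ∧
      μ.rnDeriv ν x ≤ ENNReal.ofReal (Real.exp K) := by
    -- Where the density is 0 or infinite, `Real.log` of its real part is 0 and the bound says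
    -- nothing; equivalence with Lebesgue measure and finiteness exclude these cases almost
    -- everywhere.
    filter_upwards [hK, hpos, Measure.rnDeriv_ne_top μ ν] with x h1 h2 h3
    have hp : 0 < (μ.rnDeriv ν x).toReal := ENNReal.toReal_pos h2.ne' h3
    rw [abs_le, Real.le_log_iff_exp_le hp, Real.log_le_iff_le_exp hp] at h1
    rw [← ENNReal.ofReal_toReal h3]
    exact ⟨ENNReal.ofReal_le_ofReal h1.1, ENNReal.ofReal_le_ofReal h1.2⟩
  refine ⟨ENNReal.ofReal (Real.exp K), ENNReal.ofReal_ne_top, ?_, ?_⟩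
  · rw [← withDensity_const]
    exact hwd.symm.trans_le (withDensity_mono (hb.mono fun x hx => hx.2))
  · have h1 : ENNReal.ofReal (Real.exp (-K)) • ν ≤ μ := by
      rw [← withDensity_const]
      exact (withDensity_mono (hb.mono fun x hx => hx.1)).trans_eq hwd
    have h2 : ENNReal.ofReal (Real.exp K) * ENNReal.ofReal (Real.exp (-K)) = 1 := by
      rw [← ENNReal.ofReal_mul (Real.exp_pos K).le, ← Real.exp_add]
      simp
    calc ν = ENNReal.ofReal (Real.exp K) • (ENNReal.ofReal (Real.exp (-K)) • ν) := by
          rw [smul_smul, h2, one_smul]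
      _ ≤ _ := by gcongr

theorem memLp_two_of_bound [IsFiniteMeasure μ] {f : E d → ℝ} (hf : Measurable f) {C : ℝ}
    (h : ∀ᵐ x ∂μ, |f x| ≤ C) : MemLp f 2 μ :=
  MemLp.of_bound hf.aestronglyMeasurable C h

theorem MemH2.of_contDiff (hΩ : IsOpen Ω) (hΩb : Bornology.IsBounded Ω)
    (hμ : IsSamplingMeasure Ω μ) {φ : E d → ℝ} (hφ : ContDiff ℝ 2 φ) : MemH2 Ω μ φ := by
  have := hμ.finite
  have hμΩ : ∀ᵐ x ∂μ, x ∈ Ω := hμ.ac.ae_le (ae_restrict_mem hΩ.measurableSet)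
  have key : ∀ {f : E d → ℝ}, Continuous f → MemLp f 2 μ := fun hf => by
    obtain ⟨C, -, hC⟩ := exists_bound_on hΩb hf
    exact memLp_two_of_bound hf.measurable (hμΩ.mono hC)
  exact (WeakJet.of_contDiff Ω hφ).memH2 hΩ hμ.ac (key hφ.continuous)
    (fun i => key (continuous_partialD (hφ.of_le (by norm_num)) i))
    (fun i j => key (continuous_partialD (contDiff_partialD hφ (by norm_num) i) j))

end SamplingMeasure

end DGM

/-! ### Bounded coefficients from the Lipschitz condition, and extension by zero. -/

namespace DGM
open Filter Topology
variable {d : ℕ}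

section Coefficients

variable {Ω : Set (E d)} {μ : Measure (E d)} {A : PDEOp d}

theorem partialD_const (c : ℝ) (i : Fin d) : partialD i (fun _ : E d => c) = fun _ => 0 := by
  funext x
  simp [partialD]

theorem partialD_coord (i k : Fin d) :
    partialD k (fun x : E d => x i) = fun _ => if i = k then 1 else 0 := by
  funext x
  have h : HasFDerivAt (fun x : E d => x i) (EuclideanSpace.proj i : E d →L[ℝ] ℝ) x :=
    (EuclideanSpace.proj i : E d →L[ℝ] ℝ).hasFDerivAt
  simp [partialD, h.fderiv]

theorem PDEOp.weak_contDiff_ae_eq (hΩ : IsOpen Ω) {φ : E d → ℝ} (hφ : ContDiff ℝ 2 φ) :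
    ∀ᵐ x ∂(volume.restrict Ω), A.weak Ω φ x = A.classical φ x :=
  (WeakJet.of_contDiff Ω hφ).weak_ae_eq hΩ A

/-- The Lipschitz condition for φ against 0, using that φ and its derivatives up to order two are
bounded on the bounded set Ω. -/
theorem PDEOp.IsLipschitz.classical_bdd (hΩ : IsOpen Ω) (hΩb : Bornology.IsBounded Ω)
    (hμ : IsSamplingMeasure Ω μ) (hA : A.IsLipschitz Ω μ) {φ : E d → ℝ} (hφ : ContDiff ℝ 2 φ) :
    ∃ C, ∀ᵐ x ∂(volume.restrict Ω), |A.classical φ x| ≤ C := by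
  obtain ⟨k, hk, h⟩ := hA
  have h0 : ContDiff ℝ 2 fun _ : E d => (0 : ℝ) := contDiff_const
  have z := h φ _ (MemH2.of_contDiff hΩ hΩb hμ hφ) (MemH2.of_contDiff hΩ hΩb hμ h0)
  have hφi : ∀ i, ContDiff ℝ 1 (partialD i φ) := fun i => contDiff_partialD hφ (by norm_num) i
  obtain ⟨C0, -, hC0⟩ := exists_bound_on hΩb hφ.continuous
  choose C1 _ hC1 using fun i => exists_bound_on hΩb (hφi i).continuous
  choose C2 _ hC2 using fun i j => exists_bound_on hΩb (continuous_partialD (hφi i) j)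
  refine ⟨k * (C0 + (∑ i, C1 i) + ∑ i, ∑ j, C2 i j), ?_⟩
  filter_upwards [z, A.weak_contDiff_ae_eq hΩ hφ, A.weak_contDiff_ae_eq hΩ h0,
    (WeakJet.of_contDiff Ω hφ).ae_eq_fst hΩ, (WeakJet.of_contDiff Ω hφ).ae_eq_snd hΩ,
    (WeakJet.of_contDiff Ω h0).ae_eq_fst hΩ, (WeakJet.of_contDiff Ω h0).ae_eq_snd hΩ,
    ae_restrict_mem hΩ.measurableSet] with x hx e e' f1 f2 g1 g2 hxΩ
  have e0 : A.classical (fun _ : E d => (0 : ℝ)) x = 0 := by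
    simp [PDEOp.classical, partialD_const]
  rw [e, e', e0, sub_zero] at hx
  simp only [f1, f2, g1, g2, partialD_const, sub_zero] at hx
  refine hx.trans (mul_le_mul_of_nonneg_left ?_ hk.le)
  gcongr with i _ i _ j _
  · exact hC0 x hxΩ
  · exact hC1 i x hxΩ
  · exact hC2 i j x hxΩ

/-- On functions of class `C²` a Lipschitz operator agrees almost everywhere with an operator with
bounded measurable coefficients. -/
theorem exists_bounded_coefficients (hΩ : IsOpen Ω) (hΩb : Bornology.IsBounded Ω)
    (hμ : IsSamplingMeasure Ω μ) (hAm : A.IsMeasurable) (hA : A.IsLipschitz Ω μ) :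
    ∃ (A' : PDEOp d) (B : ℝ), A'.IsMeasurable ∧ 0 ≤ B ∧ (∀ i j x, |A'.a i j x| ≤ B) ∧
      (∀ i x, |A'.b i x| ≤ B) ∧ (∀ x, |A'.c x| ≤ B) ∧
      ∀ᵐ x ∂(volume.restrict Ω), ∀ φ : E d → ℝ, ContDiff ℝ 2 φ →
        A.classical φ x = A'.classical φ x := by
  obtain ⟨R, hR⟩ := hΩb.exists_norm_le
  have ci : ∀ i, ContDiff ℝ 2 fun x : E d => x i := fun i => by fun_prop
  -- Testing on 1, x_i and x_i x_j isolates in turn c, b_i and a_ij + a_ji. Only the symmetric part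
  -- of `a` can be recovered in this way.
  obtain ⟨C0, h0⟩ := hA.classical_bdd hΩ hΩb hμ (φ := fun _ => 1) contDiff_const
  choose C1 h1 using fun i => hA.classical_bdd hΩ hΩb hμ (ci i)
  choose C2 h2 using fun i j => hA.classical_bdd hΩ hΩb hμ ((ci i).mul (ci j))
  obtain ⟨B, hB⟩ : ∃ B : ℝ, B = |C0| + (∑ i, (|C1 i| + |C0| * |R|))
    + ∑ i, ∑ j, (|C2 i j| + |C1 i| * |R| + (|C1 j| + |C0| * |R|) * |R|) := ⟨_, rfl⟩
  have n1 : ∀ i, 0 ≤ |C1 i| + |C0| * |R| := fun i => by positivity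
  have n2 : ∀ i j, 0 ≤ |C2 i j| + |C1 i| * |R| + (|C1 j| + |C0| * |R|) * |R| := fun i j => by
    positivity
  have s1 := Finset.sum_nonneg fun i (_ : i ∈ Finset.univ) => n1 i
  have s2 := Finset.sum_nonneg fun i (_ : i ∈ Finset.univ) =>
    Finset.sum_nonneg fun j (_ : j ∈ Finset.univ) => n2 i j
  have B0 : |C0| ≤ B := by linarith
  have B1 : ∀ i, |C1 i| + |C0| * |R| ≤ B := fun i => by
    have := Finset.single_le_sum (fun i _ => n1 i) (Finset.mem_univ i)
    linarith [abs_nonneg C0]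
  have B2 : ∀ i j, |C2 i j| + |C1 i| * |R| + (|C1 j| + |C0| * |R|) * |R| ≤ B := fun i j => by
    have t1 := Finset.single_le_sum (fun j _ => n2 i j) (Finset.mem_univ j)
    have t2 := Finset.single_le_sum (f := fun i => ∑ j, (|C2 i j| + |C1 i| * |R|
      + (|C1 j| + |C0| * |R|) * |R|)) (fun i _ => Finset.sum_nonneg fun j _ => n2 i j)
      (Finset.mem_univ i)
    linarith [abs_nonneg C0]
  have hB0 : 0 ≤ B := (abs_nonneg _).trans B0
  -- The new coefficients are cut off to zero outside S, so they are bounded everywhere; S has full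
  -- measure in Ω.
  let S : Set (E d) := {x | |A.c x| ≤ B} ∩ ((⋂ i, {x | |A.b i x| ≤ B}) ∩
    ⋂ i, ⋂ j, {x | |(A.a i j x + A.a j i x) / 2| ≤ B})
  have hS : MeasurableSet S := by
    have m : ∀ {f : E d → ℝ}, Measurable f → MeasurableSet {x | |f x| ≤ B} := fun hf =>
      measurableSet_le hf.norm measurable_const
    exact (m hAm.2.2).inter ((MeasurableSet.iInter fun i => m (hAm.2.1 i)).inter
      (MeasurableSet.iInter fun i => MeasurableSet.iInter fun j =>
        m (((hAm.1 i j).add (hAm.1 j i)).div_const 2)))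
  have hSae : ∀ᵐ x ∂(volume.restrict Ω), x ∈ S := by
    filter_upwards [h0, ae_all_iff.2 h1, ae_all_iff.2 fun i => ae_all_iff.2 fun j => h2 i j,
      ae_restrict_mem hΩ.measurableSet] with x k0 k1 k2 hxΩ
    have hxi : ∀ i, |x i| ≤ |R| := fun i =>
      (abs_apply_le_norm x i).trans ((hR x hxΩ).trans (le_abs_self R))
    have e0 : A.classical (fun _ => 1) x = A.c x := by simp [PDEOp.classical, partialD_const]
    have e1 : ∀ i, A.classical (fun x => x i) x = A.b i x + A.c x * x i := fun i => by
      simp [PDEOp.classical, partialD_const, partialD_coord]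
    have e2 : ∀ i j, A.classical (fun x => x i * x j) x
        = (A.b i x + A.c x * x i) * x j + (A.b j x * x i + A.a j i x + A.a i j x) := fun i j => by
      rw [A.classical_mul (ci i) (ci j), e1]
      simp [partialD_const, partialD_coord]
    rw [e0] at k0
    simp only [e1] at k1
    have c0 : |A.c x| ≤ |C0| := k0.trans (le_abs_self _)
    have c1 : ∀ i, |A.b i x| ≤ |C1 i| + |C0| * |R| := fun i => by
      have t1 : |A.c x * x i| ≤ |C0| * |R| := by
        rw [abs_mul]
        exact mul_le_mul c0 (hxi i) (abs_nonneg _) (abs_nonneg _)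
      have t2 := abs_sub (A.b i x + A.c x * x i) (A.c x * x i)
      rw [add_sub_cancel_right] at t2
      linarith [k1 i, le_abs_self (C1 i)]
    refine ⟨c0.trans B0, mem_iInter.2 fun i => (c1 i).trans (B1 i), mem_iInter₂.2 fun i j => ?_⟩
    have t0 := k2 i j
    rw [e2] at t0
    have t1 : |(A.b i x + A.c x * x i) * x j| ≤ |C1 i| * |R| := by
      rw [abs_mul]
      exact mul_le_mul ((k1 i).trans (le_abs_self _)) (hxi j) (abs_nonneg _) (abs_nonneg _)
    have t2 : |A.b j x * x i| ≤ (|C1 j| + |C0| * |R|) * |R| := by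
      rw [abs_mul]
      exact mul_le_mul (c1 j) (hxi i) (abs_nonneg _) (n1 j)
    have t3 := B2 i j
    have t4 := le_abs_self (C2 i j)
    change |(A.a i j x + A.a j i x) / 2| ≤ B
    rw [abs_le] at t0 t1 t2 ⊢
    constructor <;> linarith [t0.1, t0.2, t1.1, t1.2, t2.1, t2.2]
  have ind : ∀ {f : E d → ℝ}, (∀ x ∈ S, |f x| ≤ B) → ∀ x, |S.indicator f x| ≤ B := by
    intro f hf x
    by_cases hx : x ∈ S
    · rw [indicator_of_mem hx]; exact hf x hx
    · rw [indicator_of_notMem hx, abs_zero]; exact hB0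
  refine ⟨⟨fun i j => S.indicator fun x => (A.a i j x + A.a j i x) / 2,
    fun i => S.indicator (A.b i), S.indicator A.c⟩, B,
    ⟨fun i j => (((hAm.1 i j).add (hAm.1 j i)).div_const 2).indicator hS,
      fun i => (hAm.2.1 i).indicator hS, hAm.2.2.indicator hS⟩, hB0,
    fun i j => ind fun x hx => mem_iInter₂.1 hx.2.2 i j,
    fun i => ind fun x hx => mem_iInter.1 hx.2.1 i, ind fun x hx => hx.1, ?_⟩
  filter_upwards [hSae] with x hx φ hφ
  simp only [PDEOp.classical, indicator_of_mem hx]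
  congr 2
  -- Second derivatives of a C² function are symmetric, so symmetrizing the leading coefficients
  -- does not change the operator.
  have e : ∑ i, ∑ j, A.a j i x * partialD j (partialD i φ) x
      = ∑ i, ∑ j, A.a i j x * partialD j (partialD i φ) x := by
    rw [Finset.sum_comm]
    simp_rw [partialD_comm hφ]
  have e' : ∑ i, ∑ j, (A.a i j x + A.a j i x) / 2 * partialD j (partialD i φ) x
      = (∑ i, ∑ j, A.a i j x * partialD j (partialD i φ) x
        + ∑ i, ∑ j, A.a j i x * partialD j (partialD i φ) x) / 2 := by
    simp only [← Finset.sum_add_distrib, Finset.sum_div]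
    exact Finset.sum_congr rfl fun i _ => Finset.sum_congr rfl fun j _ => by ring
  rw [e', e]
  ring

end Coefficients

section Representatives

variable {Ω : Set (E d)}

theorem exists_l2s (hΩ : MeasurableSet Ω) {f : E d → ℝ} (hf : MemLp f 2 (volume.restrict Ω)) :
    ∃ F, L2S Ω F ∧ ∀ᵐ x ∂(volume.restrict Ω), f x = F x := by
  refine ⟨Ω.indicator (hf.1.mk f), ⟨hf.1.stronglyMeasurable_mk.measurable.indicator hΩ, ?_,
    fun x hx => indicator_of_notMem hx _⟩, ?_⟩
  · exact (memLp_indicator_iff_restrict hΩ).2 (hf.ae_eq hf.1.ae_eq_mk)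
  · filter_upwards [hf.1.ae_eq_mk, ae_restrict_mem hΩ] with x hx hxΩ
    rw [indicator_of_mem hxΩ, hx]

theorem L2S.integral_mul_eq {F f ψ : E d → ℝ} (hF : L2S Ω F)
    (hf : ∀ᵐ x ∂(volume.restrict Ω), f x = F x) :
    ∫ x, F x * ψ x = ∫ x in Ω, ψ x * f x := by
  rw [← setIntegral_eq_integral_of_forall_compl_eq_zero
    (fun x hx => by rw [hF.zero x hx, zero_mul] : ∀ x, x ∉ Ω → F x * ψ x = 0)]
  refine integral_congr_ae ?_
  filter_upwards [hf] with x hx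
  rw [hx, mul_comm]

/-- The extension by zero of a function in `H¹₀` is weakly differentiable on the whole space. -/
theorem MemH10.wd_univ (hΩ : IsOpen Ω) {μ : Measure (E d)} {C : ℝ≥0∞} (hC : C ≠ ⊤)
    (hμ : volume.restrict Ω ≤ C • μ) {f F Fk : E d → ℝ} (h : MemH10 Ω μ f) (k : Fin d)
    (hF : L2S Ω F) (hFk : L2S Ω Fk) (e : ∀ᵐ x ∂(volume.restrict Ω), f x = F x)
    (ek : ∀ᵐ x ∂(volume.restrict Ω), weakPartial Ω k f x = Fk x) : WD univ k F Fk := by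
  have hm := hΩ.measurableSet
  refine WD.of_smooth isOpen_univ (hF.locallyIntegrable.locallyIntegrableOn _)
    (hFk.locallyIntegrable.locallyIntegrableOn _) fun ψ h1 h2 _ => ?_
  -- Test functions in Ω approximating f in H¹ satisfy the integration by parts against any ψ on
  -- ℝ^d, without boundary term; the identity survives the L² limit.
  choose φ hφ t0 t1 using fun n : ℕ => h.2 (ENNReal.ofReal (1 / ((n : ℝ) + 1)))
    (ENNReal.ofReal_pos.2 (by positivity))
  have hc1 : ∀ n, ContDiff ℝ 1 (φ n) := fun n => contDiff_infty.1 (hφ n).1 1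
  have lim0 : Tendsto (fun n : ℕ => ENNReal.ofReal (1 / ((n : ℝ) + 1))) atTop (𝓝 0) := by
    have := ENNReal.tendsto_ofReal (tendsto_one_div_add_atTop_nhds_zero_nat (𝕜 := ℝ))
    simpa using this
  have conv : ∀ {a : E d → ℝ} {an : ℕ → E d → ℝ},
      (∀ n, eLpNorm (a - an n) 2 μ < ENNReal.ofReal (1 / ((n : ℝ) + 1))) →
      Tendsto (fun n => ∫⁻ x, ‖an n x - a x‖ₑ ^ 2 ∂(volume.restrict Ω)) atTop (𝓝 0) := by
    intro a an hn
    refine tendsto_lintegral_sq_of_eLpNorm (f := fun n x => an n x - a x) ?_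
    have := ENNReal.Tendsto.const_mul (a := C ^ (1 / (2 : ℝ≥0∞)).toReal) lim0
      (Or.inr (by simp [hC]))
    rw [mul_zero] at this
    refine tendsto_of_tendsto_of_tendsto_of_le_of_le tendsto_const_nhds this (fun _ => zero_le)
      fun n => ?_
    refine (eLpNorm_le_of_measure_le_smul hμ).trans ?_
    rw [smul_eq_mul]
    refine mul_le_mul_right ?_ _
    have : (fun x => an n x - a x) = -(a - an n) := by
      funext x
      simp
    rw [this, eLpNorm_neg]
    exact (hn n).le
  have L : ∀ {a : E d → ℝ} {ρ : E d → ℝ}, Continuous ρ → HasCompactSupport ρ →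
      MemLp ρ 2 (volume.restrict Ω) := fun hρ hρc =>
    (hρ.memLp_of_hasCompactSupport hρc).restrict _
  have mf : MemLp f 2 (volume.restrict Ω) := (hF.memLp.restrict Ω).ae_eq (e.mono fun x hx => hx.symm)
  have mfk : MemLp (weakPartial Ω k f) 2 (volume.restrict Ω) :=
    (hFk.memLp.restrict Ω).ae_eq (ek.mono fun x hx => hx.symm)
  have l1 := tendsto_integral_mul_of_lintegral
    (L (a := f) (continuous_partialD (contDiff_infty.1 h1 1) k) (hasCompactSupport_partialD h2 k)) mf
    (fun n => (hc1 n).continuous.aestronglyMeasurable) (conv t0)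
  have l2 := tendsto_integral_mul_of_lintegral (L (a := f) h1.continuous h2) mfk
    (fun n => (continuous_partialD (hc1 n) k).aestronglyMeasurable) (conv fun n => t1 n k)
  rw [hF.integral_mul_eq e, hFk.integral_mul_eq ek]
  refine tendsto_nhds_unique l1 (l2.neg.congr fun n => ?_)
  have ibp := (WD.of_contDiff univ (contDiff_infty.1 h1 1) k).ibp (φ n) (hc1 n) (hφ n).2.1
    (subset_univ _)
  rw [setIntegral_mul_eq_of_tsupport (hφ n).2.2, setIntegral_mul_eq_of_tsupport
    ((tsupport_partialD_subset _ k).trans (hφ n).2.2), ibp, neg_neg]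

end Representatives

end DGM

/-! ### Conclusion: the residual is orthogonal to itself. -/

namespace DGM
open Filter Topology
variable {d : ℕ}

/-- Taken from the Lipschitz bound rather than from the coefficients, whose antisymmetric
second-order part is not controlled. -/
theorem memLp_weak_sub {Ω : Set (E d)} {μ : Measure (E d)} (hμ : μ ≪ volume.restrict Ω)
    {A : PDEOp d} (hAm : A.IsMeasurable) (hA : A.IsLipschitz Ω μ) {f f' : E d → ℝ}
    (hf : MemH2 Ω μ f) (hf' : MemH2 Ω μ f') :
    MemLp (fun x => A.weak Ω f x - A.weak Ω f' x) 2 μ := by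
  obtain ⟨k, hk, h⟩ := hA
  have m : ∀ {f : E d → ℝ}, MemH2 Ω μ f → AEStronglyMeasurable (A.weak Ω f) μ := fun hf =>
    (((Finset.aestronglyMeasurable_fun_sum _ fun i _ => Finset.aestronglyMeasurable_fun_sum _
      fun j _ => (hAm.1 i j).aestronglyMeasurable.mul (hf.2 i j).2.1)).add
      (Finset.aestronglyMeasurable_fun_sum _ fun i _ =>
        (hAm.2.1 i).aestronglyMeasurable.mul (hf.1.2 i).2.1)).add
      (hAm.2.2.aestronglyMeasurable.mul hf.1.1.1)
  have hb : MemLp (fun x => k * (|f x - f' x| + (∑ i, |weakPartial Ω i f x - weakPartial Ω i f' x|)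
        + ∑ i, ∑ j, |weakPartial Ω j (weakPartial Ω i f) x
            - weakPartial Ω j (weakPartial Ω i f') x|)) 2 μ :=
    (((hf.1.1.sub hf'.1.1).norm.add (memLp_finsetSum _ fun i _ =>
      ((hf.1.2 i).2.sub (hf'.1.2 i).2).norm)).add (memLp_finsetSum _ fun i _ =>
      memLp_finsetSum _ fun j _ => ((hf.2 i j).2.sub (hf'.2 i j).2).norm)).const_mul k
  refine hb.mono ((m hf).sub (m hf')) ?_
  filter_upwards [hμ.ae_le (h f f' hf hf')] with x hx
  exact hx.trans (le_abs_self _)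

/-- A function in `H²₍₀₎` and its weak derivatives have square integrable representatives vanishing
outside `Ω`, which form a weakly differentiable function on the whole space. -/
theorem MemH20.exists_representatives {Ω : Set (E d)} (hΩ : IsOpen Ω) {μ : Measure (E d)} {C : ℝ≥0∞}
    (hC : C ≠ ⊤) (hνμ : volume.restrict Ω ≤ C • μ) {f : E d → ℝ} (hf : MemH20 Ω μ f) :
    ∃ (F : E d → ℝ) (Fi : Fin d → E d → ℝ) (Fij : Fin d → Fin d → E d → ℝ), H2Data Ω F Fi Fij ∧
      (∀ k, WD univ k F (Fi k)) ∧ (∀ᵐ x ∂(volume.restrict Ω), f x = F x) ∧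
      (∀ᵐ x ∂(volume.restrict Ω), ∀ i, weakPartial Ω i f x = Fi i x) ∧
      ∀ᵐ x ∂(volume.restrict Ω), ∀ i j, weakPartial Ω j (weakPartial Ω i f) x = Fij i j x := by
  have hm := hΩ.measurableSet
  have L : ∀ {f : E d → ℝ}, MemLp f 2 μ → MemLp f 2 (volume.restrict Ω) := fun hf =>
    hf.of_measure_le_smul hC hνμ
  obtain ⟨F, hF, e0⟩ := exists_l2s hm (L hf.1.1.1)
  choose Fi hFi e1 using fun i => exists_l2s hm (L (hf.1.1.2 i).2)
  choose Fij hFij e2 using fun i j => exists_l2s hm (L (hf.1.2 i j).2)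
  have jet := WeakJet.of_memH2 hΩ hf.1
  exact ⟨F, Fi, Fij, ⟨hF, hFi, hFij, fun i => (jet.fst i).congr_ae hm e0 (e1 i),
    fun i j => (jet.snd i j).congr_ae hm (e1 i) (e2 i j)⟩,
    fun k => hf.2.wd_univ hΩ hC hνμ k hF (hFi k) e0 (e1 k), e0, ae_all_iff.2 e1,
    ae_all_iff.2 fun i => ae_all_iff.2 (e2 i)⟩

theorem MemH2.add_contDiff {Ω : Set (E d)} (hΩ : IsOpen Ω) (hΩb : Bornology.IsBounded Ω)
    {μ : Measure (E d)} (hμ : IsSamplingMeasure Ω μ) {u v : E d → ℝ} (hu : MemH2 Ω μ u)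
    (hv : ContDiff ℝ 2 v) : MemH2 Ω μ fun x => u x + v x := by
  have hvH := MemH2.of_contDiff hΩ hΩb hμ hv
  have k1 : ∀ᵐ x ∂μ, ∀ i, weakPartial Ω i v x = partialD i v x :=
    hμ.ac.ae_le ((WeakJet.of_contDiff Ω hv).ae_eq_fst hΩ)
  have k2 : ∀ᵐ x ∂μ, ∀ i j, weakPartial Ω j (weakPartial Ω i v) x = partialD j (partialD i v) x :=
    hμ.ac.ae_le ((WeakJet.of_contDiff Ω hv).ae_eq_snd hΩ)
  exact ((WeakJet.of_memH2 hΩ hu).add (WeakJet.of_contDiff Ω hv)).memH2 hΩ hμ.ac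
    (hu.1.1.add hvH.1.1)
    (fun i => (hu.1.2 i).2.add ((hvH.1.2 i).2.ae_eq (k1.mono fun x hx => hx i)))
    fun i j => (hu.2 i j).2.add ((hvH.2 i j).2.ae_eq (k2.mono fun x hx => hx i j))

/-- The Lipschitz condition, for the distance between the difference of two Sobolev functions and a
function of class `C²`. -/
theorem abs_classical_sub_weak_sub_le {Ω : Set (E d)} (hΩ : IsOpen Ω)
    (hΩb : Bornology.IsBounded Ω) {μ : Measure (E d)} (hμ : IsSamplingMeasure Ω μ) {A : PDEOp d}
    {k : ℝ} (lip : ∀ f₁ f₂ : E d → ℝ, MemH2 Ω μ f₁ → MemH2 Ω μ f₂ →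
      ∀ᵐ x ∂(volume.restrict Ω), |A.weak Ω f₁ x - A.weak Ω f₂ x| ≤
        k * (|f₁ x - f₂ x| + (∑ i, |weakPartial Ω i f₁ x - weakPartial Ω i f₂ x|)
          + ∑ i, ∑ j, |weakPartial Ω j (weakPartial Ω i f₁) x
              - weakPartial Ω j (weakPartial Ω i f₂) x|))
    {Q u v : E d → ℝ} (hQ : MemH2 Ω μ Q) (hu : MemH2 Ω μ u) (hv : ContDiff ℝ 2 v) :
    ∀ᵐ x ∂(volume.restrict Ω), |A.classical v x - (A.weak Ω Q x - A.weak Ω u x)| ≤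
      k * (|v x - (Q x - u x)|
        + (∑ i, |partialD i v x - (weakPartial Ω i Q x - weakPartial Ω i u x)|)
        + ∑ i, ∑ j, |partialD j (partialD i v) x - (weakPartial Ω j (weakPartial Ω i Q) x
            - weakPartial Ω j (weakPartial Ω i u) x)|) := by
  -- The Lipschitz condition is applied to Q and u + v, both in H²: its left side is |𝒜v − (𝒜Q −
  -- 𝒜u)|, with the C² function v treated classically.
  have jet := (WeakJet.of_memH2 hΩ hu).add (WeakJet.of_contDiff Ω hv)
  filter_upwards [lip Q _ hQ (hu.add_contDiff hΩ hΩb hμ hv), jet.weak_ae_eq hΩ A,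
    jet.ae_eq_fst hΩ, jet.ae_eq_snd hΩ] with x hx hw j1 j2
  have e : A.weak Ω (fun x => u x + v x) x = A.weak Ω u x + A.classical v x := by
    rw [hw]
    simp only [PDEOp.weak, PDEOp.classical, mul_add, Finset.sum_add_distrib]
    ring
  have sw : ∀ a b c : ℝ, |a - (b + c)| = |c - (a - b)| := fun a b c => by
    rw [← abs_neg]; congr 1; ring
  rw [← sw, ← e]
  refine hx.trans_eq ?_
  rw [sw]
  congr 2
  · congr 1
    exact Finset.sum_congr rfl fun i _ => by rw [j1, sw]
  · exact Finset.sum_congr rfl fun i _ => Finset.sum_congr rfl fun j _ => by rw [j2, sw]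

/-- Convergence of the sum of the absolute values of a function and its derivatives. -/
theorem tendsto_eLpNorm_sum_abs {ν : Measure (E d)} {a : ℕ → E d → ℝ} {ai : Fin d → ℕ → E d → ℝ}
    {aij : Fin d → Fin d → ℕ → E d → ℝ} (m : ∀ n, Measurable (a n)) (mi : ∀ i n, Measurable (ai i n))
    (mij : ∀ i j n, Measurable (aij i j n)) (t : Tendsto (fun n => eLpNorm (a n) 2 ν) atTop (𝓝 0))
    (ti : ∀ i, Tendsto (fun n => eLpNorm (ai i n) 2 ν) atTop (𝓝 0))
    (tij : ∀ i j, Tendsto (fun n => eLpNorm (aij i j n) 2 ν) atTop (𝓝 0)) :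
    Tendsto (fun n => eLpNorm (fun x => |a n x| + (∑ i, |ai i n x|) + ∑ i, ∑ j, |aij i j n x|) 2 ν)
      atTop (𝓝 0) := by
  have nrm : ∀ a : ℕ → E d → ℝ, Tendsto (fun n => eLpNorm (a n) 2 ν) atTop (𝓝 0) →
      Tendsto (fun n => eLpNorm (fun x => |a n x|) 2 ν) atTop (𝓝 0) := fun a ha => by
    have e : (fun n => eLpNorm (fun x => |a n x|) 2 ν) = fun n => eLpNorm (a n) 2 ν :=
      funext fun n => eLpNorm_norm (a n)
    rw [e]
    exact ha
  have q : ∀ f : E d → ℝ, Measurable f → AEStronglyMeasurable (fun x => |f x|) ν :=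
    fun f hf => hf.aestronglyMeasurable.norm
  have q1 : ∀ n, AEStronglyMeasurable (fun x => ∑ i, |ai i n x|) ν := fun n =>
    Finset.aestronglyMeasurable_fun_sum _ fun i _ => q _ (mi i n)
  have q2 : ∀ i n, AEStronglyMeasurable (fun x => ∑ j, |aij i j n x|) ν := fun i n =>
    Finset.aestronglyMeasurable_fun_sum _ fun j _ => q _ (mij i j n)
  exact tendsto_eLpNorm_add (fun n => (q _ (m n)).add (q1 n))
    (fun n => Finset.aestronglyMeasurable_fun_sum _ fun i _ => q2 i n)
    (tendsto_eLpNorm_add (fun n => q _ (m n)) q1 (nrm _ t)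
      (tendsto_eLpNorm_sum Finset.univ (fun i _ n => q _ (mi i n)) fun i _ => nrm _ (ti i)))
    (tendsto_eLpNorm_sum Finset.univ (fun i _ => q2 i) fun i _ =>
      tendsto_eLpNorm_sum Finset.univ (fun j _ n => q _ (mij i j n)) fun j _ => nrm _ (tij i j))

/-- The residual of a stationary point of the wide-limit ODE vanishes. -/
theorem weak_sub_ae_eq_zero {Ω : Set (E d)} (hΩ : IsOpen Ω) (hΩb : Bornology.IsBounded Ω)
    {μ : Measure (E d)} (hμ : IsSamplingMeasure Ω μ) {η : E d → ℝ} (hη : IsAuxiliary Ω η)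
    {A : PDEOp d} (hAm : A.IsMeasurable) (hA : A.IsLipschitz Ω μ) {σ : ℝ → ℝ} (hσ : IsCnb 4 σ)
    (hσc : ¬ ∃ s : ℝ, ∀ t, σ t = s) {π : Measure (Param d)} (hπ : IsInitLaw π) {Q u : E d → ℝ}
    (hQ : MemH20 Ω μ Q) (hu : MemH20 Ω μ u)
    (hs : ∀ᵐ y ∂μ, ∫ x, (A.weak Ω Q x - A.weak Ω u x) * kernelU A η σ π x y ∂μ = 0) :
    ∀ᵐ x ∂μ, A.weak Ω Q x - A.weak Ω u x = 0 := by
  have := hμ.finite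
  have hm := hΩ.measurableSet
  have hη3 : ContDiff ℝ 3 η := hη.contDiff
  obtain ⟨C, hC, hμν, hνμ⟩ := hμ.exists_le
  have hhL := memLp_weak_sub hμ.ac hAm hA hQ.1 hu.1
  obtain ⟨h, hhm, hh⟩ : ∃ h : E d → ℝ, Measurable h ∧
      ∀ᵐ x ∂μ, A.weak Ω Q x - A.weak Ω u x = h x :=
    ⟨hhL.1.mk _, hhL.1.stronglyMeasurable_mk.measurable, hhL.1.ae_eq_mk⟩
  have hL : MemLp h 2 μ := hhL.ae_eq hh
  obtain ⟨A', B, hA'm, hB0, ha, hb, hc, hAA'⟩ := exists_bounded_coefficients hΩ hΩb hμ hAm hA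
  have hAA : ∀ᵐ x ∂μ, ∀ φ : E d → ℝ, ContDiff ℝ 2 φ → A.classical φ x = A'.classical φ x :=
    hμ.ac.ae_le hAA'
  -- The features are C² in x, so for almost every x the kernel is unchanged when 𝒜 is replaced by
  -- its bounded version, with an exceptional set independent of p and y.
  have hs' : ∀ᵐ y ∂μ, ∫ x, h x * kernelU A' η σ π x y ∂μ = 0 := by
    filter_upwards [hs] with y hy
    rw [← hy]
    refine integral_congr_ae ?_
    filter_upwards [hh, hAA] with x hx hxA
    rw [hx, kernelU_eq hη3 hσ.1, kernelU_eq hη3 hσ.1]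
    congr 2
    funext p
    refine Finset.sum_congr rfl fun m _ => ?_
    rw [hxA]
    exact ((contDiff_feature hη3 hσ.1 m).of_le (by norm_num)).comp (contDiff_prodMk_right p)
  have orth := fun {g : E d → ℝ} => integral_classical_aux_mul_eq_zero (g := g) hΩ hΩb hμ hη hA'm
    hB0 ha hb hc hσ hσc hπ hhm (hL.integrable one_le_two) hs'
  obtain ⟨F, Fi, Fij, dF, wF, F0, F1, F2⟩ := hQ.exists_representatives hΩ hC hνμ
  obtain ⟨G, Gi, Gij, dG, wG, G0, G1, G2⟩ := hu.exists_representatives hΩ hC hνμ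
  -- Density is applied to Q − u, extended by zero, whose image under 𝒜 is the residual h.
  obtain ⟨g, hg, t0, t1, t2⟩ := exists_aux_mul_tendsto hΩ hΩb hη (f := fun x => F x - G x)
    (fi := fun i x => Fi i x - Gi i x) (fij := fun i j x => Fij i j x - Gij i j x)
    ⟨dF.l2.sub dG.l2, fun i => (dF.l2i i).sub (dG.l2i i), fun i j => (dF.l2ij i j).sub (dG.l2ij i j),
      fun i => (dF.wd i).sub hΩ (dG.wd i), fun i j => (dF.wdi i j).sub hΩ (dG.wdi i j)⟩
    fun k => (wF k).sub isOpen_univ (wG k)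
  obtain ⟨k, hk, lip⟩ := hA
  let v : ℕ → E d → ℝ := fun n x => η x * g n x
  have hv : ∀ n, ContDiff ℝ 2 (v n) := fun n =>
    (hη3.of_le (by norm_num)).mul (contDiff_infty.1 (hg n).1 2)
  have hv1 : ∀ n i, ContDiff ℝ 1 (partialD i (v n)) := fun n i =>
    contDiff_partialD (hv n) (by norm_num) i
  let D : ℕ → E d → ℝ := fun n x => |v n x - (F x - G x)|
    + (∑ i, |partialD i (v n) x - (Fi i x - Gi i x)|)
    + ∑ i, ∑ j, |partialD j (partialD i (v n)) x - (Fij i j x - Gij i j x)|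
  have main : ∀ n, ∀ᵐ x ∂(volume.restrict Ω),
      |A'.classical (v n) x - (A.weak Ω Q x - A.weak Ω u x)| ≤ k * D n x := by
    intro n
    filter_upwards [abs_classical_sub_weak_sub_le hΩ hΩb hμ lip hQ.1 hu.1 (hv n), hAA',
      F0, F1, F2, G0, G1, G2] with x hx hxA f0 f1 f2 g0 g1 g2
    rw [← hxA _ (hv n)]
    refine hx.trans_eq ?_
    simp only [f0, f1, f2, g0, g1, g2, D]
  have hD : Tendsto (fun n => eLpNorm (D n) 2 (volume.restrict Ω)) atTop (𝓝 0) :=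
    tendsto_eLpNorm_sum_abs
      (fun n => (hv n).continuous.measurable.sub (dF.l2.sub dG.l2).meas)
      (fun i n => (hv1 n i).continuous.measurable.sub ((dF.l2i i).sub (dG.l2i i)).meas)
      (fun i j n => (continuous_partialD (hv1 n i) j).measurable.sub
        ((dF.l2ij i j).sub (dG.l2ij i j)).meas) t0 t1 t2
  -- The Lipschitz bound dominates the distance from 𝒜(ηg_n) to h by the H² distance, and μ ≤ C ·
  -- Lebesgue transfers it to L²(μ).
  have hconv : Tendsto (fun n => eLpNorm (fun x => A'.classical (v n) x - h x) 2 μ) atTop (𝓝 0) := by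
    have h1 := ENNReal.Tendsto.const_mul (a := C ^ (1 / (2 : ℝ≥0∞)).toReal * ENNReal.ofReal k) hD
      (Or.inr (ENNReal.mul_ne_top (by simp [hC]) ENNReal.ofReal_ne_top))
    rw [mul_zero] at h1
    refine tendsto_of_tendsto_of_tendsto_of_le_of_le tendsto_const_nhds h1 (fun _ => zero_le)
      fun n => ?_
    have e : eLpNorm (fun x => A'.classical (v n) x - h x) 2 μ
        = eLpNorm (fun x => A'.classical (v n) x - (A.weak Ω Q x - A.weak Ω u x)) 2 μ :=
      eLpNorm_congr_ae (hh.mono fun x hx => by simp only [hx])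
    rw [e]
    refine (eLpNorm_le_of_measure_le_smul hμν).trans ?_
    rw [smul_eq_mul, mul_assoc]
    refine mul_le_mul_right ?_ _
    refine eLpNorm_le_mul_eLpNorm_of_ae_le_mul ?_ 2
    filter_upwards [main n] with x hx
    have hDn : 0 ≤ D n x := by positivity
    rwa [Real.norm_eq_abs, Real.norm_eq_abs, abs_of_nonneg hDn]
  have A'm : ∀ n, AEStronglyMeasurable (A'.classical (v n)) μ := fun n =>
    (((Finset.measurable_sum _ fun i _ => Finset.measurable_sum _ fun j _ =>
      (hA'm.1 i j).mul (continuous_partialD (hv1 n i) j).measurable).add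
      (Finset.measurable_sum _ fun i _ => (hA'm.2.1 i).mul (hv1 n i).continuous.measurable)).add
      (hA'm.2.2.mul (hv n).continuous.measurable)).aestronglyMeasurable
  have lim := tendsto_integral_mul_of_lintegral hL hL A'm (tendsto_lintegral_sq_of_eLpNorm hconv)
  -- Each 𝒜(ηg_n) is orthogonal to h and these functions converge to h, so h is orthogonal to
  -- itself.
  have z : ∫ x, h x * h x ∂μ = 0 := by
    refine tendsto_nhds_unique lim (tendsto_const_nhds.congr fun n => ?_)
    exact (orth (hg n).1 (hg n).2).symm
  have z' := (integral_eq_zero_iff_of_nonneg (fun x => mul_self_nonneg (h x))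
    (hL.integrable_mul hL)).1 z
  filter_upwards [hh, z'] with x hx hx'
  rw [hx]
  exact mul_self_eq_zero.1 hx'

end DGM

theorem mainTheorem6 (d : ℕ) (hd : 0 < d)
    (Ω : Set (DGM.E d)) (hΩ_open : IsOpen Ω) (hΩ_bdd : Bornology.IsBounded Ω)
    (hΩ_bdry : ∃ α : ℝ≥0, 0 < α ∧ α < 1 ∧ DGM.HasC3HolderBoundary α Ω)
    (μ : Measure (DGM.E d)) (hμ : DGM.IsSamplingMeasure Ω μ)
    (η : DGM.E d → ℝ) (hη : DGM.IsAuxiliary Ω η)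
    (A : DGM.PDEOp d) (hA_meas : A.IsMeasurable) (hA_lip : A.IsLipschitz Ω μ)
    (σ : ℝ → ℝ) (hσ : DGM.IsCnb 4 σ) (hσ_nonconst : ¬ ∃ s : ℝ, ∀ t, σ t = s)
    (π : Measure (DGM.Param d)) (hπ : DGM.IsInitLaw π)
    (g : DGM.E d → ℝ) (hsol : ∃ u : DGM.E d → ℝ, DGM.IsSolution Ω μ A g u)
    (Qstar : DGM.E d → ℝ) (hQ : DGM.IsStationary Ω μ A η σ π g Qstar) :
    DGM.IsSolution Ω μ A g Qstar ∧
      DGM.objective Ω μ A g Qstar = 0 ∧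
      ∀ Q : DGM.E d → ℝ, DGM.MemH20 Ω μ Q →
        DGM.objective Ω μ A g Qstar ≤ DGM.objective Ω μ A g Q := by
  obtain ⟨u, hu, hug⟩ := hsol
  -- The exact solution u replaces g by 𝒜u, so the residual becomes the image of a difference of two
  -- functions in H²₍₀₎.
  have hs : ∀ᵐ y ∂μ, ∫ x, (A.weak Ω Qstar x - A.weak Ω u x) * DGM.kernelU A η σ π x y ∂μ = 0 := by
    filter_upwards [hQ.2] with y hy
    rw [DGM.limitField, neg_eq_zero, DGM.opU] at hy
    rw [← hy]
    refine integral_congr_ae ?_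
    filter_upwards [hug] with x hx
    rw [hx]
  have h0 := DGM.weak_sub_ae_eq_zero hΩ_open hΩ_bdd hμ hη hA_meas hA_lip hσ hσ_nonconst hπ hQ.1 hu hs
  have h1 : ∀ᵐ x ∂μ, A.weak Ω Qstar x = g x := by
    filter_upwards [h0, hug] with x hx hx'
    rw [← hx']
    exact sub_eq_zero.1 hx
  have h2 : DGM.objective Ω μ A g Qstar = 0 := by
    rw [DGM.objective, ← integral_zero (DGM.E d) ℝ (μ := μ)]
    refine integral_congr_ae ?_
    filter_upwards [h1] with x hx
    rw [hx, sub_self, zero_pow two_ne_zero]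
  refine ⟨⟨hQ.1, h1⟩, h2, fun Q _ => ?_⟩
  rw [h2]
  exact integral_nonneg fun x => sq_nonneg _
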